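/- Let $w$ be a strictly positive real-analytic weight on the unit circle, let $\Phi_n$ ($n\ge 0$) be the monic orthogonal polynomials with respect to $w(z)\,|dz|$, and let $$D(w;z)=\exp\Big(\frac1{4\pi}\int_0^{2\pi}\log w(e^{i\theta})\,\frac{e^{i\theta}+z}{e^{i\theta}-z}\,d\theta\Big),\qquad |z|\ne 1,$$ be its Szegő function, written $D_{\rm i}$ for $|z|<1$ and $D_{\rm e}$ for $|z|>1$. Put $\tau=D_{\rm e}(\infty)=1/D_{\rm i}(0)=\exp\big(-\frac1{4\pi}\int_0^{2\pi}\log w(e^{i\theta})\,d\theta\big)$, and let $\rho$ be the infimum of the $r\in(0,1)$ such that $D_{\rm e}$ has a holomorphic continuation to $|z|>r$. Assume that for some $0\le\rho'<\rho$ the function $D_{\rm e}$ can be continued to $|z|>\rho'$ as a meromorphic function whose only singularities are (finitely many) poles $a_1,\dots,a_u$ on the circle $|z|=\rho$. Let $m$ be the maximal multiplicity of these poles, numbered so that $a_1,\dots,a_\ell$ ($1\le \ell\le u$) are exactly those of multiplicity $m$ (the dominant poles). Put $\widehat D_{\rm e}(a_k)=\lim_{z\to a_k}D_{\rm e}(z)(z-a_k)^m$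 for $k\le \ell$. (i) Let $\rho<r<1$, and let $\rho'\le\sigma<\rho$ be such that $D_{\rm e}$ is bounded on $\{\sigma<|z|<s\}$ for some $s>\sigma$ (this is automatic if $\sigma>\rho'$). There is a constant $0<C<\infty$, and for every $\varepsilon>0$ there is $0<\delta=\delta(\varepsilon)<1$, with $C$ independent of $n$ and $\varepsilon$ and $\delta$ independent of $n$, such that for all $n\ge1$ and all $z$ with $\sigma<|z|\le r-\varepsilon$ and $|z-a_k|\ge\varepsilon$ for $k=1,\dots,u$, $$\Phi_n(z)=\frac{D_{\rm e}(z)}{D_{\rm e}(\infty)}\,z^n+\frac{D_{\rm i}(0)}{D_{\rm i}(z)}\sum_{k=1}^{\ell}\binom{n}{m-1}a_k^{n-m+1}\,\frac{D_{\rm i}(a_k)\,\widehat D_{\rm e}(a_k)}{a_k-z}+h_n(z),$$ where $$|h_n(z)|\le\begin{cases}C\,(\rho^n\delta^n+r^{3n}), & m=1,\\[2pt] \dfrac{C}{\varepsilon^{m}}\,n^{m-2}\rho^n, & m\ge2.\end{cases}$$ (ii) For every compact $K\subset\{|z|<\rho\}$ there are constants $0<C<\infty$ and $0<\delta<1$ such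 that for all $z\in K$ and all $n\ge\max(1,m-1)$, $$\left|\frac{\tau D_{\rm i}(z)}{a_1^{n-m+1}}\binom{n}{m-1}^{-1}\Phi_n(z)-\sum_{k=1}^{\ell}\frac{D_{\rm i}(a_k)\,\widehat D_{\rm e}(a_k)}{a_k-z}\,e^{2\pi i(n-m+1)\theta_k}\right|\le\begin{cases}C\,\delta^n, & m=1,\\ C/n, & m\ge2,\end{cases}$$ where $\theta_1=1$ and $\theta_k=\frac1{2\pi}(\arg a_k-\arg a_1)$ for $k=2,\dots,\ell$. (iii) For every compact $K\subset\{|z|<\rho\}$ and all sufficiently large $n$, $\Phi_n$ has at most $\ell-1$ zeros on $K$, counted with multiplicity. -/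

import Mathlib

open Filter Topology Polynomial

noncomputable section

/-- The Szegő function `D(w; z)` of a weight `w` on the unit circle, for `|z| ≠ 1`.
Its restriction to `|z| < 1` is `D_i(w; ·)`, its restriction to `|z| > 1` is `D_e(w; ·)`. -/
def szegoD (w : Circle → ℝ) (z : ℂ) : ℂ :=
  Complex.exp ((1 / (4 * (Real.pi : ℂ))) *
    ∫ θ in (0 : ℝ)..(2 * Real.pi), (Real.log (w (Circle.exp θ)) : ℂ) *
      (((Circle.exp θ : ℂ) + z) / ((Circle.exp θ : ℂ) - z)))

/-- The constant `τ = D_e(w; ∞) = 1 / D_i(w; 0)`. -/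
def szegoTau (w : Circle → ℝ) : ℝ :=
  Real.exp (-(1 / (4 * Real.pi)) *
    ∫ θ in (0 : ℝ)..(2 * Real.pi), Real.log (w (Circle.exp θ)))

/-- The critical radius: the infimum of the `r ∈ (0, 1)` such that `D_e(w; ·)`, given on `|z| > 1`,
has a holomorphic continuation to `|z| > r`. -/
def szegoRadius (w : Circle → ℝ) : ℝ :=
  sInf {r : ℝ | 0 < r ∧ r < 1 ∧ ∃ F : ℂ → ℂ,
    DifferentiableOn ℂ F {z | r < ‖z‖} ∧ ∀ z : ℂ, 1 < ‖z‖ → F z = szegoD w z}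

/-- `φ` is the sequence of orthonormal polynomials for the measure `w(z) |dz|` on the unit circle:
`φ n` has degree `n` and positive leading coefficient. -/
structure IsOrthonormalSystem (w : Circle → ℝ) (φ : ℕ → ℂ[X]) : Prop where
  natDegree_eq : ∀ n, (φ n).natDegree = n
  leadingCoeff_pos : ∀ n, ∃ κ : ℝ, 0 < κ ∧ (φ n).leadingCoeff = (κ : ℂ)
  orthonormal : ∀ m n, ∫ θ in (0 : ℝ)..(2 * Real.pi),
      (φ n).eval (Circle.exp θ : ℂ) * (starRingEnd ℂ) ((φ m).eval (Circle.exp θ : ℂ)) *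
        (w (Circle.exp θ) : ℂ) = if m = n then 1 else 0

/-- The monic orthogonal polynomial `Φ_n = φ_n / κ_n`. -/
def monicOP (φ : ℕ → ℂ[X]) (n : ℕ) : ℂ[X] :=
  C ((φ n).leadingCoeff)⁻¹ * φ n

/-- `a` is a pole of `f`. -/
def IsPoleAt (f : ℂ → ℂ) (a : ℂ) : Prop :=
  MeromorphicAt f a ∧ meromorphicOrderAt f a < 0

/-- The multiplicity of a pole `a` of `f`. -/
def poleMult (f : ℂ → ℂ) (a : ℂ) : ℕ :=
  (-(meromorphicOrderAt f a).untop₀).toNat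

/-- `a` is a dominant pole of `f` in the region `U`: every other singularity `b` of `f` in `U` has
smaller modulus, or has the same modulus and is a pole of at most the multiplicity of `a`. -/
def IsDominantPole (f : ℂ → ℂ) (U : Set ℂ) (a : ℂ) : Prop :=
  a ∈ U ∧ IsPoleAt f a ∧ ∀ b ∈ U, b ≠ a → ¬ AnalyticAt ℂ f b →
    ‖b‖ < ‖a‖ ∨ (‖b‖ = ‖a‖ ∧ IsPoleAt f b ∧ poleMult f b ≤ poleMult f a)

/-- `lim_{z → a} f(z) (z - a)^m`. -/
def poleCoeff (f : ℂ → ℂ) (m : ℕ) (a : ℂ) : ℂ :=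
  limUnder (𝓝[≠] a) (fun z => f z * (z - a) ^ m)

/-- The angles `θ_1 = 1` and `θ_k = (arg a_k - arg a_1) / (2π)` for `k ≥ 2`
(the index `k` starts at `0` here). -/
def relAngle {l : ℕ} (hl : 0 < l) (a : Fin l → ℂ) (k : Fin l) : ℝ :=
  if (k : ℕ) = 0 then 1 else (Complex.arg (a k) - Complex.arg (a ⟨0, hl⟩)) / (2 * Real.pi)

open Classical in
/-- The number of zeros of `p` in `K`, counted with multiplicity (for `p ≠ 0`). -/
def numZerosIn (p : ℂ[X]) (K : Set ℂ) : ℕ :=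
  (p.roots.filter (fun z => z ∈ K)).card

end

/-! Write D for the continuation of D_i across the unit circle. Reflection gives D_e(z) =
1/conj(D_i(1/conj z)), and Poisson integrals give |D_e|² w = 1 on the circle, so w = D/D_e there
(`exists_szegoExtension`). In a thin annulus 1 < |z| < R, orthogonality of Φ_n to 1, …, z^(n-1)
turns the Laurent splitting of (D/D_e) Φ_n into z^n A_n + B_n, with A_n holomorphic in |z| < R and
B_n holomorphic in |z| > 1 and zero at infinity (`SzegoExtension.weight_mul_eq`). This replaces a
Riemann–Hilbert problem and has two consequences.

Multiplied by D_e and integrated against the Cauchy kernel, the B_n term disappears, so D(z) Φ_n(z)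
is the Cauchy integral of t^n A_n D_e over the unit circle (`SzegoExtension.mul_monicOP_eq`).
Divided by z^n D, the identity expresses A_n/D - 1/τ as a Cauchy integral of B_n/(t^n D), whose
circle can be enlarged to any radius below 1/ρ. Since the weighted mean of |Φ_n| is bounded
uniformly in n, so is B_n on that circle, and A_n = D/τ + O(q^n) for every q > ρ
(`SzegoExtension.exists_norm_interiorPart_sub_le`).

The rest of (i) and (ii) is residue calculus. Put D_e = principal parts + Q, with Q regular across
|z| = ρ. The residue at t = z gives the D_e z^n term. The residues at the a_k give derivatives of
t^n A_n, of which the highest, at the poles of top order, dominates and equals binom(n, m-1)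
a_k^(n-m+1) D(a_k)/τ up to lower order. The Q part is handled on a circle inside |t| = ρ and costs
only q^n with q < ρ. For m = 1 the residue errors combine with the error in z^n D_e into divided
differences of t^n (A_n - D/τ), so no loss occurs near the poles.

For (iii), suppose ℓ zeros lie in |z| ≤ κ < ρ, with monic zero polynomial Q_ℓ. Testing the
asymptotics against A/Q_ℓ, where A vanishes at all dominant poles but one, isolates the coefficient
at that pole and forces it to tend to 0 (`norm_residue_mul_le`). Its modulus is a nonzero constant.
-/

/-! ### Contour integrals over circles centred at the origin -/

/-- The normalized contour integral `(2πi)⁻¹ ∮_{|t| = R} f(t) dt`. -/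
noncomputable def cInt (R : ℝ) (f : ℂ → ℂ) : ℂ :=
  (2 * Real.pi * Complex.I : ℂ)⁻¹ * ∮ t in C(0, R), f t

theorem AnalyticAt.dslope {f : ℂ → ℂ} {a z : ℂ} (ha : AnalyticAt ℂ f a) (hz : AnalyticAt ℂ f z) :
    AnalyticAt ℂ (dslope f a) z := by
  by_cases h : z = a
  · subst h
    obtain ⟨p, hp⟩ := ha
    exact ⟨_, hp.has_fpower_series_dslope_fslope⟩
  · have h1 : AnalyticAt ℂ (fun t => (t - a)⁻¹ * (f t - f a)) z :=
      ((analyticAt_id.sub analyticAt_const).inv (sub_ne_zero.2 h)).mul (hz.sub analyticAt_const)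
    refine h1.congr ?_
    filter_upwards [dslope_eventuallyEq_slope_of_ne f h] with t ht
    rw [ht, slope_def_field]
    ring

theorem circleIntegrable_of_analyticAt {R : ℝ} (hR : 0 ≤ R) {f : ℂ → ℂ}
    (hf : ∀ z, ‖z‖ = R → AnalyticAt ℂ f z) : CircleIntegrable f 0 R :=
  ContinuousOn.circleIntegrable hR fun z hz =>
    (hf z (by simpa using hz)).continuousAt.continuousWithinAt

theorem cInt_congr {R : ℝ} (hR : 0 ≤ R) {f g : ℂ → ℂ} (h : ∀ z, ‖z‖ = R → f z = g z) :
    cInt R f = cInt R g := by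
  unfold cInt
  rw [circleIntegral.integral_congr hR fun z hz => h z (by simpa using hz)]

theorem cInt_add {R : ℝ} {f g : ℂ → ℂ} (hf : CircleIntegrable f 0 R) (hg : CircleIntegrable g 0 R) :
    cInt R (fun t => f t + g t) = cInt R f + cInt R g := by
  unfold cInt
  rw [circleIntegral.integral_add hf hg, mul_add]

theorem cInt_sub {R : ℝ} {f g : ℂ → ℂ} (hf : CircleIntegrable f 0 R) (hg : CircleIntegrable g 0 R) :
    cInt R (fun t => f t - g t) = cInt R f - cInt R g := by
  unfold cInt
  rw [circleIntegral.integral_sub hf hg, mul_sub]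

theorem cInt_const_mul (R : ℝ) (c : ℂ) (f : ℂ → ℂ) :
    cInt R (fun t => c * f t) = c * cInt R f := by
  unfold cInt
  rw [circleIntegral.integral_const_mul]
  ring

theorem cInt_sum {R : ℝ} {ι : Type*} (s : Finset ι) {f : ι → ℂ → ℂ}
    (hf : ∀ i ∈ s, CircleIntegrable (f i) 0 R) :
    cInt R (fun t => ∑ i ∈ s, f i t) = ∑ i ∈ s, cInt R (f i) := by
  unfold cInt
  rw [circleIntegral.integral_fun_sum hf, Finset.mul_sum]

theorem norm_cInt_le {R M : ℝ} (hR : 0 ≤ R) {f : ℂ → ℂ} (h : ∀ z, ‖z‖ = R → ‖f z‖ ≤ M) :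
    ‖cInt R f‖ ≤ R * M := by
  have := circleIntegral.norm_two_pi_i_inv_smul_integral_le_of_norm_le_const (c := 0) (f := f) hR
    (fun z hz => h z (by simpa using hz))
  simpa [cInt, smul_eq_mul] using this

theorem cInt_deform {r R : ℝ} (hr : 0 < r) (hrR : r ≤ R) {f : ℂ → ℂ}
    (hf : ∀ z, r ≤ ‖z‖ → ‖z‖ ≤ R → AnalyticAt ℂ f z) : cInt R f = cInt r f := by
  unfold cInt
  rw [Complex.circleIntegral_eq_of_differentiable_on_annulus_off_countable hr hrR
    Set.countable_empty (f := f)]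
  · intro z hz
    have h1 : ‖z‖ ≤ R := by simpa using hz.1
    have h2 : r ≤ ‖z‖ := by simpa using hz.2
    exact (hf z h2 h1).continuousAt.continuousWithinAt
  · intro z hz
    have h1 : ‖z‖ < R := by simpa using hz.1.1
    have h2 : r < ‖z‖ := by simpa using hz.1.2
    exact (hf z h2.le h1.le).differentiableAt

theorem cInt_eq_zero {R : ℝ} (hR : 0 ≤ R) {f : ℂ → ℂ} (hf : ∀ z, ‖z‖ ≤ R → AnalyticAt ℂ f z) :
    cInt R f = 0 := by
  unfold cInt
  rw [Complex.circleIntegral_eq_zero_of_differentiable_on_off_countable hR Set.countable_empty,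
    mul_zero]
  · exact fun z hz => (hf z (by simpa using hz)).continuousAt.continuousWithinAt
  · intro z hz
    have h1 : ‖z‖ < R := by simpa using hz.1
    exact (hf z h1.le).differentiableAt

theorem two_pi_I_inv_mul (x : ℂ) :
    (2 * Real.pi * Complex.I : ℂ)⁻¹ * (2 * Real.pi * Complex.I * x) = x := by
  have : (2 * Real.pi * Complex.I : ℂ) ≠ 0 := by
    simp [Real.pi_ne_zero]
  field_simp

theorem cInt_cauchy {R : ℝ} {f : ℂ → ℂ} (hf : ∀ z, ‖z‖ ≤ R → AnalyticAt ℂ f z) {z : ℂ}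
    (hz : ‖z‖ < R) : cInt R (fun t => f t / (t - z)) = f z := by
  unfold cInt
  rw [Complex.circleIntegral_div_sub_of_differentiable_on_off_countable Set.countable_empty
    (by simpa using hz), two_pi_I_inv_mul]
  · exact fun z hz => (hf z (by simpa using hz)).continuousAt.continuousWithinAt
  · intro z hz
    have h1 : ‖z‖ < R := by simpa using hz.1
    exact (hf z h1.le).differentiableAt

theorem sub_ne_zero_of_norm_lt {t z : ℂ} (h : ‖z‖ < ‖t‖) : t - z ≠ 0 := by
  intro h0
  rw [sub_eq_zero.1 h0] at h
  exact lt_irrefl _ h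

theorem sub_ne_zero_of_norm_gt {t z : ℂ} (h : ‖t‖ < ‖z‖) : t - z ≠ 0 := by
  intro h0
  rw [sub_eq_zero.1 h0] at h
  exact lt_irrefl _ h

theorem analyticAt_div_sub {f : ℂ → ℂ} {t z : ℂ} (hf : AnalyticAt ℂ f t) (h : t - z ≠ 0) :
    AnalyticAt ℂ (fun t => f t / (t - z)) t :=
  hf.div (analyticAt_id.sub analyticAt_const) h

/-- The divided difference of f at z is analytic in the whole closed annulus, so its integrals over
the two circles agree; separating the constant f z in each integral gives the formula. -/
theorem cInt_annulus {r R : ℝ} (hr : 0 < r) {f : ℂ → ℂ}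
    (hf : ∀ z, r ≤ ‖z‖ → ‖z‖ ≤ R → AnalyticAt ℂ f z) {z : ℂ} (hz1 : r < ‖z‖) (hz2 : ‖z‖ < R) :
    f z = cInt R (fun t => f t / (t - z)) - cInt r (fun t => f t / (t - z)) := by
  have hz := hf z hz1.le hz2.le
  have key : cInt R (dslope f z) = cInt r (dslope f z) :=
    cInt_deform hr (hz1.trans hz2).le fun t h1 h2 => hz.dslope (hf t h1 h2)
  have hslope : ∀ t, t - z ≠ 0 → dslope f z t = f t / (t - z) - f z / (t - z) := by
    intro t ht
    rw [dslope_of_ne _ (sub_ne_zero.1 ht), slope_def_field]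
    ring
  have hR : 0 < R := hr.trans (hz1.trans hz2)
  have e1 : cInt R (dslope f z) = cInt R (fun t => f t / (t - z)) - f z := by
    rw [cInt_congr hR.le (g := fun t => f t / (t - z) - f z / (t - z))
      (fun t ht => hslope t (sub_ne_zero_of_norm_lt (ht ▸ hz2))), cInt_sub, cInt_cauchy
      (f := fun _ => f z) (fun _ _ => analyticAt_const) hz2]
    · exact circleIntegrable_of_analyticAt hR.le fun t ht =>
        analyticAt_div_sub (hf t (ht ▸ (hz1.trans hz2).le) ht.le)
          (sub_ne_zero_of_norm_lt (ht ▸ hz2))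
    · exact circleIntegrable_of_analyticAt hR.le fun t ht =>
        analyticAt_div_sub analyticAt_const (sub_ne_zero_of_norm_lt (ht ▸ hz2))
  have e2 : cInt r (dslope f z) = cInt r (fun t => f t / (t - z)) := by
    rw [cInt_congr hr.le (g := fun t => f t / (t - z) - f z / (t - z))
      (fun t ht => hslope t (sub_ne_zero_of_norm_gt (ht ▸ hz1))), cInt_sub,
      cInt_eq_zero hr.le (f := fun t => f z / (t - z)), sub_zero]
    · exact fun t ht => analyticAt_div_sub analyticAt_const
        (sub_ne_zero_of_norm_gt (ht.trans_lt hz1))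
    · exact circleIntegrable_of_analyticAt hr.le fun t ht =>
        analyticAt_div_sub (hf t ht.ge (ht ▸ (hz1.trans hz2).le))
          (sub_ne_zero_of_norm_gt (ht ▸ hz1))
    · exact circleIntegrable_of_analyticAt hr.le fun t ht =>
        analyticAt_div_sub analyticAt_const (sub_ne_zero_of_norm_gt (ht ▸ hz1))
  rw [e1, e2] at key
  linear_combination -key

/-- Residue at infinity: the circle is enlarged until f is within ε/|t| of c/t. -/
theorem cInt_eq_of_tendsto {R : ℝ} (hR : 0 < R) {f : ℂ → ℂ} {c : ℂ}
    (hf : ∀ z, R ≤ ‖z‖ → AnalyticAt ℂ f z)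
    (hlim : Tendsto (fun t => t * f t) (Bornology.cobounded ℂ) (𝓝 c)) : cInt R f = c := by
  refine eq_of_sub_eq_zero (norm_eq_zero.1 (le_antisymm (le_of_forall_pos_le_add ?_)
    (norm_nonneg _)))
  intro ε hε
  rw [zero_add]
  have h1 := (Metric.tendsto_nhds.1 hlim ε hε)
  rw [← comap_norm_atTop, eventually_comap, eventually_atTop] at h1
  obtain ⟨M, hM⟩ := h1
  set S := max M R
  have hS : 0 < S := hR.trans_le (le_max_right _ _)
  have h0 : ∀ t : ℂ, ‖t‖ = S → t ≠ 0 := fun t ht h => by simp [h] at ht; exact hS.ne ht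
  rw [← cInt_deform hR (le_max_right M R) (fun z hz _ => hf z hz),
    ← cInt_cauchy (f := fun _ => c) (z := 0) (R := S) (fun _ _ => analyticAt_const) (by simpa),
    ← cInt_sub]
  · refine (norm_cInt_le (M := ε / S) hS.le fun t ht => ?_).trans_eq (by field_simp)
    have h2 := (hM S (le_max_left _ _) t ht).le
    have ht0 := h0 t ht
    have : f t - c / (t - 0) = (t * f t - c) / t := by field_simp; ring
    rw [this, norm_div, ht]
    rw [dist_eq_norm] at h2
    gcongr
  · exact circleIntegrable_of_analyticAt hS.le fun t ht => hf t (ht ▸ le_max_right _ _)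
  · exact circleIntegrable_of_analyticAt hS.le fun t ht =>
      analyticAt_div_sub analyticAt_const (by simpa using h0 t ht)

theorem analyticAt_cInt_div_sub {R : ℝ} (hR : 0 < R) {f : ℂ → ℂ} (hf : CircleIntegrable f 0 R)
    {z : ℂ} (hz : ‖z‖ < R) : AnalyticAt ℂ (fun z => cInt R fun t => f t / (t - z)) z := by
  lift R to NNReal using hR.le
  have h := hasFPowerSeriesOn_cauchy_integral hf (by simpa using hR)
  have h2 := h.analyticAt_of_mem (y := z) (by simpa [enorm_eq_nnnorm, ← NNReal.coe_lt_coe] using hz)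
  refine h2.congr (Eventually.of_forall fun w => ?_)
  simp [cInt, smul_eq_mul, div_eq_inv_mul]

theorem norm_le_of_norm_le_sphere {R M : ℝ} (hR : 0 < R) {f : ℂ → ℂ}
    (hf : ∀ z, ‖z‖ ≤ R → AnalyticAt ℂ f z) (h : ∀ z, ‖z‖ = R → ‖f z‖ ≤ M) {z : ℂ} (hz : ‖z‖ ≤ R) :
    ‖f z‖ ≤ M := by
  refine Complex.norm_le_of_forall_mem_frontier_norm_le (U := Metric.ball 0 R)
    Metric.isBounded_ball ?_ (fun w hw => ?_) ?_
  · refine DifferentiableOn.diffContOnCl fun w hw => ?_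
    rw [closure_ball _ hR.ne'] at hw
    exact (hf w (by simpa using hw)).differentiableAt.differentiableWithinAt
  · rw [frontier_ball _ hR.ne'] at hw
    exact h w (by simpa using hw)
  · rw [closure_ball _ hR.ne']
    simpa using hz

/-- By the maximum principle it suffices to look at the circle of radius R. The gain is a bound that
does not degenerate as z approaches a. -/
theorem norm_dslope_le {R M : ℝ} {f : ℂ → ℂ} (hf : ∀ z, ‖z‖ ≤ R → AnalyticAt ℂ f z)
    (h : ∀ z, ‖z‖ ≤ R → ‖f z‖ ≤ M) {a z : ℂ} (ha : ‖a‖ < R) (hz : ‖z‖ ≤ R) :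
    ‖dslope f a z‖ ≤ 2 * M / (R - ‖a‖) := by
  have hR : 0 < R := (norm_nonneg a).trans_lt ha
  refine norm_le_of_norm_le_sphere hR (fun w hw => (hf a ha.le).dslope (hf w hw)) (fun w hw => ?_) hz
  have hne : w - a ≠ 0 := sub_ne_zero_of_norm_lt (hw ▸ ha)
  rw [dslope_of_ne _ (sub_ne_zero.1 hne), slope_def_field, norm_div]
  have h1 : ‖f w - f a‖ ≤ 2 * M := (norm_sub_le _ _).trans (by linarith [h w hw.le, h a ha.le])
  have h2 : R - ‖a‖ ≤ ‖w - a‖ := by rw [← hw]; exact norm_sub_norm_le _ _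
  have h3 : 0 < R - ‖a‖ := by linarith
  have h4 : 0 ≤ M := (norm_nonneg _).trans (h a ha.le)
  gcongr

/-- Differentiation under the integral sign; the power series argument used inside the circle is not
available outside. -/
theorem analyticAt_cInt_div_sub_of_lt_norm {R : ℝ} (hR : 0 < R) {f : ℂ → ℂ}
    (hf : CircleIntegrable f 0 R) {z : ℂ} (hz : R < ‖z‖) :
    AnalyticAt ℂ (fun z => cInt R fun t => f t / (t - z)) z := by
  have hopen : IsOpen {z : ℂ | R < ‖z‖} := isOpen_lt continuous_const continuous_norm
  refine DifferentiableOn.analyticAt (s := {z : ℂ | R < ‖z‖}) (fun w hw => ?_)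
    (hopen.mem_nhds hz)
  refine DifferentiableAt.differentiableWithinAt ?_
  unfold cInt circleIntegral
  refine DifferentiableAt.const_mul ?_ _
  have hw : R < ‖w‖ := hw
  obtain ⟨d, hd⟩ : ∃ d, d = (‖w‖ - R) / 2 := ⟨_, rfl⟩
  have hd0 : 0 < d := by rw [hd]; linarith
  have hdist : ∀ x ∈ Metric.ball w d, ∀ θ : ℝ, d ≤ ‖circleMap 0 R θ - x‖ := by
    intro x hx θ
    have h1 : ‖w‖ - ‖x‖ ≤ ‖w - x‖ := norm_sub_norm_le _ _
    have h2 : ‖w - x‖ < d := by rw [← dist_eq_norm, dist_comm]; exact hx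
    have h3 : ‖x‖ - ‖circleMap 0 R θ‖ ≤ ‖circleMap 0 R θ - x‖ := by
      rw [norm_sub_rev]; exact norm_sub_norm_le _ _
    have h4 : ‖circleMap 0 R θ‖ = R := by simp [abs_of_pos hR]
    linarith
  have hgm : MeasureTheory.AEStronglyMeasurable (fun θ ↦ f (circleMap 0 R θ))
      (MeasureTheory.volume.restrict (Set.uIoc 0 (2 * Real.pi))) :=
    (intervalIntegrable_iff.1 hf).aestronglyMeasurable
  have hmeas : ∀ k : ℕ, ∀ x, MeasureTheory.AEStronglyMeasurable
      (fun θ ↦ deriv (circleMap 0 R) θ • (f (circleMap 0 R θ) / (circleMap 0 R θ - x) ^ k))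
      (MeasureTheory.volume.restrict (Set.uIoc 0 (2 * Real.pi))) := by
    intro k x
    simp only [deriv_circleMap, smul_eq_mul, div_eq_mul_inv]
    refine MeasureTheory.AEStronglyMeasurable.mul
      (Measurable.aestronglyMeasurable (by fun_prop)) (hgm.mul ?_)
    exact Measurable.aestronglyMeasurable (by fun_prop)
  refine (intervalIntegral.hasDerivAt_integral_of_dominated_loc_of_deriv_le
    (F' := fun x θ ↦ deriv (circleMap 0 R) θ • (f (circleMap 0 R θ) / (circleMap 0 R θ - x) ^ 2))
    (bound := fun θ ↦ R * (‖f (circleMap 0 R θ)‖ * (d ^ 2)⁻¹))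
    (Metric.ball_mem_nhds w hd0) ?_ ?_ (hmeas 2 w) ?_ ?_ ?_).2.differentiableAt
  · filter_upwards with x
    simpa using hmeas 1 x
  · have : CircleIntegrable (fun t => f t / (t - w)) 0 R := by
      simp only [div_eq_mul_inv]
      refine hf.mul_continuousOn ?_
      intro t ht
      have ht' : ‖t‖ = R := by simpa [abs_of_pos hR] using ht
      exact ((continuousAt_id.sub continuousAt_const).inv₀
        (sub_ne_zero_of_norm_gt (ht' ▸ hw))).continuousWithinAt
    simpa using this.out
  · filter_upwards with θ _ x hx
    rw [norm_smul, norm_div, norm_pow, deriv_circleMap, norm_mul, Complex.norm_I, mul_one,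
      norm_circleMap_zero, abs_of_pos hR, div_eq_mul_inv]
    gcongr
    exact hdist x hx θ
  · exact ((IntervalIntegrable.norm hf).mul_const _).const_mul _
  · filter_upwards with θ _ x hx
    have h0 : circleMap 0 R θ - x ≠ 0 := by
      have := hd0.trans_le (hdist x hx θ)
      exact norm_pos_iff.1 this
    have h1 := (((hasDerivAt_id' x).const_sub (circleMap 0 R θ)).inv h0).const_mul
      (deriv (circleMap 0 R) θ * f (circleMap 0 R θ))
    refine (h1.congr_deriv (by rw [smul_eq_mul]; ring)).congr_of_eventuallyEq
      (Eventually.of_forall fun y => ?_)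
    simp only [Pi.inv_apply, smul_eq_mul, div_eq_mul_inv, mul_assoc]

/-! ### Poisson integrals and radial limits -/

theorem continuousOn_re_herglotz {z : ℂ} (hz : ‖z‖ < 1) :
    ContinuousOn (fun ζ : ℂ => ((ζ + z) / (ζ - z)).re) (Metric.sphere 0 1) := by
  refine Complex.continuous_re.comp_continuousOn (ContinuousOn.div (by fun_prop) (by fun_prop) ?_)
  intro ζ hζ
  exact sub_ne_zero_of_norm_lt (by simpa using (by simpa using hζ : ‖ζ‖ = 1) ▸ hz)

theorem re_herglotz_nonneg {z ζ : ℂ} (hz : ‖z‖ < 1) (hζ : ‖ζ‖ = 1) :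
    0 ≤ ((ζ + z) / (ζ - z)).re := by
  have h := le_re_herglotzRieszKernel (c := 0) (R := 1) (z := ζ) (w := z) (by simpa using hζ)
    (by simpa using hz)
  simp only [sub_zero] at h
  refine le_trans ?_ h
  have := norm_nonneg z
  apply div_nonneg <;> linarith

theorem circleAverage_re_herglotz_mul_re {f : ℂ → ℂ} (hf : Differentiable ℂ f) {z : ℂ}
    (hz : ‖z‖ < 1) :
    Real.circleAverage (fun ζ => ((ζ + z) / (ζ - z)).re * (f ζ).re) 0 1 = (f z).re := by
  have h := DiffContOnCl.circleAverage_re_herglotzRieszKernel_smul' (c := 0) (R := 1) (w := z)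
    hf.diffContOnCl (by simpa using hz)
  simp only [sub_zero] at h
  rw [← h]
  have hci : CircleIntegrable (fun ζ => ((ζ + z) / (ζ - z)).re • f ζ) 0 1 :=
    ((continuousOn_re_herglotz hz).smul hf.continuous.continuousOn).circleIntegrable zero_le_one
  have h2 := Complex.reCLM.circleAverage_comp_comm hci
  rw [Complex.reCLM_apply] at h2
  rw [← h2]
  congr 1
  ext ζ
  simp

/-- A Korovkin-type majorant: on the circle ‖ζ - ζ₀‖² is the real part of an affine function of ζ,
so the Poisson integral of the right side is known exactly. -/
theorem exists_abs_sub_le_add_mul_sq {g : ℂ → ℝ} (hg : ContinuousOn g (Metric.sphere 0 1))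
    {ζ₀ : ℂ} (h0 : ‖ζ₀‖ = 1) {ε : ℝ} (hε : 0 < ε) :
    ∃ M, 0 ≤ M ∧ ∀ ζ, ‖ζ‖ = 1 → |g ζ - g ζ₀| ≤ ε + M * ‖ζ - ζ₀‖ ^ 2 := by
  obtain ⟨B, hB⟩ := (isCompact_sphere (0 : ℂ) 1).exists_bound_of_continuousOn hg
  have hB0 : ∀ ζ : ℂ, ‖ζ‖ = 1 → |g ζ| ≤ B := fun ζ hζ => hB ζ (by simpa using hζ)
  obtain ⟨δ, hδ, h⟩ := Metric.continuousOn_iff.1 hg ζ₀ (by simpa using h0) ε hε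
  have hBn : 0 ≤ B := (abs_nonneg _).trans (hB0 ζ₀ h0)
  refine ⟨2 * B / δ ^ 2, by positivity, fun ζ hζ => ?_⟩
  by_cases hd : dist ζ ζ₀ < δ
  · have := h ζ (by simpa using hζ) hd
    rw [Real.dist_eq] at this
    have h3 : 0 ≤ 2 * B / δ ^ 2 * ‖ζ - ζ₀‖ ^ 2 := by positivity
    linarith
  · rw [not_lt, dist_eq_norm] at hd
    have h1 : |g ζ - g ζ₀| ≤ 2 * B := (abs_sub _ _).trans (by linarith [hB0 ζ hζ, hB0 ζ₀ h0])
    have h2 : 2 * B ≤ 2 * B / δ ^ 2 * ‖ζ - ζ₀‖ ^ 2 := by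
      rw [div_mul_eq_mul_div, le_div_iff₀ (by positivity)]
      gcongr
    linarith

theorem norm_sub_sq_of_norm_one {ζ ζ₀ : ℂ} (h : ‖ζ‖ = 1) (h0 : ‖ζ₀‖ = 1) :
    ‖ζ - ζ₀‖ ^ 2 = 2 - 2 * (ζ * (starRingEnd ℂ) ζ₀).re := by
  rw [← Complex.normSq_eq_norm_sq, Complex.normSq_sub, Complex.normSq_eq_norm_sq,
    Complex.normSq_eq_norm_sq, h, h0]
  ring

/-- Positivity of the kernel squeezes the Poisson integral of g between those of g ζ₀ ± the
quadratic majorant, and at r ζ₀ the majorant takes the value ε/2 + M(2 - 2r). -/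
theorem tendsto_poisson_radial {g : ℂ → ℝ} (hg : ContinuousOn g (Metric.sphere 0 1))
    {ζ₀ : ℂ} (h0 : ‖ζ₀‖ = 1) :
    Tendsto (fun r : ℝ => Real.circleAverage
      (fun ζ => ((ζ + r * ζ₀) / (ζ - r * ζ₀)).re * g ζ) 0 1) (𝓝[<] 1) (𝓝 (g ζ₀)) := by
  rw [Metric.tendsto_nhds]
  intro ε hε
  obtain ⟨M, hM0, hM⟩ := exists_abs_sub_le_add_mul_sq hg h0 (half_pos hε)
  have hr1 : ∀ᶠ r : ℝ in 𝓝[<] 1, M * (2 - 2 * r) < ε / 2 := by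
    have : Tendsto (fun r : ℝ => M * (2 - 2 * r)) (𝓝[<] 1) (𝓝 (M * (2 - 2 * 1))) :=
      (Continuous.tendsto (by fun_prop) 1).mono_left nhdsWithin_le_nhds
    refine this.eventually_lt_const ?_
    simpa using hε
  have hr2 : ∀ᶠ r : ℝ in 𝓝[<] 1, 0 < r ∧ r < 1 := Ioo_mem_nhdsLT zero_lt_one
  filter_upwards [hr1, hr2] with r hr ⟨hr0, hr1⟩
  set z : ℂ := r * ζ₀ with hzdef
  have hz : ‖z‖ < 1 := by simpa [hzdef, h0, abs_of_pos hr0] using hr1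
  have hzz : z * (starRingEnd ℂ) ζ₀ = r := by
    rw [hzdef, mul_assoc, Complex.mul_conj, Complex.normSq_eq_norm_sq, h0]; simp
  have hint : ∀ u : ℂ → ℝ, ContinuousOn u (Metric.sphere 0 1) →
      CircleIntegrable (fun ζ => ((ζ + z) / (ζ - z)).re * u ζ) 0 1 := fun u hu =>
    ((continuousOn_re_herglotz hz).mul hu).circleIntegrable zero_le_one
  -- The sign s = ±1 selects the upper or lower comparison function, each the real part of an affine
  -- function.
  have hval : ∀ s : ℝ, Real.circleAverage (fun ζ => ((ζ + z) / (ζ - z)).re *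
      (g ζ₀ + s * (ε / 2 + M * (2 - 2 * (ζ * (starRingEnd ℂ) ζ₀).re)))) 0 1
      = g ζ₀ + s * (ε / 2 + M * (2 - 2 * r)) := by
    intro s
    have := circleAverage_re_herglotz_mul_re (z := z) (f := fun ζ => ((g ζ₀ : ℝ) : ℂ) +
      s * ((ε / 2 : ℝ) + (M : ℝ) * (2 - 2 * (ζ * (starRingEnd ℂ) ζ₀)))) (by fun_prop) hz
    simp only [hzz] at this
    simpa using this
  have habs : ∀ ζ, ‖ζ‖ = 1 →
      |g ζ - g ζ₀| ≤ ε / 2 + M * (2 - 2 * (ζ * (starRingEnd ℂ) ζ₀).re) := fun ζ hζ => by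
    rw [← norm_sub_sq_of_norm_one hζ h0]; exact hM ζ hζ
  have up : Real.circleAverage (fun ζ => ((ζ + z) / (ζ - z)).re * g ζ) 0 1
      ≤ g ζ₀ + 1 * (ε / 2 + M * (2 - 2 * r)) := by
    rw [← hval 1]
    refine Real.circleAverage_mono (hint _ hg) (hint _ (by fun_prop)) fun ζ hζ => ?_
    have hζ : ‖ζ‖ = 1 := by simpa using hζ
    refine mul_le_mul_of_nonneg_left ?_ (re_herglotz_nonneg hz hζ)
    linarith [(abs_le.1 (habs ζ hζ)).2]
  have low : g ζ₀ + (-1) * (ε / 2 + M * (2 - 2 * r)) ≤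
      Real.circleAverage (fun ζ => ((ζ + z) / (ζ - z)).re * g ζ) 0 1 := by
    rw [← hval (-1)]
    refine Real.circleAverage_mono (hint _ (by fun_prop)) (hint _ hg) fun ζ hζ => ?_
    have hζ : ‖ζ‖ = 1 := by simpa using hζ
    refine mul_le_mul_of_nonneg_left ?_ (re_herglotz_nonneg hz hζ)
    linarith [(abs_le.1 (habs ζ hζ)).1]
  rw [Real.dist_eq, abs_lt]
  constructor <;> linarith

/-! ### The Szegő function: reflection, boundary values, continuation -/

/-- The logarithm of a weight on the unit circle, extended to the plane along rays. -/
noncomputable def logWeight (w : Circle → ℝ) (ζ : ℂ) : ℝ := Real.log (w (Circle.exp ζ.arg))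

theorem logWeight_circleMap (w : Circle → ℝ) (θ : ℝ) :
    logWeight w (circleMap 0 1 θ) = Real.log (w (Circle.exp θ)) := by
  have : circleMap 0 1 θ = (Circle.exp θ : ℂ) := by simp [circleMap]
  rw [logWeight, this, Circle.exp_arg]

theorem continuous_of_analyticAt_circleExp {w : Circle → ℝ}
    (han : ∀ θ : ℝ, AnalyticAt ℝ (fun t : ℝ => w (Circle.exp t)) θ) : Continuous w := by
  have h : IsOpenQuotientMap Circle.exp :=
    ⟨Circle.exp_surjective, Circle.exp.continuous, isLocalHomeomorph_circleExp.isOpenMap⟩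
  rw [← h.continuous_comp_iff]
  exact continuous_iff_continuousAt.2 fun θ => (han θ).continuousAt

theorem continuousOn_logWeight {w : Circle → ℝ} (hpos : ∀ ζ, 0 < w ζ) (hw : Continuous w) :
    ContinuousOn (logWeight w) (Metric.sphere 0 1) := by
  rw [continuousOn_iff_continuous_domRestrict]
  have : (Metric.sphere (0 : ℂ) 1).domRestrict (logWeight w) =
      fun x => Real.log (w ⟨x.1, by simp [Submonoid.unitSphere]⟩) := by
    ext x
    simp only [Set.domRestrict_apply, logWeight]
    congr 2
    exact Circle.exp_arg ⟨x.1, by simp [Submonoid.unitSphere]⟩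
  rw [this]
  exact (hw.comp (by fun_prop)).log fun x => (hpos _).ne'

theorem szegoD_eq_circleAverage (w : Circle → ℝ) (z : ℂ) :
    szegoD w z = Complex.exp ((1 / 2) * Real.circleAverage
      (fun ζ => herglotzRieszKernel 0 z ζ • (logWeight w ζ : ℂ)) 0 1) := by
  rw [szegoD, Real.circleAverage_def]
  congr 1
  simp only [logWeight_circleMap, herglotzRieszKernel_def, sub_zero]
  rw [Complex.real_smul, Complex.ofReal_inv, Complex.ofReal_mul, Complex.ofReal_ofNat]
  have h : ∀ θ : ℝ, ((circleMap 0 1 θ + z) / (circleMap 0 1 θ - z)) •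
      (Real.log (w (Circle.exp θ)) : ℂ) = (Real.log (w (Circle.exp θ)) : ℂ) *
      (((Circle.exp θ : ℂ) + z) / ((Circle.exp θ : ℂ) - z)) := fun θ => by
    have : circleMap 0 1 θ = (Circle.exp θ : ℂ) := by simp [circleMap]
    rw [this, smul_eq_mul, mul_comm]
  rw [intervalIntegral.integral_congr fun θ _ => h θ]
  ring

theorem circleIntegrable_logWeight {w : Circle → ℝ} (hpos : ∀ ζ, 0 < w ζ) (hw : Continuous w) :
    CircleIntegrable (fun ζ => (logWeight w ζ : ℂ)) 0 1 :=
  (Complex.continuous_ofReal.comp_continuousOn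
    (continuousOn_logWeight hpos hw)).circleIntegrable zero_le_one

theorem analyticAt_szegoD {w : Circle → ℝ} (hpos : ∀ ζ, 0 < w ζ) (hw : Continuous w) {z : ℂ}
    (hz : ‖z‖ < 1) : AnalyticAt ℂ (szegoD w) z := by
  refine DifferentiableOn.analyticAt (s := Metric.ball 0 1) (fun x hx => ?_)
    (Metric.isOpen_ball.mem_nhds (by simpa using hz))
  refine DifferentiableAt.differentiableWithinAt ?_
  rw [funext (szegoD_eq_circleAverage w)]
  exact ((hasDerivAt_circleAverage_herglotzRieszKernel_smul
    (circleIntegrable_logWeight hpos hw) hx).differentiableAt.const_mul _).cexp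

theorem szegoD_ne_zero (w : Circle → ℝ) (z : ℂ) : szegoD w z ≠ 0 := Complex.exp_ne_zero _

theorem norm_szegoD_sq {w : Circle → ℝ} (hpos : ∀ ζ, 0 < w ζ) (hw : Continuous w) {z : ℂ}
    (hz : ‖z‖ < 1) : ‖szegoD w z‖ ^ 2 = Real.exp (Real.circleAverage
      (fun ζ => ((ζ + z) / (ζ - z)).re * logWeight w ζ) 0 1) := by
  have h := re_circleAverage_herglotzRieszKernel_smul (g := logWeight w) (w := z) (R := 1)
    ((continuousOn_logWeight hpos hw).circleIntegrable zero_le_one) (by simpa using hz)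
  rw [szegoD_eq_circleAverage, Complex.norm_exp, ← Real.exp_nat_mul]
  congr 1
  have h2 : Real.circleAverage (fun ζ => ((ζ + z) / (ζ - z)).re * logWeight w ζ) 0 1 =
      Real.circleAverage (Complex.re ∘ herglotzRieszKernel 0 z • logWeight w) 0 1 := by
    congr 1
    ext ζ
    simp [herglotzRieszKernel_def]
  rw [h2, ← h]
  generalize Real.circleAverage
      (fun ζ => herglotzRieszKernel 0 z ζ • (logWeight w ζ : ℂ)) 0 1 = x
  have : (1 / 2 : ℂ) * x = ((1 / 2 : ℝ) : ℂ) * x := by norm_num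
  rw [this, Complex.re_ofReal_mul]
  push_cast
  ring

theorem szegoD_zero (w : Circle → ℝ) : szegoD w 0 = ((szegoTau w : ℝ) : ℂ)⁻¹ := by
  rw [szegoD, szegoTau, ← Complex.ofReal_inv, ← Real.exp_neg]
  have : ∀ θ : ℝ, ((Circle.exp θ : ℂ) + 0) / ((Circle.exp θ : ℂ) - 0) = 1 := fun θ => by
    simp
  simp only [this, mul_one, intervalIntegral.integral_ofReal]
  push_cast
  congr 1
  ring

/-- On the circle conj ζ = ζ⁻¹, so conjugating the Herglotz kernel at 1/conj z returns the kernel at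
z with the opposite sign. -/
theorem szegoD_eq_inv_conj {w : Circle → ℝ} {z : ℂ} (hz : z ≠ 0) :
    szegoD w z = ((starRingEnd ℂ) (szegoD w ((starRingEnd ℂ) z)⁻¹))⁻¹ := by
  rw [szegoD, szegoD, ← Complex.exp_conj, ← Complex.exp_neg]
  congr 1
  rw [map_mul, ← mul_neg, intervalIntegral, intervalIntegral]
  simp only [Set.Ioc_eq_empty_of_le (Real.two_pi_pos.le), MeasureTheory.Measure.restrict_empty,
    MeasureTheory.integral_zero_measure, sub_zero]
  rw [← integral_conj, ← MeasureTheory.integral_neg]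
  congr 1
  · rw [map_div₀, map_mul, Complex.conj_ofReal, map_one, map_ofNat]
  · congr 1
    ext θ
    have he : (starRingEnd ℂ) (Circle.exp θ : ℂ) = (Circle.exp θ : ℂ)⁻¹ := by
      rw [← Circle.coe_inv_eq_conj, Circle.coe_inv]
    have he0 : (Circle.exp θ : ℂ) ≠ 0 := Circle.coe_ne_zero _
    simp only [map_mul, map_div₀, map_add, map_sub, map_inv₀, Complex.conj_conj,
      Complex.conj_ofReal, he]
    rw [← mul_neg]
    congr 1
    have h1 : (Circle.exp θ : ℂ)⁻¹ + z⁻¹ = ((Circle.exp θ : ℂ) + z) * ((Circle.exp θ : ℂ) * z)⁻¹ := by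
      field_simp; ring
    have h2 : (Circle.exp θ : ℂ)⁻¹ - z⁻¹ =
        -((Circle.exp θ : ℂ) - z) * ((Circle.exp θ : ℂ) * z)⁻¹ := by
      field_simp; ring
    rw [h1, h2, mul_div_mul_right _ _ (inv_ne_zero (mul_ne_zero he0 hz)), div_neg, neg_neg]

/-- If no admissible r existed, the infimum of the empty set would have the default value 0;
positivity therefore supplies some r < 1. -/
theorem szegoRadius_lt_one {w : Circle → ℝ} (h : 0 < szegoRadius w) : szegoRadius w < 1 := by
  unfold szegoRadius at h ⊢
  set S := {r : ℝ | 0 < r ∧ r < 1 ∧ ∃ F : ℂ → ℂ,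
    DifferentiableOn ℂ F {z | r < ‖z‖} ∧ ∀ z : ℂ, 1 < ‖z‖ → F z = szegoD w z}
  have hne : S.Nonempty := by
    by_contra hS
    rw [Set.not_nonempty_iff_eq_empty.1 hS, Real.sInf_empty] at h
    exact lt_irrefl _ h
  obtain ⟨r, hr⟩ := hne
  exact (csInf_le ⟨0, fun x hx => hx.1.le⟩ hr).trans_lt hr.2.1

theorem norm_inv_conj (z : ℂ) : ‖((starRingEnd ℂ) z)⁻¹‖ = ‖z‖⁻¹ := by
  rw [norm_inv, RCLike.norm_conj]

/-- Schwarz reflection in the unit circle. -/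
theorem analyticAt_conj_comp_inv_conj {f : ℂ → ℂ} {z : ℂ} (hz : z ≠ 0)
    (hf : AnalyticAt ℂ f ((starRingEnd ℂ) z)⁻¹) :
    AnalyticAt ℂ (fun z => (starRingEnd ℂ) (f ((starRingEnd ℂ) z)⁻¹)) z := by
  have h1 : AnalyticAt ℂ (fun z => (starRingEnd ℂ) (f ((starRingEnd ℂ) z))) z⁻¹ := by
    rw [Complex.analyticAt_iff_eventually_differentiableAt]
    rw [← map_inv₀] at hf
    have h2 := (Complex.analyticAt_iff_eventually_differentiableAt.1 hf)
    have h3 : Tendsto (starRingEnd ℂ) (𝓝 z⁻¹) (𝓝 ((starRingEnd ℂ) z⁻¹)) :=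
      Complex.continuous_conj.tendsto _
    filter_upwards [h3.eventually h2] with t ht
    exact differentiableAt_conj_conj_iff.2 ht
  have h2 : AnalyticAt ℂ (fun z : ℂ => z⁻¹) z := analyticAt_inv hz
  have := h1.comp_of_eq h2 rfl
  refine this.congr (Eventually.of_forall fun t => ?_)
  simp

/-- `D` continues the interior Szegő function of `w` to `‖z‖ < R`, `De` continues the exterior one
to `‖z‖ > ρ`, and `J` continues `1 / D` to `1 ≤ ‖z‖ < 1 / ρ`. -/
structure SzegoExtension (w : Circle → ℝ) (De D J : ℂ → ℂ) (ρ R : ℝ) : Prop where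
  pos : 0 < ρ
  lt_one : ρ < 1
  one_lt : 1 < R
  mul_lt : R * ρ < 1
  eq_szegoD : ∀ z, ‖z‖ < 1 → D z = szegoD w z
  analyticAt_D : ∀ z, ‖z‖ < R → AnalyticAt ℂ D z
  D_ne : ∀ z, ‖z‖ < R → D z ≠ 0
  analyticAt_De : ∀ z, ρ < ‖z‖ → AnalyticAt ℂ De z
  De_ne : ∀ z, 1 ≤ ‖z‖ → De z ≠ 0
  weight_eq : ∀ θ : ℝ, (w (Circle.exp θ) : ℂ) = D (Circle.exp θ) / De (Circle.exp θ)
  analyticAt_J : ∀ z, 1 ≤ ‖z‖ → ‖z‖ * ρ < 1 → AnalyticAt ℂ J z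
  J_eq : ∀ z, 1 ≤ ‖z‖ → ‖z‖ < R → J z = (D z)⁻¹
  tendsto_De : Tendsto De (Bornology.cobounded ℂ) (𝓝 (szegoTau w : ℂ))

/-- For r < 1 the reflection formula gives |D_e(ζ/r)| |D_i(rζ)| = 1; as r → 1 the first factor
converges by continuity and |D_i(rζ)|² tends to w(ζ) by the Poisson limit. -/
theorem norm_sq_mul_weight_eq_one {w : Circle → ℝ} (hpos : ∀ ζ, 0 < w ζ) (hw : Continuous w)
    {De : ℂ → ℂ} (hDe : ∀ z : ℂ, 1 < ‖z‖ → De z = szegoD w z) (θ : ℝ)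
    (hc : ContinuousAt De (Circle.exp θ : ℂ)) :
    ‖De (Circle.exp θ)‖ ^ 2 * w (Circle.exp θ) = 1 := by
  set ζ : ℂ := (Circle.exp θ : ℂ) with hζ
  have hn : ‖ζ‖ = 1 := Circle.norm_coe _
  have hζ0 : ζ ≠ 0 := fun h => by simp [h] at hn
  have h1 := tendsto_poisson_radial (continuousOn_logWeight hpos hw) hn
  have hlog : logWeight w ζ = Real.log (w (Circle.exp θ)) := by rw [logWeight, hζ, Circle.exp_arg]
  have h2 := (Real.continuous_exp.tendsto _).comp h1
  rw [hlog, Real.exp_log (hpos _)] at h2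
  have hr2 : ∀ᶠ r : ℝ in 𝓝[<] 1, 0 < r ∧ r < 1 := Ioo_mem_nhdsLT zero_lt_one
  have h3 : Tendsto (fun r : ℝ => ‖De ((r : ℂ)⁻¹ * ζ)‖ ^ 2) (𝓝[<] 1) (𝓝 (‖De ζ‖ ^ 2)) := by
    have h4 : Tendsto (fun r : ℝ => (r : ℂ)⁻¹ * ζ) (𝓝[<] 1) (𝓝 (((1 : ℝ) : ℂ)⁻¹ * ζ)) := by
      refine Tendsto.mono_left ?_ nhdsWithin_le_nhds
      exact ((Complex.continuous_ofReal.tendsto 1).inv₀ (by simp)).mul_const _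
    rw [Complex.ofReal_one, inv_one, one_mul] at h4
    exact ((hc.tendsto.comp h4).norm).pow 2
  refine tendsto_nhds_unique ((h3.mul h2).congr' ?_) tendsto_const_nhds
  filter_upwards [hr2] with r ⟨h0, h1⟩
  have hz : ‖(r : ℂ) * ζ‖ < 1 := by simpa [hn, abs_of_pos h0] using h1
  have hr0 : (r : ℂ) ≠ 0 := by exact_mod_cast h0.ne'
  have hbig : 1 < ‖(r : ℂ)⁻¹ * ζ‖ := by
    simpa [hn, abs_of_pos h0] using (one_lt_inv₀ h0).2 h1
  have hconj : ((starRingEnd ℂ) ((r : ℂ)⁻¹ * ζ))⁻¹ = r * ζ := by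
    rw [map_mul, map_inv₀, Complex.conj_ofReal, mul_inv, inv_inv, hζ, ← Circle.coe_inv_eq_conj,
      Circle.coe_inv, inv_inv]
  rw [Function.comp_apply, ← norm_szegoD_sq hpos hw hz, hDe _ hbig,
    szegoD_eq_inv_conj (mul_ne_zero (inv_ne_zero hr0) hζ0), hconj, norm_inv, RCLike.norm_conj,
    ← mul_pow, inv_mul_cancel₀ (norm_ne_zero_iff.2 (szegoD_ne_zero _ _)), one_pow]

theorem tendsto_exterior_szegoD {w : Circle → ℝ} (hpos : ∀ ζ, 0 < w ζ) (hw : Continuous w)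
    {De : ℂ → ℂ} (hDe : ∀ z : ℂ, 1 < ‖z‖ → De z = szegoD w z) :
    Tendsto De (Bornology.cobounded ℂ) (𝓝 (szegoTau w : ℂ)) := by
  have h1 : Tendsto (fun z : ℂ => ((starRingEnd ℂ) z)⁻¹) (Bornology.cobounded ℂ) (𝓝 0) := by
    rw [← tendsto_zero_iff_norm_tendsto_zero.symm]
    simp only [norm_inv_conj]
    exact tendsto_inv_atTop_zero.comp tendsto_norm_cobounded_atTop
  have h2 := (analyticAt_szegoD hpos hw (z := 0) (by simp)).continuousAt.tendsto.comp h1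
  have h3 := ((Complex.continuous_conj.tendsto _).comp h2).inv₀
    (by simpa using szegoD_ne_zero w 0)
  rw [szegoD_zero, map_inv₀, Complex.conj_ofReal, inv_inv] at h3
  refine h3.congr' ?_
  filter_upwards [tendsto_norm_cobounded_atTop.eventually (eventually_gt_atTop 1)] with z hz
  have hz0 : z ≠ 0 := fun h => by simp [h] at hz; linarith
  rw [hDe z hz, szegoD_eq_inv_conj hz0]
  rfl

/-- Compactness of the circle, used to find a collar inside it on which `De` has no zeros. -/
theorem exists_lt_one_forall_mem {U : Set ℂ} (hU : IsOpen U) (h : ∀ z : ℂ, ‖z‖ = 1 → z ∈ U) :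
    ∃ r, 0 < r ∧ r < 1 ∧ ∀ z : ℂ, r < ‖z‖ → ‖z‖ ≤ 1 → z ∈ U := by
  obtain ⟨δ, hδ, hsub⟩ := (isCompact_sphere (0 : ℂ) 1).exists_thickening_subset_open hU
    (fun z hz => h z (by simpa using hz))
  refine ⟨max (1 / 2) (1 - δ), by positivity, max_lt (by norm_num) (by linarith), fun z h1 h2 => ?_⟩
  have h3 : 1 / 2 < ‖z‖ := (le_max_left _ _).trans_lt h1
  have h4 : 1 - δ < ‖z‖ := (le_max_right _ _).trans_lt h1
  have hz0 : (‖z‖ : ℂ) ≠ 0 := by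
    have : ‖z‖ ≠ 0 := by linarith
    exact_mod_cast this
  refine hsub (Metric.mem_thickening_iff.2 ⟨(‖z‖ : ℂ)⁻¹ * z, ?_, ?_⟩)
  · have : ‖z‖ ≠ 0 := by linarith
    simp [this]
  · rw [dist_eq_norm]
    have h5 : z - (‖z‖ : ℂ)⁻¹ * z = ((‖z‖ - 1 : ℝ) : ℂ) * ((‖z‖ : ℂ)⁻¹ * z) := by
      push_cast; field_simp
    have h6 : ‖(‖z‖ : ℂ)⁻¹ * z‖ = 1 := by
      have : ‖z‖ ≠ 0 := by linarith
      simp [this]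
    rw [h5, norm_mul, h6, mul_one, Complex.norm_real, Real.norm_eq_abs, abs_lt]
    constructor <;> linarith

/-- `J` is the reflection of `De`, analytic for 0 < |z| < 1/ρ, and equals 1/D_i in the punctured
disc. Hence 1/`J` continues D_i as far as `J` has no zeros, that is, as far as the reflected point
stays in the collar where `De` does not vanish. -/
theorem exists_szegoExtension {w : Circle → ℝ} (hpos : ∀ ζ, 0 < w ζ) (hw : Continuous w)
    {De : ℂ → ℂ} (hDe : ∀ z : ℂ, 1 < ‖z‖ → De z = szegoD w z) {ρ : ℝ} (hρ0 : 0 < ρ) (hρ1 : ρ < 1)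
    (han : ∀ z, ρ < ‖z‖ → AnalyticAt ℂ De z) : ∃ D J R, SzegoExtension w De D J ρ R := by
  have hmul : ∀ x : ℝ, x < ρ⁻¹ ↔ x * ρ < 1 := fun x => by
    rw [inv_eq_one_div, lt_div_iff₀ hρ0]
  have hcirc : ∀ z : ℂ, ‖z‖ = 1 → ∃ θ : ℝ, z = Circle.exp θ := fun z hz =>
    ⟨z.arg, (congrArg Subtype.val
      (Circle.exp_arg ⟨z, by simp [Submonoid.unitSphere, hz]⟩)).symm⟩
  have hw1 : ∀ θ : ℝ, ‖De (Circle.exp θ)‖ ^ 2 * w (Circle.exp θ) = 1 := fun θ =>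
    norm_sq_mul_weight_eq_one hpos hw hDe θ (han _ (by simpa using hρ1)).continuousAt
  have hne1 : ∀ z : ℂ, ‖z‖ = 1 → De z ≠ 0 := by
    intro z hz h0
    obtain ⟨θ, rfl⟩ := hcirc z hz
    have := hw1 θ
    rw [h0] at this
    simp at this
  obtain ⟨r, hr0, hr1, hr⟩ := exists_lt_one_forall_mem (U := {z | ρ < ‖z‖ ∧ De z ≠ 0}) (by
    rw [isOpen_iff_mem_nhds]
    rintro z ⟨h1, h2⟩
    filter_upwards [(isOpen_lt continuous_const continuous_norm).mem_nhds h1,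
      (han z h1).continuousAt.eventually_ne h2] with t h3 h4 using ⟨h3, h4⟩)
    (fun z hz => ⟨by rw [hz]; exact hρ1, hne1 z hz⟩)
  set J : ℂ → ℂ := fun z => (starRingEnd ℂ) (De ((starRingEnd ℂ) z)⁻¹) with hJ
  set D : ℂ → ℂ := fun z => if ‖z‖ < 1 then szegoD w z else (J z)⁻¹ with hD
  -- Any R below 1/s keeps reflected points in the zero-free collar and also yields R ρ < 1.
  set s := max r ρ with hs
  have hs0 : 0 < s := hr0.trans_le (le_max_left _ _)
  have hs1 : s < 1 := max_lt hr1 hρ1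
  obtain ⟨R, hR1, hR2⟩ := exists_between ((one_lt_inv₀ hs0).2 hs1)
  have hRs : ∀ x : ℝ, 0 < x → x < R → s < x⁻¹ := fun x h0 h => by
    rw [lt_inv_comm₀ hs0 h0]; exact h.trans hR2
  have hpos' : ∀ {z : ℂ}, z ≠ 0 → 0 < ‖z‖ := fun h => norm_pos_iff.2 h
  have hne0 : ∀ {z : ℂ}, 1 ≤ ‖z‖ → z ≠ 0 := fun h h0 => by simp [h0] at h; linarith
  have hJan : ∀ z, z ≠ 0 → ‖z‖ * ρ < 1 → AnalyticAt ℂ J z := fun z h0 h =>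
    analyticAt_conj_comp_inv_conj h0 (han _ (by
      rwa [norm_inv_conj, lt_inv_comm₀ hρ0 (hpos' h0), hmul]))
  have hDJ : ∀ z, z ≠ 0 → D z = (J z)⁻¹ := by
    intro z h0
    by_cases h1 : ‖z‖ < 1
    · rw [hD]
      simp only [h1, if_true, hJ]
      rw [hDe _ (by rw [norm_inv_conj]; exact (one_lt_inv₀ (hpos' h0)).2 h1),
        szegoD_eq_inv_conj h0]
    · simp only [hD, h1, if_false]
  have hDeg : ∀ z, 1 ≤ ‖z‖ → De z ≠ 0 := by
    intro z hz
    rcases hz.eq_or_lt with h | h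
    · exact hne1 z h.symm
    · rw [hDe z h]; exact szegoD_ne_zero _ _
  have hJne : ∀ z, z ≠ 0 → ‖z‖ < R → J z ≠ 0 := by
    intro z h0 h
    have h2 := hRs _ (hpos' h0) h
    simp only [hJ, ne_eq, map_eq_zero]
    by_cases h3 : ‖z‖ < 1
    · exact hDeg _ (by rw [norm_inv_conj]; exact ((one_lt_inv₀ (hpos' h0)).2 h3).le)
    · refine (hr _ ?_ ?_).2
      · rw [norm_inv_conj]; exact (le_max_left _ _).trans_lt h2
      · rw [norm_inv_conj]; exact inv_le_one_of_one_le₀ (not_lt.1 h3)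
  have hRρ : ∀ x : ℝ, x < R → x * ρ < 1 := by
    intro x hx
    rw [← hmul]
    exact hx.trans (hR2.trans_le (inv_anti₀ hρ0 (le_max_right _ _)))
  refine ⟨D, J, R, hρ0, hρ1, hR1, ?_, ?_, ?_, ?_, han, hDeg, ?_, ?_, ?_,
    tendsto_exterior_szegoD hpos hw hDe⟩
  · rw [← hmul]
    exact (hR2.trans_le (inv_anti₀ hρ0 (le_max_right _ _)))
  · intro z hz
    simp [hD, hz]
  · intro z hz
    by_cases h0 : z = 0
    · refine (analyticAt_szegoD hpos hw (z := z) (by simp [h0])).congr ?_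
      filter_upwards [Metric.ball_mem_nhds z zero_lt_one] with t ht
      have : ‖t‖ < 1 := by simpa [h0] using ht
      simp [hD, this]
    · refine ((hJan z h0 (hRρ _ hz)).inv (hJne z h0 hz)).congr ?_
      filter_upwards [isOpen_ne.mem_nhds h0] with t ht
      rw [hDJ t ht]; rfl
  · intro z hz
    by_cases h0 : z = 0
    · simp only [h0, hD, norm_zero, zero_lt_one, if_true]
      exact szegoD_ne_zero _ _
    · rw [hDJ z h0]
      exact inv_ne_zero (hJne z h0 hz)
  · intro θ
    have h1 : ((starRingEnd ℂ) (Circle.exp θ : ℂ))⁻¹ = Circle.exp θ := by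
      rw [← Circle.coe_inv_eq_conj, Circle.coe_inv, inv_inv]
    rw [hDJ _ (Circle.coe_ne_zero _)]
    simp only [hJ, h1]
    have h2 := hw1 θ
    have h3 : De (Circle.exp θ) ≠ 0 := hne1 _ (Circle.norm_coe _)
    rw [← Complex.normSq_eq_norm_sq] at h2
    have h4 : (starRingEnd ℂ) (De (Circle.exp θ)) * De (Circle.exp θ) * (w (Circle.exp θ) : ℂ) = 1 := by
      rw [mul_comm ((starRingEnd ℂ) _), Complex.mul_conj]
      exact_mod_cast h2
    have h5 : (starRingEnd ℂ) (De (Circle.exp θ)) ≠ 0 := by simpa using h3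
    field_simp
    linear_combination h4
  · exact fun z h1 h2 => hJan z (hne0 h1) h2
  · intro z h1 _
    rw [hDJ z (hne0 h1), inv_inv]

/-! ### Orthogonality and a mean bound uniform in n -/

/-- The sesquilinear form of the weight `w` on polynomials. -/
noncomputable def weightForm (w : Circle → ℝ) (p q : ℂ[X]) : ℂ :=
  ∫ θ in (0 : ℝ)..(2 * Real.pi), p.eval (Circle.exp θ : ℂ) *
    (starRingEnd ℂ) (q.eval (Circle.exp θ : ℂ)) * (w (Circle.exp θ) : ℂ)

theorem continuous_eval_circleExp (p : ℂ[X]) :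
    Continuous fun θ : ℝ => p.eval (Circle.exp θ : ℂ) :=
  p.continuous.comp (continuous_subtype_val.comp Circle.exp.continuous)

theorem continuous_weight_circleExp {w : Circle → ℝ} (hw : Continuous w) :
    Continuous fun θ : ℝ => (w (Circle.exp θ) : ℂ) :=
  Complex.continuous_ofReal.comp (hw.comp Circle.exp.continuous)

theorem continuous_weightForm {w : Circle → ℝ} (hw : Continuous w) (p q : ℂ[X]) :
    Continuous fun θ : ℝ => p.eval (Circle.exp θ : ℂ) *
      (starRingEnd ℂ) (q.eval (Circle.exp θ : ℂ)) * (w (Circle.exp θ) : ℂ) :=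
  ((continuous_eval_circleExp p).mul (Complex.continuous_conj.comp
    (continuous_eval_circleExp q))).mul (continuous_weight_circleExp hw)

theorem weightForm_add_right {w : Circle → ℝ} (hw : Continuous w) (p q r : ℂ[X]) :
    weightForm w p (q + r) = weightForm w p q + weightForm w p r := by
  unfold weightForm
  rw [← intervalIntegral.integral_add ((continuous_weightForm hw p q).intervalIntegrable _ _)
    ((continuous_weightForm hw p r).intervalIntegrable _ _)]
  congr 1
  ext θ
  rw [eval_add, map_add]
  ring

theorem weightForm_C_mul_right (w : Circle → ℝ) (p q : ℂ[X]) (c : ℂ) :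
    weightForm w p (C c * q) = (starRingEnd ℂ) c * weightForm w p q := by
  unfold weightForm
  rw [← intervalIntegral.integral_const_mul]
  congr 1
  ext θ
  rw [eval_mul, eval_C, map_mul]
  ring

theorem weightForm_C_mul_left (w : Circle → ℝ) (p q : ℂ[X]) (c : ℂ) :
    weightForm w (C c * p) q = c * weightForm w p q := by
  unfold weightForm
  rw [← intervalIntegral.integral_const_mul]
  congr 1
  ext θ
  rw [eval_mul, eval_C]
  ring

theorem leadingCoeff_ne_zero {w : Circle → ℝ} {φ : ℕ → ℂ[X]} (hφ : IsOrthonormalSystem w φ)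
    (n : ℕ) : (φ n).leadingCoeff ≠ 0 := by
  obtain ⟨κ, hκ, h⟩ := hφ.leadingCoeff_pos n
  rw [h]
  exact_mod_cast hκ.ne'

/-- Induction on the degree bound d: subtracting a multiple of φ d removes the coefficient of degree
d, and φ d is itself orthogonal to φ n. -/
theorem weightForm_eq_zero_of_degree_lt {w : Circle → ℝ} (hw : Continuous w) {φ : ℕ → ℂ[X]}
    (hφ : IsOrthonormalSystem w φ) (n : ℕ) : ∀ d, d ≤ n → ∀ p : ℂ[X], p.degree < d →
      weightForm w (φ n) p = 0 := by
  intro d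
  induction d with
  | zero =>
    intro _ p hp
    have : p = 0 := by
      rw [← degree_eq_bot]
      simpa using hp
    simp [this, weightForm]
  | succ d ih =>
    intro hd p hp
    have hl := leadingCoeff_ne_zero hφ d
    set c := p.coeff d / (φ d).leadingCoeff with hc
    have h1 : (p + C (-c) * φ d).degree < d := by
      rw [degree_lt_iff_coeff_zero]
      intro m hm
      rw [coeff_add, coeff_C_mul]
      rcases hm.eq_or_lt with h | h
      · subst h
        have : (φ d).coeff d = (φ d).leadingCoeff := by
          rw [leadingCoeff, hφ.natDegree_eq]
        rw [this, hc]
        field_simp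
        ring
      · rw [(degree_lt_iff_coeff_zero _ _).1 hp m h,
          coeff_eq_zero_of_natDegree_lt (by rw [hφ.natDegree_eq]; exact h)]
        simp
    have h2 := ih (by omega) _ h1
    have h3 : weightForm w (φ n) (φ d) = 0 := by
      have := hφ.orthonormal d n
      rwa [if_neg (by omega)] at this
    rwa [weightForm_add_right hw, weightForm_C_mul_right, h3, mul_zero, add_zero] at h2

theorem monic_monicOP {w : Circle → ℝ} {φ : ℕ → ℂ[X]} (hφ : IsOrthonormalSystem w φ) (n : ℕ) :
    (monicOP φ n).Monic := by
  rw [Monic, monicOP, leadingCoeff_mul, leadingCoeff_C, inv_mul_cancel₀ (leadingCoeff_ne_zero hφ n)]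

theorem natDegree_monicOP {w : Circle → ℝ} {φ : ℕ → ℂ[X]} (hφ : IsOrthonormalSystem w φ) (n : ℕ) :
    (monicOP φ n).natDegree = n := by
  rw [monicOP, natDegree_C_mul (inv_ne_zero (leadingCoeff_ne_zero hφ n)), hφ.natDegree_eq]

theorem weightForm_monicOP_eq_zero {w : Circle → ℝ} (hw : Continuous w) {φ : ℕ → ℂ[X]}
    (hφ : IsOrthonormalSystem w φ) {n : ℕ} {p : ℂ[X]} (hp : p.degree < n) :
    weightForm w (monicOP φ n) p = 0 := by
  rw [monicOP, weightForm_C_mul_left, weightForm_eq_zero_of_degree_lt hw hφ n n le_rfl p hp,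
    mul_zero]

/-- Write z^n = Φ + q with deg q < n. From |Φ + q| = 1 on the circle, 1 - Re(Φ conj q) = (1 + |Φ|² +
|q|²)/2 ≥ |Φ|; orthogonality removes the cross term after integration. The bound does not depend on
n. -/
theorem integral_norm_monicOP_mul_le {w : Circle → ℝ} (hpos : ∀ ζ, 0 < w ζ) (hw : Continuous w)
    {φ : ℕ → ℂ[X]} (hφ : IsOrthonormalSystem w φ) (n : ℕ) :
    ∫ θ in (0 : ℝ)..(2 * Real.pi), ‖(monicOP φ n).eval (Circle.exp θ : ℂ)‖ * w (Circle.exp θ)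
      ≤ ∫ θ in (0 : ℝ)..(2 * Real.pi), w (Circle.exp θ) := by
  set Φ := monicOP φ n with hΦ
  set q : ℂ[X] := X ^ n - Φ with hq
  have hwc : Continuous fun θ : ℝ => w (Circle.exp θ) := hw.comp Circle.exp.continuous
  have hpc : ∀ p : ℂ[X], Continuous fun θ : ℝ => ‖p.eval (Circle.exp θ : ℂ)‖ := fun p =>
    (continuous_eval_circleExp p).norm
  have hqd : q.degree < n := by
    have hm := monic_monicOP hφ n
    have hd : Φ.degree = n := by
      rw [degree_eq_natDegree hm.ne_zero, natDegree_monicOP hφ]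
    have := degree_sub_lt_left (p := X ^ n) (q := Φ) (by rw [degree_X_pow, hd])
      (pow_ne_zero _ X_ne_zero) (by rw [leadingCoeff_X_pow, hm.leadingCoeff])
    rwa [degree_X_pow] at this
  have hzero : ∫ θ in (0 : ℝ)..(2 * Real.pi), (Φ.eval (Circle.exp θ : ℂ) *
      (starRingEnd ℂ) (q.eval (Circle.exp θ : ℂ))).re * w (Circle.exp θ) = 0 := by
    have h1 := weightForm_monicOP_eq_zero hw hφ hqd
    have h2 := Complex.reCLM.intervalIntegral_comp_comm
      ((continuous_weightForm hw Φ q).intervalIntegrable (μ := MeasureTheory.volume)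
        0 (2 * Real.pi))
    rw [weightForm] at h1
    rw [h1, map_zero] at h2
    rw [← h2]
    congr 1
    ext θ
    simp
  have hint : ∀ f : ℝ → ℝ, Continuous f →
      IntervalIntegrable f MeasureTheory.volume 0 (2 * Real.pi) :=
    fun f hf => hf.intervalIntegrable _ _
  have hcr : Continuous fun θ : ℝ => (Φ.eval (Circle.exp θ : ℂ) *
      (starRingEnd ℂ) (q.eval (Circle.exp θ : ℂ))).re * w (Circle.exp θ) :=
    (Complex.continuous_re.comp ((continuous_eval_circleExp Φ).mul
      (Complex.continuous_conj.comp (continuous_eval_circleExp q)))).mul hwc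
  calc ∫ θ in (0 : ℝ)..(2 * Real.pi), ‖Φ.eval (Circle.exp θ : ℂ)‖ * w (Circle.exp θ)
      ≤ ∫ θ in (0 : ℝ)..(2 * Real.pi), (w (Circle.exp θ) - (Φ.eval (Circle.exp θ : ℂ) *
          (starRingEnd ℂ) (q.eval (Circle.exp θ : ℂ))).re * w (Circle.exp θ)) := by
        refine intervalIntegral.integral_mono_on Real.two_pi_pos.le
          (hint _ ((hpc Φ).mul hwc)) (hint _ (hwc.sub hcr)) fun θ _ => ?_
        have hn : ‖(X ^ n : ℂ[X]).eval (Circle.exp θ : ℂ)‖ = 1 := by simp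
        have hx : (X ^ n : ℂ[X]).eval (Circle.exp θ : ℂ) =
            Φ.eval (Circle.exp θ : ℂ) + q.eval (Circle.exp θ : ℂ) := by
          rw [hq, eval_sub]; ring
        have hexp := Complex.normSq_add (Φ.eval (Circle.exp θ : ℂ)) (q.eval (Circle.exp θ : ℂ))
        rw [← hx, Complex.normSq_eq_norm_sq, hn, Complex.normSq_eq_norm_sq,
          Complex.normSq_eq_norm_sq] at hexp
        have hwp := hpos (Circle.exp θ)
        have : ‖Φ.eval (Circle.exp θ : ℂ)‖ ≤ 1 - (Φ.eval (Circle.exp θ : ℂ) *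
          (starRingEnd ℂ) (q.eval (Circle.exp θ : ℂ))).re := by
          nlinarith [sq_nonneg (‖Φ.eval (Circle.exp θ : ℂ)‖ - 1),
            sq_nonneg ‖q.eval (Circle.exp θ : ℂ)‖]
        nlinarith
    _ = ∫ θ in (0 : ℝ)..(2 * Real.pi), w (Circle.exp θ) := by
        rw [intervalIntegral.integral_sub (hint _ hwc) (hint _ hcr), hzero, sub_zero]

theorem cInt_one_eq (f : ℂ → ℂ) : cInt 1 f = (2 * Real.pi : ℂ)⁻¹ *
    ∫ θ in (0 : ℝ)..(2 * Real.pi), f (Circle.exp θ) * (Circle.exp θ : ℂ) := by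
  unfold cInt circleIntegral
  have : ∀ θ : ℝ, deriv (circleMap 0 1) θ • f (circleMap 0 1 θ) =
      Complex.I * (f (Circle.exp θ) * (Circle.exp θ : ℂ)) := fun θ => by
    have : circleMap 0 1 θ = (Circle.exp θ : ℂ) := by simp [circleMap]
    rw [deriv_circleMap, this, smul_eq_mul]
    ring
  rw [intervalIntegral.integral_congr fun θ _ => this θ, intervalIntegral.integral_const_mul,
    ← mul_assoc]
  congr 1
  have := Complex.I_ne_zero
  have : (Real.pi : ℂ) ≠ 0 := by exact_mod_cast Real.pi_ne_zero
  field_simp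

/-- The quotient is the reversed polynomial at 1/t, whose constant term is the leading coefficient
1. -/
theorem monic_eval_div_pow_tendsto {p : ℂ[X]} (hp : p.Monic) :
    Tendsto (fun t => p.eval t / t ^ p.natDegree) (Bornology.cobounded ℂ) (𝓝 1) := by
  have h1 : Tendsto (fun t : ℂ => p.reverse.eval t⁻¹) (Bornology.cobounded ℂ) (𝓝 1) := by
    have := (p.reverse.continuous.tendsto 0).comp (tendsto_inv₀_cobounded (α := ℂ))
    rwa [← coeff_zero_eq_eval_zero, coeff_zero_reverse, hp.leadingCoeff] at this
  refine h1.congr' ?_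
  filter_upwards [Bornology.eventually_ne_cobounded (0 : ℂ)] with t ht
  let _ := invertibleOfNonzero ht
  have := eval₂_reverse_mul_pow (RingHom.id ℂ) t p
  rw [invOf_eq_inv] at this
  rw [eq_div_iff (pow_ne_zero _ ht)]
  exact this

/-! ### Splitting of the weighted polynomial and contour representations -/

section Riemann

variable {w : Circle → ℝ} {De D J : ℂ → ℂ} {ρ R₀ : ℝ}

theorem SzegoExtension.analyticAt_weight_mul (h : SzegoExtension w De D J ρ R₀) (p : ℂ[X]) {t : ℂ}
    (h1 : 1 ≤ ‖t‖) (h2 : ‖t‖ < R₀) : AnalyticAt ℂ (fun t => D t / De t * p.eval t) t :=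
  ((h.analyticAt_D t h2).div (h.analyticAt_De t (h.lt_one.trans_le h1)) (h.De_ne t h1)).mul
    (AnalyticOnNhd.eval_polynomial p t (Set.mem_univ _))

/-- On the unit circle t^(-k) is the conjugate of t^k and D/D_e is w, so this is orthogonality to
z^k; the extra factor 1/t is absorbed by dt. Analyticity then moves the circle to radius R. -/
theorem SzegoExtension.cInt_moment_eq_zero (h : SzegoExtension w De D J ρ R₀) (hw : Continuous w)
    {φ : ℕ → ℂ[X]} (hφ : IsOrthonormalSystem w φ) {n k : ℕ} (hk : k < n) {R : ℝ} (hR1 : 1 ≤ R)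
    (hR : R < R₀) :
    cInt R (fun t => D t / De t * (monicOP φ n).eval t / t ^ (k + 1)) = 0 := by
  have h0 : ∀ t : ℂ, 1 ≤ ‖t‖ → t ≠ 0 := fun t ht h => by simp [h] at ht; linarith
  rw [cInt_deform (f := fun t => D t / De t * (monicOP φ n).eval t / t ^ (k + 1))
    zero_lt_one hR1 fun t h1 h2 => (h.analyticAt_weight_mul _ h1 (h2.trans_lt hR)).div (analyticAt_id.pow _)
      (pow_ne_zero _ (h0 t h1)), cInt_one_eq]
  have := weightForm_monicOP_eq_zero hw hφ (n := n) (p := X ^ k) (by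
    rw [degree_X_pow]; exact_mod_cast hk)
  rw [weightForm] at this
  rw [mul_eq_zero]
  right
  rw [← this]
  congr 1
  ext θ
  rw [h.weight_eq θ, eval_pow, eval_X, map_pow, ← Circle.coe_inv_eq_conj, Circle.coe_inv,
    inv_pow]
  have : (Circle.exp θ : ℂ) ≠ 0 := Circle.coe_ne_zero _
  field_simp
  ring

theorem SzegoExtension.norm_cInt_one_le (h : SzegoExtension w De D J ρ R₀)
    (hpos : ∀ ζ, 0 < w ζ) (hw : Continuous w) {φ : ℕ → ℂ[X]} (hφ : IsOrthonormalSystem w φ)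
    (n : ℕ) {z : ℂ} (hz : 1 < ‖z‖) :
    ‖cInt 1 (fun t => D t / De t * (monicOP φ n).eval t / (t - z))‖ ≤
      (2 * Real.pi)⁻¹ * ((‖z‖ - 1)⁻¹ * ∫ θ in (0 : ℝ)..(2 * Real.pi), w (Circle.exp θ)) := by
  have hwc : Continuous fun θ : ℝ => w (Circle.exp θ) := hw.comp Circle.exp.continuous
  have h2 : ‖((2 * Real.pi : ℂ))⁻¹‖ = (2 * Real.pi)⁻¹ := by
    rw [norm_inv, norm_mul, Complex.norm_real, Real.norm_of_nonneg Real.pi_pos.le]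
    simp
  rw [cInt_one_eq, norm_mul, h2]
  have hz0 : 0 < ‖z‖ - 1 := by linarith
  refine mul_le_mul_of_nonneg_left ?_ (by positivity)
  calc _ ≤ ∫ θ in (0 : ℝ)..(2 * Real.pi), (‖z‖ - 1)⁻¹ *
        (‖(monicOP φ n).eval (Circle.exp θ : ℂ)‖ * w (Circle.exp θ)) := by
        refine intervalIntegral.norm_integral_le_of_norm_le Real.two_pi_pos.le
          (Eventually.of_forall fun θ _ => ?_) (Continuous.intervalIntegrable
            (continuous_const.mul ((continuous_eval_circleExp _).norm.mul hwc)) _ _)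
        rw [← h.weight_eq θ, norm_mul, norm_div, norm_mul, Circle.norm_coe, mul_one,
          Complex.norm_real, Real.norm_of_nonneg (hpos _).le, div_eq_inv_mul,
          mul_comm (w _)]
        have hd : ‖z‖ - 1 ≤ ‖(Circle.exp θ : ℂ) - z‖ := by
          have := norm_sub_norm_le z (Circle.exp θ : ℂ)
          rwa [Circle.norm_coe, norm_sub_rev] at this
        have := (hpos (Circle.exp θ)).le
        gcongr
    _ ≤ _ := by
        rw [intervalIntegral.integral_const_mul]
        have := integral_norm_monicOP_mul_le hpos hw hφ n
        gcongr

/-- The function `A` with `D Φₙ / Dₑ = zⁿ A + O(1/z)` around the unit circle. -/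
noncomputable def interiorPart (De D : ℂ → ℂ) (R : ℝ) (φ : ℕ → ℂ[X]) (n : ℕ) (z : ℂ) : ℂ :=
  cInt R fun t => D t / De t * (monicOP φ n).eval t / t ^ n / (t - z)

/-- The part of `D Φₙ / Dₑ` that is holomorphic outside the unit circle. -/
noncomputable def exteriorPart (De D : ℂ → ℂ) (φ : ℕ → ℂ[X]) (n : ℕ) (z : ℂ) : ℂ :=
  -cInt 1 fun t => D t / De t * (monicOP φ n).eval t / (t - z)

theorem ne_zero_of_one_le_norm {t : ℂ} (ht : 1 ≤ ‖t‖) : t ≠ 0 := fun h => by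
  simp [h] at ht
  linarith

theorem SzegoExtension.analyticAt_interiorPart (h : SzegoExtension w De D J ρ R₀) {R : ℝ}
    (hR1 : 1 ≤ R) (hR : R < R₀) (φ : ℕ → ℂ[X]) (n : ℕ) {z : ℂ} (hz : ‖z‖ < R) :
    AnalyticAt ℂ (interiorPart De D R φ n) z := by
  refine analyticAt_cInt_div_sub (by linarith) (circleIntegrable_of_analyticAt (by linarith)
    fun t ht => ?_) hz
  exact (h.analyticAt_weight_mul _ (ht ▸ hR1) (ht ▸ hR)).div (analyticAt_id.pow _)
    (pow_ne_zero _ (ne_zero_of_one_le_norm (ht ▸ hR1)))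

theorem SzegoExtension.analyticAt_exteriorPart (h : SzegoExtension w De D J ρ R₀)
    (φ : ℕ → ℂ[X]) (n : ℕ) {z : ℂ} (hz : 1 < ‖z‖) :
    AnalyticAt ℂ (exteriorPart De D φ n) z := by
  refine (analyticAt_cInt_div_sub_of_lt_norm zero_lt_one
    (circleIntegrable_of_analyticAt zero_le_one fun t ht => ?_) hz).neg
  exact h.analyticAt_weight_mul _ ht.ge (ht ▸ h.one_lt)

/-- The kernels 1/(t - z) and z^n/(t^n (t - z)) differ by a geometric sum of z^k/t^(k+1) with k < n,
whose integrals are the vanishing moments. This is where orthogonality enters: the part holomorphic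
inside is divisible by z^n. -/
theorem SzegoExtension.pow_mul_interiorPart (h : SzegoExtension w De D J ρ R₀)
    (hw : Continuous w) {φ : ℕ → ℂ[X]} (hφ : IsOrthonormalSystem w φ) (n : ℕ) {R : ℝ}
    (hR1 : 1 ≤ R) (hR : R < R₀) {z : ℂ} (hz : ‖z‖ < R) :
    z ^ n * interiorPart De D R φ n z =
      cInt R fun t => D t / De t * (monicOP φ n).eval t / (t - z) := by
  have h0 : ∀ t : ℂ, ‖t‖ = R → t ≠ 0 := fun t ht => ne_zero_of_one_le_norm (ht ▸ hR1)
  have hR0 : 0 ≤ R := by linarith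
  have han : ∀ t : ℂ, ‖t‖ = R → AnalyticAt ℂ (fun t => D t / De t * (monicOP φ n).eval t) t :=
    fun t ht => h.analyticAt_weight_mul _ (ht ▸ hR1) (ht ▸ hR)
  have hsub : ∀ t : ℂ, ‖t‖ = R → t - z ≠ 0 := fun t ht => sub_ne_zero_of_norm_lt (ht ▸ hz)
  unfold interiorPart
  rw [← cInt_const_mul, eq_comm, ← sub_eq_zero, ← cInt_sub]
  · rw [cInt_congr hR0 (g := fun t => ∑ j ∈ Finset.range n, z ^ (n - 1 - j) *
      (D t / De t * (monicOP φ n).eval t / t ^ (n - 1 - j + 1))), cInt_sum]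
    · refine Finset.sum_eq_zero fun j hj => ?_
      rw [cInt_const_mul, h.cInt_moment_eq_zero hw hφ (by
        have := Finset.mem_range.1 hj; omega) hR1 hR, mul_zero]
    · intro j _
      exact circleIntegrable_of_analyticAt hR0 fun t ht =>
        analyticAt_const.mul ((han t ht).div (analyticAt_id.pow _) (pow_ne_zero _ (h0 t ht)))
    · intro t ht
      have h1 := h0 t ht
      have h2 := hsub t ht
      have hg := (Commute.all t z).geom_sum₂_mul n
      have h3 : ∀ j ∈ Finset.range n, z ^ (n - 1 - j) *
          (D t / De t * (monicOP φ n).eval t / t ^ (n - 1 - j + 1)) =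
          (D t / De t * (monicOP φ n).eval t / t ^ n) * (t ^ j * z ^ (n - 1 - j)) := by
        intro j hj
        have hj := Finset.mem_range.1 hj
        have : t ^ n = t ^ j * t ^ (n - 1 - j + 1) := by rw [← pow_add]; congr 1; omega
        rw [this]
        field_simp
      rw [Finset.sum_congr rfl h3, ← Finset.mul_sum, eq_div_of_mul_eq h2 hg]
      have := pow_ne_zero n h1
      field_simp
  · exact circleIntegrable_of_analyticAt hR0 fun t ht => analyticAt_div_sub (han t ht) (hsub t ht)
  · exact circleIntegrable_of_analyticAt hR0 fun t ht => analyticAt_const.mul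
      (analyticAt_div_sub ((han t ht).div (analyticAt_id.pow _) (pow_ne_zero _ (h0 t ht)))
        (hsub t ht))

theorem SzegoExtension.weight_mul_eq (h : SzegoExtension w De D J ρ R₀)
    (hw : Continuous w) {φ : ℕ → ℂ[X]} (hφ : IsOrthonormalSystem w φ) (n : ℕ) {R : ℝ}
    (hR1 : 1 ≤ R) (hR : R < R₀) {z : ℂ} (hz1 : 1 < ‖z‖) (hz : ‖z‖ < R) :
    D z / De z * (monicOP φ n).eval z =
      z ^ n * interiorPart De D R φ n z + exteriorPart De D φ n z := by
  rw [h.pow_mul_interiorPart hw hφ n hR1 hR hz, exteriorPart, ← sub_eq_add_neg]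
  exact cInt_annulus zero_lt_one
    (fun t h1 h2 => h.analyticAt_weight_mul (monicOP φ n) h1 (h2.trans_lt hR)) hz1 hz

theorem tendsto_div_sub_cobounded (z : ℂ) :
    Tendsto (fun t => t / (t - z)) (Bornology.cobounded ℂ) (𝓝 1) := by
  have h1 : Tendsto (fun t : ℂ => (1 - z * t⁻¹)⁻¹) (Bornology.cobounded ℂ) (𝓝 (1 - z * 0)⁻¹) :=
    (tendsto_const_nhds.sub (tendsto_inv₀_cobounded.const_mul z)).inv₀ (by simp)
  rw [mul_zero, sub_zero, inv_one] at h1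
  refine h1.congr' ?_
  filter_upwards [Bornology.eventually_ne_cobounded (0 : ℂ),
    Bornology.eventually_ne_cobounded z] with t ht htz
  have h2 : 1 - z * t⁻¹ = (t - z) / t := by field_simp
  rw [h2, inv_div]

theorem SzegoExtension.tendsto_exteriorPart (h : SzegoExtension w De D J ρ R₀)
    (hpos : ∀ ζ, 0 < w ζ) (hw : Continuous w) {φ : ℕ → ℂ[X]} (hφ : IsOrthonormalSystem w φ)
    (n : ℕ) : Tendsto (exteriorPart De D φ n) (Bornology.cobounded ℂ) (𝓝 0) := by
  set M := ∫ θ in (0 : ℝ)..(2 * Real.pi), w (Circle.exp θ)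
  have h1 : Tendsto (fun z : ℂ => (2 * Real.pi)⁻¹ * ((‖z‖ - 1)⁻¹ * M)) (Bornology.cobounded ℂ)
      (𝓝 ((2 * Real.pi)⁻¹ * (0 * M))) :=
    ((tendsto_inv_atTop_zero.comp (tendsto_atTop_add_const_right _ (-1)
      (tendsto_norm_cobounded_atTop (E := ℂ)))).mul_const _).const_mul _
  rw [zero_mul, mul_zero] at h1
  refine squeeze_zero_norm' ?_ h1
  filter_upwards [tendsto_norm_cobounded_atTop.eventually (eventually_gt_atTop 1)] with z hz
  rw [exteriorPart, norm_neg]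
  exact h.norm_cInt_one_le hpos hw hφ n hz

/-- The contour integral representation of the orthogonal polynomials. -/
theorem SzegoExtension.mul_monicOP_eq (h : SzegoExtension w De D J ρ R₀)
    (hpos : ∀ ζ, 0 < w ζ) (hw : Continuous w) {φ : ℕ → ℂ[X]} (hφ : IsOrthonormalSystem w φ)
    (n : ℕ) {R : ℝ} (hR1 : 1 < R) (hR : R < R₀) {z : ℂ} (hz : ‖z‖ < 1) :
    D z * (monicOP φ n).eval z =
      cInt 1 fun t => t ^ n * interiorPart De D R φ n t * De t / (t - z) := by
  obtain ⟨S, hS1, hS⟩ := exists_between hR1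
  have hS0 : 0 < S := by linarith
  have hp : ∀ t, AnalyticAt ℂ (fun t => (monicOP φ n).eval t) t := fun t =>
    AnalyticOnNhd.eval_polynomial _ t (Set.mem_univ _)
  have hsub : ∀ t : ℂ, 1 ≤ ‖t‖ → t - z ≠ 0 := fun t ht => sub_ne_zero_of_norm_lt (hz.trans_le ht)
  -- The circle is moved into the annulus where the splitting holds. There the integrand is D Φ_n/(t
  -- - z) minus `De` times the exterior part over t - z; the first gives the value at z, the second
  -- is o(1/t) at infinity and integrates to 0.
  rw [← cInt_deform zero_lt_one hS1.le, cInt_congr hS0.le (g := fun t =>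
    D t * (monicOP φ n).eval t / (t - z) - De t * exteriorPart De D φ n t / (t - z)), cInt_sub,
    cInt_cauchy (f := fun t => D t * (monicOP φ n).eval t)
      (fun t ht => (h.analyticAt_D t (by linarith)).mul (hp t)) (hz.trans hS1),
    cInt_eq_of_tendsto hS0 (f := fun t => De t * exteriorPart De D φ n t / (t - z)) (c := 0),
    sub_zero]
  · exact fun t ht => analyticAt_div_sub ((h.analyticAt_De t (h.lt_one.trans
      (hS1.trans_le ht))).mul (h.analyticAt_exteriorPart φ n (hS1.trans_le ht)))
      (hsub t (hS1.le.trans ht))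
  · have := (h.tendsto_De.mul (h.tendsto_exteriorPart hpos hw hφ n)).mul
      (tendsto_div_sub_cobounded z)
    rw [mul_zero, zero_mul] at this
    exact this.congr fun t => by ring
  · exact circleIntegrable_of_analyticAt hS0.le fun t ht => analyticAt_div_sub
      ((h.analyticAt_D t (by linarith)).mul (hp t)) (hsub t (ht ▸ hS1.le))
  · exact circleIntegrable_of_analyticAt hS0.le fun t ht => analyticAt_div_sub
      ((h.analyticAt_De t (h.lt_one.trans (ht ▸ hS1))).mul
      (h.analyticAt_exteriorPart φ n (ht ▸ hS1))) (hsub t (ht ▸ hS1.le))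
  · intro t ht
    have h1 := h.weight_mul_eq hw hφ n hR1.le hR (ht ▸ hS1) (ht ▸ hS)
    have h2 := h.De_ne t (ht ▸ hS1.le)
    have h3 : D t * (monicOP φ n).eval t = De t * (D t / De t * (monicOP φ n).eval t) := by
      field_simp
    rw [← sub_div, h3, h1]
    ring
  · exact fun t h1 h2 => analyticAt_div_sub (((analyticAt_id.pow n).mul
      (h.analyticAt_interiorPart hR1.le hR φ n (h2.trans_lt hS))).mul
      (h.analyticAt_De t (h.lt_one.trans_le h1))) (hsub t h1)

/-- Dividing the splitting by t^n D gives A/D = Φ/(t^n D_e) - B J/t^n in a thin annulus. The first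
term is analytic outside with limit 1/τ and contributes exactly 1/τ to the Cauchy integral; in the
second the circle can grow as far as `J` is analytic. -/
theorem SzegoExtension.interiorPart_div_sub_eq (h : SzegoExtension w De D J ρ R₀)
    (hw : Continuous w) {φ : ℕ → ℂ[X]} (hφ : IsOrthonormalSystem w φ)
    (n : ℕ) {R : ℝ} (hR1 : 1 < R) (hR : R < R₀) {S : ℝ} (hRS : R ≤ S) (hSρ : S * ρ < 1)
    {z : ℂ} (hz : ‖z‖ ≤ 1) :
    interiorPart De D R φ n z / D z - (szegoTau w : ℂ)⁻¹ =
      -cInt S fun t => exteriorPart De D φ n t * J t / t ^ n / (t - z) := by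
  obtain ⟨T, hT1, hT⟩ := exists_between hR1
  have hT0 : 0 < T := by linarith
  have hp : ∀ t, AnalyticAt ℂ (fun t => (monicOP φ n).eval t) t := fun t =>
    AnalyticOnNhd.eval_polynomial _ t (Set.mem_univ _)
  have hsub : ∀ t : ℂ, 1 < ‖t‖ → t - z ≠ 0 := fun t ht => sub_ne_zero_of_norm_lt (hz.trans_lt ht)
  have hτ : (szegoTau w : ℂ) ≠ 0 := by exact_mod_cast (Real.exp_pos _).ne'
  have han1 : ∀ t : ℂ, T ≤ ‖t‖ → AnalyticAt ℂ
      (fun t => (monicOP φ n).eval t / t ^ n / De t / (t - z)) t := fun t ht =>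
    analyticAt_div_sub (((hp t).div (analyticAt_id.pow n) (pow_ne_zero _
      (ne_zero_of_one_le_norm (hT1.le.trans ht)))).div (h.analyticAt_De t (by
        linarith [h.lt_one])) (h.De_ne t (hT1.le.trans ht))) (hsub t (hT1.trans_le ht))
  have han2 : ∀ t : ℂ, T ≤ ‖t‖ → ‖t‖ ≤ S → AnalyticAt ℂ
      (fun t => exteriorPart De D φ n t * J t / t ^ n / (t - z)) t := fun t ht hS =>
    analyticAt_div_sub (((h.analyticAt_exteriorPart φ n (hT1.trans_le ht)).mul
      (h.analyticAt_J t (hT1.le.trans ht) ((mul_le_mul_of_nonneg_right hS h.pos.le).trans_lt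
        hSρ))).div (analyticAt_id.pow n) (pow_ne_zero _
      (ne_zero_of_one_le_norm (hT1.le.trans ht)))) (hsub t (hT1.trans_le ht))
  have key := cInt_cauchy (f := fun t => interiorPart De D R φ n t / D t) (R := T) (z := z)
    (fun t ht => (h.analyticAt_interiorPart hR1.le hR φ n (ht.trans_lt hT)).div
      (h.analyticAt_D t (by linarith)) (h.D_ne t (by linarith))) (hz.trans_lt hT1)
  rw [← key, cInt_deform hT0 (hT.le.trans hRS) han2, cInt_congr hT0.le (g := fun t =>
    (monicOP φ n).eval t / t ^ n / De t / (t - z) -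
    exteriorPart De D φ n t * J t / t ^ n / (t - z)), cInt_sub,
    cInt_eq_of_tendsto hT0 han1 (c := (szegoTau w : ℂ)⁻¹)]
  · ring
  · have h1 := monic_eval_div_pow_tendsto (monic_monicOP hφ n)
    rw [natDegree_monicOP hφ] at h1
    have := (h1.div h.tendsto_De hτ).mul (tendsto_div_sub_cobounded z)
    rw [mul_one, one_div] at this
    exact this.congr fun t => by rw [Pi.div_apply]; ring
  · exact circleIntegrable_of_analyticAt hT0.le fun t ht => han1 t ht.ge
  · exact circleIntegrable_of_analyticAt hT0.le fun t ht => han2 t ht.ge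
      (ht ▸ (hT.le.trans hRS))
  · intro t ht
    have h1 := h.weight_mul_eq hw hφ n hR1.le hR (ht ▸ hT1) (ht ▸ hT)
    have h2 := h.De_ne t (ht ▸ hT1.le)
    have h3 := h.D_ne t (by linarith)
    have h4 : t ^ n ≠ 0 := pow_ne_zero _ (ne_zero_of_one_le_norm (ht ▸ hT1.le))
    rw [← sub_div]
    congr 1
    rw [h.J_eq t (ht ▸ hT1.le) (by linarith)]
    field_simp at h1 ⊢
    linear_combination -h1

theorem SzegoExtension.exists_norm_interiorPart_sub_le (h : SzegoExtension w De D J ρ R₀)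
    (hpos : ∀ ζ, 0 < w ζ) (hw : Continuous w) {φ : ℕ → ℂ[X]} (hφ : IsOrthonormalSystem w φ)
    {R : ℝ} (hR1 : 1 < R) (hR : R < R₀) {q : ℝ} (hq : ρ < q) :
    ∃ M, 0 ≤ M ∧ ∀ n z, ‖z‖ ≤ 1 →
      ‖interiorPart De D R φ n z - D z / szegoTau w‖ ≤ M * q ^ n := by
  have hRρ : R * ρ < 1 := (mul_le_mul_of_nonneg_right hR.le h.pos.le).trans_lt h.mul_lt
  have hR0 : 0 < R := by linarith
  have hρR : ρ < R⁻¹ := by rw [inv_eq_one_div, lt_div_iff₀ hR0, mul_comm]; exact hRρ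
  -- The large circle has radius S = 1/p: p > ρ keeps it in the domain of `J`, p < 1/R puts it
  -- beyond R, and t^(-n) contributes p^n ≤ q^n.
  obtain ⟨p, hp1, hp2⟩ := exists_between (lt_min hq hρR)
  have hp0 : 0 < p := h.pos.trans hp1
  have hpq : p < q := hp2.trans_le (min_le_left _ _)
  have hpR : R < p⁻¹ := by
    rw [lt_inv_comm₀ hR0 hp0]; exact hp2.trans_le (min_le_right _ _)
  set S := p⁻¹ with hS
  have hS0 : 0 < S := hR0.trans hpR
  have hS1 : 1 < S := hR1.trans hpR
  have hSρ : S * ρ < 1 := by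
    rw [hS, inv_mul_lt_iff₀ hp0, mul_one]; exact hp1
  obtain ⟨B, hB⟩ := (isCompact_sphere (0 : ℂ) S).exists_bound_of_continuousOn (f := J)
    fun t ht => by
      have ht : ‖t‖ = S := by simpa using ht
      exact (h.analyticAt_J t (ht ▸ hS1.le) (ht ▸ hSρ)).continuousAt.continuousWithinAt
  obtain ⟨B', hB'⟩ := (isCompact_closedBall (0 : ℂ) 1).exists_bound_of_continuousOn (f := D)
    fun t ht => by
      have ht : ‖t‖ ≤ 1 := by simpa using ht
      exact (h.analyticAt_D t (ht.trans_lt h.one_lt)).continuousAt.continuousWithinAt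
  set V := (2 * Real.pi)⁻¹ * ((S - 1)⁻¹ * ∫ θ in (0 : ℝ)..(2 * Real.pi), w (Circle.exp θ)) with hV
  have hSm : 0 < S - 1 := by linarith
  have hVb : ∀ n t, ‖t‖ = S → ‖exteriorPart De D φ n t‖ ≤ V := by
    intro n t ht
    rw [exteriorPart, norm_neg, hV, ← ht]
    exact h.norm_cInt_one_le hpos hw hφ n (ht ▸ hS1)
  have hV0 : 0 ≤ V := (norm_nonneg _).trans (hVb 0 (S : ℂ) (by simp [abs_of_pos hS0]))
  have hB0 : 0 ≤ B := (norm_nonneg _).trans (hB (S : ℂ) (by simp [abs_of_pos hS0]))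
  have hB'0 : 0 ≤ B' := (norm_nonneg _).trans (hB' 0 (by simp))
  refine ⟨B' * (S * (V * B / (S - 1))), by positivity, fun n z hz => ?_⟩
  have hD := h.D_ne z (hz.trans_lt h.one_lt)
  have e : interiorPart De D R φ n z - D z / szegoTau w =
      D z * (interiorPart De D R φ n z / D z - (szegoTau w : ℂ)⁻¹) := by
    field_simp
  rw [e, h.interiorPart_div_sub_eq hw hφ n hR1 hR hpR.le hSρ hz, norm_mul, norm_neg,
    mul_assoc]
  refine mul_le_mul (hB' z (by simpa using hz)) ?_ (norm_nonneg _) hB'0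
  rw [mul_assoc]
  refine norm_cInt_le hS0.le fun t ht => ?_
  have hd : S - 1 ≤ ‖t - z‖ := by
    have := norm_sub_norm_le t z
    linarith
  have hpn : ‖t ^ n‖⁻¹ ≤ q ^ n := by
    rw [norm_pow, ht, hS, inv_pow, inv_inv]
    gcongr
  rw [norm_div, norm_div, norm_mul, div_eq_mul_inv, div_eq_mul_inv, div_eq_mul_inv, mul_right_comm]
  have h1 := hVb n t ht
  have h2 := hB t (by simpa using ht)
  have h3 : ‖t - z‖⁻¹ ≤ (S - 1)⁻¹ := inv_anti₀ hSm hd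
  gcongr

end Riemann

/-! ### Poles and principal parts -/

/-- Each divided difference peels off the term of highest order. The top coefficient is described
through m = k + 1 because there is none for m = 0. -/
theorem exists_principalPart {a : ℂ} (m : ℕ) : ∀ {g : ℂ → ℂ}, AnalyticAt ℂ g a →
    ∃ (c : ℕ → ℂ) (g' : ℂ → ℂ), AnalyticAt ℂ g' a ∧ (∀ k, m = k + 1 → c k = g a) ∧
      ∀ z, z ≠ a → g z / (z - a) ^ m = ∑ j ∈ Finset.range m, c j / (z - a) ^ (j + 1) + g' z := by
  induction m with
  | zero => exact fun {g} hg => ⟨0, g, hg, fun k hk => by omega, fun z _ => by simp⟩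
  | succ m ih =>
    intro g hg
    obtain ⟨c, g', hg', -, h⟩ := ih (hg.dslope hg)
    refine ⟨Function.update c m (g a), g', hg', fun k hk => ?_, fun z hz => ?_⟩
    · obtain rfl : m = k := by omega
      simp
    · rw [Finset.sum_range_succ, Function.update_self, Finset.sum_congr rfl (g := fun j =>
        c j / (z - a) ^ (j + 1)) fun j hj => by
          rw [Function.update_of_ne (Finset.mem_range.1 hj).ne]]
      have h1 := h z hz
      rw [add_right_comm, ← h1]
      have h2 : z - a ≠ 0 := sub_ne_zero.2 hz
      have h3 := sub_smul_dslope g a z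
      rw [smul_eq_mul] at h3
      rw [show g z = (z - a) * dslope g a z + g a from eq_add_of_sub_eq h3.symm]
      field_simp
      ring

/-- One common exponent m serves all poles: a pole of smaller multiplicity is padded by powers of z
- a, so its numerator vanishes at a. This later makes the top coefficient zero exactly at the
non-dominant poles. -/
theorem IsPoleAt.exists_eq_div {f : ℂ → ℂ} {a : ℂ} (h : IsPoleAt f a) {m : ℕ}
    (hm : poleMult f a ≤ m) : ∃ g : ℂ → ℂ, AnalyticAt ℂ g a ∧
      (∀ᶠ z in 𝓝[≠] a, f z = g z / (z - a) ^ m) ∧ (poleMult f a = m ↔ g a ≠ 0) := by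
  obtain ⟨hmer, hneg⟩ := h
  obtain ⟨n, hn⟩ := WithTop.ne_top_iff_exists.1 hneg.ne_top
  rw [← hn] at hneg
  have hn0 : n < 0 := by exact_mod_cast hneg
  have hp : poleMult f a = (-n).toNat := by rw [poleMult, ← hn, WithTop.untop₀_coe]
  obtain ⟨g, hg, hga, hfg⟩ := (meromorphicOrderAt_eq_int_iff hmer).1 hn.symm
  obtain ⟨d, hd⟩ := Nat.exists_eq_add_of_le hm
  refine ⟨fun z => (z - a) ^ d * g z, ((analyticAt_id.sub analyticAt_const).pow d).mul hg, ?_, ?_⟩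
  · filter_upwards [hfg, self_mem_nhdsWithin] with z hz hza
    have h0 : z - a ≠ 0 := sub_ne_zero.2 hza
    have h1 : n = -((poleMult f a : ℕ) : ℤ) := by rw [hp]; omega
    rw [hz, hd, h1, zpow_neg, zpow_natCast, smul_eq_mul, pow_add]
    field_simp
  · rw [hd]
    rcases Nat.eq_zero_or_pos d with h0 | h0
    · simp [h0, hga]
    · simp [h0.ne']

theorem IsPoleAt.poleMult_pos {f : ℂ → ℂ} {a : ℂ} (h : IsPoleAt f a) : 0 < poleMult f a := by
  obtain ⟨hmer, hneg⟩ := h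
  obtain ⟨n, hn⟩ := WithTop.ne_top_iff_exists.1 hneg.ne_top
  rw [← hn] at hneg
  have hn0 : n < 0 := by exact_mod_cast hneg
  rw [poleMult, ← hn, WithTop.untop₀_coe]
  omega

/-- All removable singularities are filled at once by redefining the function as its punctured
limit, which near each point agrees with the local analytic model. -/
theorem exists_analytic_extension {U : Set ℂ} {S : ℂ → ℂ}
    (h : ∀ z ∈ U, ∃ s, AnalyticAt ℂ s z ∧ ∀ᶠ t in 𝓝[≠] z, S t = s t) :
    ∃ R : ℂ → ℂ, (∀ z ∈ U, AnalyticAt ℂ R z) ∧ ∀ z, ContinuousAt S z → R z = S z := by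
  refine ⟨fun z => limUnder (𝓝[≠] z) S, fun z hz => ?_, fun z hz =>
    (hz.tendsto.mono_left nhdsWithin_le_nhds).limUnder_eq⟩
  obtain ⟨s, hs, hS⟩ := h z hz
  have key : ∀ t, ContinuousAt s t → (∀ᶠ x in 𝓝[≠] t, S x = s x) → s t = limUnder (𝓝[≠] t) S :=
    fun t h1 h2 => (((h1.tendsto.mono_left nhdsWithin_le_nhds).congr'
      (h2.mono fun _ hx => hx.symm)).limUnder_eq).symm
  refine hs.congr ?_
  rw [eventually_nhdsWithin_iff, eventually_nhds_iff] at hS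
  obtain ⟨V, hV, hVo, hzV⟩ := hS
  filter_upwards [hVo.mem_nhds hzV, hs.eventually_analyticAt] with t htV hts
  refine key t hts.continuousAt ?_
  by_cases htz : t = z
  · subst htz
    rw [eventually_nhdsWithin_iff]
    filter_upwards [hVo.mem_nhds hzV] with x hx hne using hV x hx hne
  · refine Filter.Eventually.filter_mono nhdsWithin_le_nhds ?_
    filter_upwards [hVo.mem_nhds htV, isOpen_ne.mem_nhds htz] with x hx hne using hV x hx hne

theorem analyticAt_principalPart {a z : ℂ} (h : z ≠ a) (c : ℕ → ℂ) (m : ℕ) :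
    AnalyticAt ℂ (fun z => ∑ j ∈ Finset.range m, c j / (z - a) ^ (j + 1)) z :=
  Finset.analyticAt_fun_sum _ fun _ _ => analyticAt_const.div
    ((analyticAt_id.sub analyticAt_const).pow _) (pow_ne_zero _ (sub_ne_zero.2 h))

/-- Separation of the principal parts at finitely many poles of order at most `μ + 1`. -/
theorem exists_principalPart_decomposition {f : ℂ → ℂ} {U : Set ℂ} {u μ : ℕ} {a : Fin u → ℂ}
    (ha : Function.Injective a) (hpole : ∀ k, IsPoleAt f (a k))
    (hmult : ∀ k, poleMult f (a k) ≤ μ + 1)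
    (han : ∀ z ∈ U, z ∉ Set.range a → AnalyticAt ℂ f z) :
    ∃ (c : Fin u → ℕ → ℂ) (R : ℂ → ℂ), (∀ z ∈ U, AnalyticAt ℂ R z) ∧
      (∀ z ∈ U, z ∉ Set.range a →
        f z = ∑ k, ∑ j ∈ Finset.range (μ + 1), c k j / (z - a k) ^ (j + 1) + R z) ∧
      (∀ k, poleCoeff f (μ + 1) (a k) = c k μ) ∧
      ∀ k, poleMult f (a k) = μ + 1 ↔ c k μ ≠ 0 := by
  choose g hg hfg hga using fun k => (hpole k).exists_eq_div (hmult k)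
  choose c g' hg' hc hcg using fun k => exists_principalPart (μ + 1) (hg k)
  have hcμ : ∀ k, c k μ = g k (a k) := fun k => hc k μ rfl
  set S : ℂ → ℂ := fun z => f z - ∑ k, ∑ j ∈ Finset.range (μ + 1), c k j / (z - a k) ^ (j + 1)
    with hS
  have hSan : ∀ z ∈ U, z ∉ Set.range a → AnalyticAt ℂ S z := fun z hz hza =>
    (han z hz hza).sub (Finset.analyticAt_fun_sum _ fun k _ =>
      analyticAt_principalPart (fun h => hza ⟨k, h.symm⟩) _ _)
  obtain ⟨R, hR, hRS⟩ := exists_analytic_extension (U := U) (S := S) fun z hz => by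
    by_cases hza : z ∈ Set.range a
    · obtain ⟨k, rfl⟩ := hza
      -- At a pole, its own principal part cancels and the principal parts of the other poles are
      -- analytic.
      refine ⟨fun z => g' k z - ∑ i ∈ Finset.univ.erase k,
        ∑ j ∈ Finset.range (μ + 1), c i j / (z - a i) ^ (j + 1), (hg' k).sub
          (Finset.analyticAt_fun_sum _ fun i hi => analyticAt_principalPart
            (fun h => (Finset.ne_of_mem_erase hi) (ha h).symm) _ _), ?_⟩
      filter_upwards [hfg k, self_mem_nhdsWithin] with t ht hta
      rw [hS]
      simp only
      rw [ht, hcg k t hta, ← Finset.add_sum_erase _ _ (Finset.mem_univ k)]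
      ring
    · exact ⟨S, hSan z hz hza, Eventually.of_forall fun _ => rfl⟩
  refine ⟨c, R, hR, fun z hz hza => ?_, fun k => ?_, fun k => ?_⟩
  · rw [hRS z (hSan z hz hza).continuousAt, hS]
    ring
  · rw [hcμ, poleCoeff]
    refine Tendsto.limUnder_eq (((hg k).continuousAt.tendsto.mono_left
      nhdsWithin_le_nhds).congr' ?_)
    filter_upwards [hfg k, self_mem_nhdsWithin] with t ht hta
    have h0 : t - a k ≠ 0 := sub_ne_zero.2 hta
    rw [ht]
    field_simp
  · rw [hcμ]
    exact hga k

/-! ### Residues of t^n g(t) at a multiple pole -/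

/-- Iterated partial fractions: 1/((t - a)(t - z)) = (1/(t - z) - 1/(t - a))/(z - a). -/
theorem cInt_div_pow_div_sub {G : ℂ → ℂ} (hG : ∀ t, ‖t‖ ≤ 1 → AnalyticAt ℂ G t) {a z : ℂ}
    (ha : ‖a‖ < 1) (hz : ‖z‖ < 1) (hza : z ≠ a) (j : ℕ) :
    cInt 1 (fun t => G t / (t - a) ^ j / (t - z)) = G z / (z - a) ^ j -
      ∑ i ∈ Finset.range j, cInt 1 (fun t => G t / (t - a) ^ (i + 1)) / (z - a) ^ (j - i) := by
  have hta : ∀ t : ℂ, ‖t‖ = 1 → t - a ≠ 0 := fun t ht => sub_ne_zero_of_norm_lt (ht ▸ ha)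
  have htz : ∀ t : ℂ, ‖t‖ = 1 → t - z ≠ 0 := fun t ht => sub_ne_zero_of_norm_lt (ht ▸ hz)
  have han : ∀ j (t : ℂ), ‖t‖ = 1 → AnalyticAt ℂ (fun t => G t / (t - a) ^ j) t := fun j t ht =>
    (hG t ht.le).div ((analyticAt_id.sub analyticAt_const).pow _) (pow_ne_zero _ (hta t ht))
  have h0 : z - a ≠ 0 := sub_ne_zero.2 hza
  induction j with
  | zero => simpa using cInt_cauchy hG hz
  | succ j ih =>
    rw [cInt_congr zero_le_one (g := fun t => (z - a)⁻¹ * (G t / (t - a) ^ j / (t - z) -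
      G t / (t - a) ^ (j + 1))), cInt_const_mul, cInt_sub, ih, Finset.sum_range_succ]
    · have : ∀ i ∈ Finset.range j, cInt 1 (fun t => G t / (t - a) ^ (i + 1)) /
          (z - a) ^ (j + 1 - i) = (z - a)⁻¹ *
          (cInt 1 (fun t => G t / (t - a) ^ (i + 1)) / (z - a) ^ (j - i)) := by
        intro i hi
        have hi := Finset.mem_range.1 hi
        rw [show j + 1 - i = (j - i) + 1 by omega, pow_succ]
        field_simp
      rw [Finset.sum_congr rfl this, ← Finset.mul_sum, show j + 1 - j = 1 by omega]
      field_simp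
      ring
    · exact circleIntegrable_of_analyticAt zero_le_one fun t ht =>
        analyticAt_div_sub (han j t ht) (htz t ht)
    · exact circleIntegrable_of_analyticAt zero_le_one fun t ht => han _ t ht
    · intro t ht
      have h1 := hta t ht
      have h2 := htz t ht
      field_simp
      ring

/-- This is the i-th Taylor coefficient of t^n at a. Writing t^(n+1) = t^n (t - a) + a t^n yields
Pascal's recursion; for i > n the truncated exponent is harmless because the binomial vanishes. -/
theorem cInt_pow_div_sub_pow {a : ℂ} (ha : ‖a‖ < 1) (n : ℕ) : ∀ i : ℕ,
    cInt 1 (fun t => t ^ n / (t - a) ^ (i + 1)) = n.choose i * a ^ (n - i) := by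
  have hta : ∀ t : ℂ, 1 ≤ ‖t‖ → t - a ≠ 0 := fun t ht => sub_ne_zero_of_norm_lt (ha.trans_le ht)
  have h0 : ∀ n : ℕ, cInt 1 (fun t => t ^ n / (t - a) ^ (0 + 1)) = a ^ n := fun n => by
    simpa using cInt_cauchy (f := fun t => t ^ n) (fun t _ => analyticAt_id.pow n) ha
  have han : ∀ n i (t : ℂ), 1 ≤ ‖t‖ → AnalyticAt ℂ (fun t => t ^ n / (t - a) ^ i) t :=
    fun n i t ht => (analyticAt_id.pow n).div ((analyticAt_id.sub analyticAt_const).pow _)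
      (pow_ne_zero _ (hta t ht))
  induction n with
  | zero =>
    intro i
    cases i with
    | zero => simpa using h0 0
    | succ i =>
      rw [cInt_eq_of_tendsto zero_lt_one (c := 0) fun t ht => han 0 _ t ht]
      · simp
      · have h1 : Tendsto (fun t => (t - a)⁻¹) (Bornology.cobounded ℂ) (𝓝 0) :=
          tendsto_inv₀_cobounded.comp (tendsto_sub_const_cobounded a)
        have := (tendsto_div_sub_cobounded a).mul (h1.pow (i + 1))
        rw [zero_pow (by omega), mul_zero] at this
        exact this.congr fun t => by generalize t - a = b; ring
  | succ n ih =>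
    intro i
    cases i with
    | zero => simpa using h0 (n + 1)
    | succ i =>
      rw [cInt_congr zero_le_one (g := fun t => t ^ n / (t - a) ^ (i + 1) +
        a * (t ^ n / (t - a) ^ (i + 1 + 1))), cInt_add, cInt_const_mul, ih, ih,
        Nat.choose_succ_succ, Nat.add_sub_add_right]
      · rcases Nat.lt_or_ge n (i + 1) with h | h
        · simp [Nat.choose_eq_zero_of_lt h]
        · rw [show n - i = (n - (i + 1)) + 1 by omega]
          push_cast
          ring
      · exact circleIntegrable_of_analyticAt zero_le_one fun t ht => han _ _ t ht.ge
      · exact circleIntegrable_of_analyticAt zero_le_one fun t ht =>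
          analyticAt_const.mul (han _ _ t ht.ge)
      · intro t ht
        have := hta t ht.ge
        field_simp
        ring

/-- Freezing g at a extracts the leading term; the rest has a pole of one order less and hence one
power of n less. -/
theorem cInt_pow_mul_div_sub_pow_succ {a : ℂ} (ha : ‖a‖ < 1) {g : ℂ → ℂ}
    (hg : ∀ t, ‖t‖ ≤ 1 → AnalyticAt ℂ g t) (n i : ℕ) :
    cInt 1 (fun t => t ^ n * g t / (t - a) ^ (i + 1 + 1)) =
      n.choose (i + 1) * a ^ (n - (i + 1)) * g a +
        cInt 1 (fun t => t ^ n * dslope g a t / (t - a) ^ (i + 1)) := by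
  have hta : ∀ t : ℂ, ‖t‖ = 1 → t - a ≠ 0 := fun t ht => sub_ne_zero_of_norm_lt (ht ▸ ha)
  have han : ∀ i (t : ℂ), ‖t‖ = 1 → AnalyticAt ℂ (fun t => (t - a) ^ i) t :=
    fun i t ht => (analyticAt_id.sub analyticAt_const).pow _
  rw [cInt_congr zero_le_one (g := fun t => g a * (t ^ n / (t - a) ^ (i + 1 + 1)) +
    t ^ n * dslope g a t / (t - a) ^ (i + 1)), cInt_add, cInt_const_mul, cInt_pow_div_sub_pow ha]
  · ring
  · exact circleIntegrable_of_analyticAt zero_le_one fun t ht => analyticAt_const.mul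
      ((analyticAt_id.pow n).div (han _ t ht) (pow_ne_zero _ (hta t ht)))
  · exact circleIntegrable_of_analyticAt zero_le_one fun t ht =>
      ((analyticAt_id.pow n).mul ((hg a ha.le).dslope (hg t ht.le))).div (han _ t ht)
        (pow_ne_zero _ (hta t ht))
  · intro t ht
    have h1 := hta t ht
    have h2 := sub_smul_dslope g a t
    rw [smul_eq_mul] at h2
    rw [show g t = (t - a) * dslope g a t + g a from eq_add_of_sub_eq h2.symm]
    field_simp
    ring

/-- Induction on the pole order by freezing g at a. The constant is uniform in a and g, as needed
because g depends on n in the application. -/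
theorem exists_norm_cInt_pow_mul_le {ρ : ℝ} (h0 : 0 < ρ) (h1 : ρ < 1) (i : ℕ) :
    ∃ K, 0 ≤ K ∧ ∀ (a : ℂ) (g : ℂ → ℂ) (M : ℝ) (n : ℕ), ‖a‖ = ρ →
      (∀ t, ‖t‖ ≤ 1 → AnalyticAt ℂ g t) → (∀ t, ‖t‖ ≤ 1 → ‖g t‖ ≤ M) → 1 ≤ n →
      ‖cInt 1 (fun t => t ^ n * g t / (t - a) ^ (i + 1))‖ ≤ K * M * n ^ i * ρ ^ n := by
  induction i with
  | zero =>
    refine ⟨1, zero_le_one, fun a g M n ha hg hM _ => ?_⟩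
    have := cInt_cauchy (f := fun t => t ^ n * g t) (R := 1) (z := a)
      (fun t ht => (analyticAt_id.pow n).mul (hg t ht)) (by rw [ha]; exact h1)
    simp only [zero_add, pow_one]
    rw [this, norm_mul, norm_pow, ha, one_mul, pow_zero, mul_one, mul_comm]
    have := hM a (by rw [ha]; exact h1.le)
    gcongr
  | succ i ih =>
    obtain ⟨K, hK, ih⟩ := ih
    have h2 : 0 < 1 - ρ := by linarith
    refine ⟨(ρ ^ (i + 1))⁻¹ + K * (2 / (1 - ρ)), by positivity, fun a g M n ha hg hM hn => ?_⟩
    have ha1 : ‖a‖ < 1 := by rw [ha]; exact h1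
    have hM0 : 0 ≤ M := (norm_nonneg _).trans (hM a ha1.le)
    have hn1 : (1 : ℝ) ≤ n := by exact_mod_cast hn
    rw [cInt_pow_mul_div_sub_pow_succ ha1 hg]
    have e1 := ih a (dslope g a) (2 * M / (1 - ρ)) n ha
      (fun t ht => (hg a ha1.le).dslope (hg t ht))
      (fun t ht => by rw [← ha]; exact norm_dslope_le hg hM ha1 ht) hn
    have e2 : ‖(n.choose (i + 1) : ℂ) * a ^ (n - (i + 1)) * g a‖ ≤
        (ρ ^ (i + 1))⁻¹ * M * n ^ (i + 1) * ρ ^ n := by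
      rcases Nat.lt_or_ge n (i + 1) with h | h
      · simp only [Nat.choose_eq_zero_of_lt h, Nat.cast_zero, zero_mul, norm_zero]
        positivity
      · have h3 : ρ ^ n = ρ ^ (i + 1) * ρ ^ (n - (i + 1)) := by rw [← pow_add]; congr 1; omega
        have h4 : ((n.choose (i + 1) : ℕ) : ℝ) ≤ (n : ℝ) ^ (i + 1) := by
          exact_mod_cast Nat.choose_le_pow n (i + 1)
        rw [norm_mul, norm_mul, norm_pow, ha, Complex.norm_natCast, h3]
        have h5 := hM a ha1.le
        calc _ ≤ (n : ℝ) ^ (i + 1) * ρ ^ (n - (i + 1)) * M := by gcongr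
          _ = _ := by field_simp
    have e3 : K * (2 * M / (1 - ρ)) * n ^ i * ρ ^ n ≤
        K * (2 * M / (1 - ρ)) * n ^ (i + 1) * ρ ^ n := by
      have : (n : ℝ) ^ i ≤ n ^ (i + 1) := pow_le_pow_right₀ hn1 (by omega)
      gcongr
    refine (norm_add_le _ _).trans ((add_le_add e2 (e1.trans e3)).trans_eq ?_)
    ring

theorem exists_norm_cInt_pow_mul_sub_le {ρ : ℝ} (h0 : 0 < ρ) (h1 : ρ < 1) (i : ℕ) :
    ∃ K, 0 ≤ K ∧ ∀ (a : ℂ) (g : ℂ → ℂ) (M : ℝ) (n : ℕ), ‖a‖ = ρ →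
      (∀ t, ‖t‖ ≤ 1 → AnalyticAt ℂ g t) → (∀ t, ‖t‖ ≤ 1 → ‖g t‖ ≤ M) → 1 ≤ n →
      ‖cInt 1 (fun t => t ^ n * g t / (t - a) ^ (i + 1 + 1)) -
        n.choose (i + 1) * a ^ (n - (i + 1)) * g a‖ ≤ K * M * n ^ i * ρ ^ n := by
  obtain ⟨K, hK, h⟩ := exists_norm_cInt_pow_mul_le h0 h1 i
  have h2 : 0 < 1 - ρ := by linarith
  refine ⟨K * (2 / (1 - ρ)), by positivity, fun a g M n ha hg hM hn => ?_⟩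
  have ha1 : ‖a‖ < 1 := by rw [ha]; exact h1
  rw [cInt_pow_mul_div_sub_pow_succ ha1 hg, add_sub_cancel_left]
  refine (h a (dslope g a) (2 * M / (1 - ρ)) n ha
      (fun t ht => (hg a ha1.le).dslope (hg t ht))
      (fun t ht => by rw [← ha]; exact norm_dslope_le hg hM ha1 ht) hn).trans_eq ?_
  ring

/-! ### Residue expansion of the contour representation -/

/-- The data on which the asymptotic analysis of `P n` rests: a contour integral representation of
`D * P n` whose density `t ^ n * g n t * De t` has the poles `a k`, with principal parts
given by `c` and regular part `Q`. -/
structure PoleRepresentation (P : ℕ → ℂ → ℂ) (D De : ℂ → ℂ) (g : ℕ → ℂ → ℂ) (τ : ℂ) (ρ ρ' : ℝ)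
    {u : ℕ} (a : Fin u → ℂ) (μ : ℕ) (c : Fin u → ℕ → ℂ) (Q : ℂ → ℂ) : Prop where
  pos : 0 < ρ
  lt_one : ρ < 1
  nonneg' : 0 ≤ ρ'
  lt : ρ' < ρ
  norm_a : ∀ k, ‖a k‖ = ρ
  analyticAt_D : ∀ z, ‖z‖ ≤ 1 → AnalyticAt ℂ D z
  D_ne : ∀ z, ‖z‖ ≤ 1 → D z ≠ 0
  analyticAt_g : ∀ n z, ‖z‖ ≤ 1 → AnalyticAt ℂ (g n) z
  g_close : ∀ q, ρ < q → ∃ M, 0 ≤ M ∧ ∀ n z, ‖z‖ ≤ 1 → ‖g n z - D z / τ‖ ≤ M * q ^ n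
  rep : ∀ n z, ‖z‖ < 1 → D z * P n z = cInt 1 fun t => t ^ n * g n t * De t / (t - z)
  analyticAt_Q : ∀ z, ρ' < ‖z‖ → AnalyticAt ℂ Q z
  De_eq : ∀ z, ρ' < ‖z‖ → z ∉ Set.range a →
    De z = ∑ k, ∑ j ∈ Finset.range (μ + 1), c k j / (z - a k) ^ (j + 1) + Q z

/-- The contribution of the residues at the poles `a k`. -/
noncomputable def residuePart (g : ℕ → ℂ → ℂ) {u : ℕ} (a : Fin u → ℂ) (μ : ℕ)
    (c : Fin u → ℕ → ℂ) (n : ℕ) (z : ℂ) : ℂ :=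
  -∑ k, ∑ j ∈ Finset.range (μ + 1), c k j * ∑ i ∈ Finset.range (j + 1),
    cInt 1 (fun t => t ^ n * g n t / (t - a k) ^ (i + 1)) / (z - a k) ^ (j + 1 - i)

/-- The leading term of `residuePart`. -/
noncomputable def leadingPart (D : ℂ → ℂ) (τ : ℂ) {u : ℕ} (a : Fin u → ℂ) (μ : ℕ)
    (c : Fin u → ℕ → ℂ) (n : ℕ) (z : ℂ) : ℂ :=
  ∑ k, n.choose μ * a k ^ (n - μ) * (D (a k) / τ * c k μ / (a k - z))

namespace PoleRepresentation

variable {P : ℕ → ℂ → ℂ} {D De : ℂ → ℂ} {g : ℕ → ℂ → ℂ} {τ : ℂ} {ρ ρ' : ℝ} {u : ℕ}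
  {a : Fin u → ℂ} {μ : ℕ} {c : Fin u → ℕ → ℂ} {Q : ℂ → ℂ}

theorem exists_norm_D_le (h : PoleRepresentation P D De g τ ρ ρ' a μ c Q) :
    ∃ B, 0 ≤ B ∧ ∀ z, ‖z‖ ≤ 1 → ‖D z‖ ≤ B := by
  obtain ⟨B, hB⟩ := (isCompact_closedBall (0 : ℂ) 1).exists_bound_of_continuousOn (f := D)
    fun t ht => (h.analyticAt_D t (by simpa using ht)).continuousAt.continuousWithinAt
  exact ⟨B, (norm_nonneg _).trans (hB 0 (by simp)), fun z hz => hB z (by simpa using hz)⟩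

theorem exists_norm_inv_D_le (h : PoleRepresentation P D De g τ ρ ρ' a μ c Q) :
    ∃ B, 0 ≤ B ∧ ∀ z, ‖z‖ ≤ 1 → ‖(D z)⁻¹‖ ≤ B := by
  obtain ⟨B, hB⟩ := (isCompact_closedBall (0 : ℂ) 1).exists_bound_of_continuousOn
    (f := fun z => (D z)⁻¹) fun t ht => ((h.analyticAt_D t (by simpa using ht)).inv
      (h.D_ne t (by simpa using ht))).continuousAt.continuousWithinAt
  exact ⟨B, (norm_nonneg _).trans (hB 0 (by simp)), fun z hz => hB z (by simpa using hz)⟩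

theorem exists_norm_g_le (h : PoleRepresentation P D De g τ ρ ρ' a μ c Q) :
    ∃ B, 0 ≤ B ∧ ∀ n z, ‖z‖ ≤ 1 → ‖g n z‖ ≤ B := by
  obtain ⟨B, hB0, hB⟩ := h.exists_norm_D_le
  obtain ⟨M, hM0, hM⟩ := h.g_close 1 h.lt_one
  refine ⟨M + B / ‖τ‖, by positivity, fun n z hz => ?_⟩
  have h1 := hM n z hz
  rw [one_pow, mul_one] at h1
  have h2 : ‖D z / τ‖ ≤ B / ‖τ‖ := by
    rw [norm_div]
    have := hB z hz
    gcongr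
  calc ‖g n z‖ = ‖(g n z - D z / τ) + D z / τ‖ := by rw [sub_add_cancel]
    _ ≤ _ := (norm_add_le _ _).trans (add_le_add h1 h2)

theorem analyticAt_pow_mul (h : PoleRepresentation P D De g τ ρ ρ' a μ c Q) (n : ℕ) {t : ℂ}
    (ht : ‖t‖ ≤ 1) : AnalyticAt ℂ (fun t => t ^ n * g n t) t :=
  (analyticAt_id.pow n).mul (h.analyticAt_g n t ht)

theorem notMem_range_of_norm_ne (h : PoleRepresentation P D De g τ ρ ρ' a μ c Q) {z : ℂ}
    (hz : ‖z‖ ≠ ρ) : z ∉ Set.range a := by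
  rintro ⟨k, rfl⟩
  exact hz (h.norm_a k)

/-- The principal parts are integrated by residues, at t = z and at the poles; only the integral
with the regular part `Q` is left. -/
theorem mul_eq (h : PoleRepresentation P D De g τ ρ ρ' a μ c Q) (n : ℕ) {z : ℂ} (hz : ‖z‖ < 1)
    (hza : z ∉ Set.range a) :
    D z * P n z = z ^ n * g n z *
      (∑ k, ∑ j ∈ Finset.range (μ + 1), c k j / (z - a k) ^ (j + 1)) +
      residuePart g a μ c n z + cInt 1 (fun t => t ^ n * g n t * Q t / (t - z)) := by
  have hta : ∀ k (t : ℂ), ‖t‖ = 1 → t - a k ≠ 0 := fun k t ht =>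
    sub_ne_zero_of_norm_lt (by rw [ht, h.norm_a]; exact h.lt_one)
  have htz : ∀ t : ℂ, ‖t‖ = 1 → t - z ≠ 0 := fun t ht => sub_ne_zero_of_norm_lt (ht ▸ hz)
  have hci : ∀ k j, CircleIntegrable
      (fun t => c k j * (t ^ n * g n t / (t - a k) ^ (j + 1) / (t - z))) 0 1 := fun k j =>
    circleIntegrable_of_analyticAt zero_le_one fun t ht => analyticAt_const.mul
      (analyticAt_div_sub ((h.analyticAt_pow_mul n ht.le).div ((analyticAt_id.sub
        analyticAt_const).pow _) (pow_ne_zero _ (hta k t ht))) (htz t ht))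
  have hQi : CircleIntegrable (fun t => t ^ n * g n t * Q t / (t - z)) 0 1 :=
    circleIntegrable_of_analyticAt zero_le_one fun t ht => analyticAt_div_sub
      ((h.analyticAt_pow_mul n ht.le).mul (h.analyticAt_Q t (by
        rw [ht]; exact h.lt.trans h.lt_one))) (htz t ht)
  rw [h.rep n z hz, cInt_congr zero_le_one (g := fun t => (∑ k, ∑ j ∈ Finset.range (μ + 1),
    c k j * (t ^ n * g n t / (t - a k) ^ (j + 1) / (t - z))) +
    t ^ n * g n t * Q t / (t - z)), cInt_add, cInt_sum]
  · congr 1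
    rw [residuePart, Finset.mul_sum, ← sub_eq_add_neg, ← Finset.sum_sub_distrib]
    refine Finset.sum_congr rfl fun k _ => ?_
    rw [cInt_sum _ fun j _ => hci k j, Finset.mul_sum, ← Finset.sum_sub_distrib]
    refine Finset.sum_congr rfl fun j _ => ?_
    rw [cInt_const_mul, cInt_div_pow_div_sub (fun t ht => h.analyticAt_pow_mul n ht)
      (by rw [h.norm_a]; exact h.lt_one) hz (fun h => hza ⟨k, h.symm⟩)]
    ring
  · exact fun k _ => CircleIntegrable.fun_sum _ fun j _ => hci k j
  · exact CircleIntegrable.fun_sum _ fun k _ => CircleIntegrable.fun_sum _ fun j _ => hci k j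
  · exact hQi
  · intro t ht
    rw [h.De_eq t (by rw [ht]; exact h.lt.trans h.lt_one) (h.notMem_range_of_norm_ne
      (by rw [ht]; exact h.lt_one.ne')), mul_add, add_div, Finset.mul_sum, Finset.sum_div]
    congr 1
    refine Finset.sum_congr rfl fun k _ => ?_
    rw [Finset.mul_sum, Finset.sum_div]
    refine Finset.sum_congr rfl fun j _ => ?_
    ring

theorem exists_norm_Q_le_of_lt (h : PoleRepresentation P D De g τ ρ ρ' a μ c Q) {s r : ℝ}
    (hs : ρ' < s) : ∃ B, ∀ z, s ≤ ‖z‖ → ‖z‖ ≤ r → ‖Q z‖ ≤ B := by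
  obtain ⟨B, hB⟩ := ((isCompact_closedBall (0 : ℂ) r).diff
    (Metric.isOpen_ball (x := (0 : ℂ)) (ε := s))).exists_bound_of_continuousOn (f := Q)
    fun t ht => by
      have : s ≤ ‖t‖ := by simpa using ht.2
      exact (h.analyticAt_Q t (hs.trans_le this)).continuousAt.continuousWithinAt
  exact ⟨B, fun z h1 h2 => hB z ⟨by simpa using h2, by simpa using h1⟩⟩

theorem norm_principalParts_le {z : ℂ} {d : ℝ} (hd0 : 0 < d) (hd1 : d ≤ 1)
    (hd : ∀ k, d ≤ ‖z - a k‖) :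
    ‖∑ k, ∑ j ∈ Finset.range (μ + 1), c k j / (z - a k) ^ (j + 1)‖ ≤
      (∑ k, ∑ j ∈ Finset.range (μ + 1), ‖c k j‖) / d ^ (μ + 1) := by
  rw [Finset.sum_div]
  refine norm_sum_le_of_le _ fun k _ => ?_
  rw [Finset.sum_div]
  refine norm_sum_le_of_le _ fun j hj => ?_
  rw [norm_div, norm_pow]
  have h1 : d ^ (μ + 1) ≤ ‖z - a k‖ ^ (j + 1) :=
    (pow_le_pow_of_le_one hd0.le hd1 (by have := Finset.mem_range.1 hj; omega)).trans
      (pow_le_pow_left₀ hd0.le (hd k) _)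
  gcongr

theorem le_norm_sub_a (h : PoleRepresentation P D De g τ ρ ρ' a μ c Q) {z : ℂ} (k : Fin u) :
    ρ - ‖z‖ ≤ ‖z - a k‖ := by
  rw [← h.norm_a k, norm_sub_rev]
  exact norm_sub_norm_le _ _

/-- Near |z| = σ the bound passes from `De` to `Q`, since the poles stay at positive distance; the
remaining annulus is compact. This is the only use of the boundedness hypothesis when σ = ρ'. -/
theorem exists_norm_Q_le (h : PoleRepresentation P D De g τ ρ ρ' a μ c Q) {σ s M r : ℝ}
    (hσ : ρ' ≤ σ) (hσρ : σ < ρ) (hs : σ < s)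
    (hM : ∀ z : ℂ, σ < ‖z‖ → ‖z‖ < s → ‖De z‖ ≤ M) :
    ∃ B, 0 ≤ B ∧ ∀ z, σ < ‖z‖ → ‖z‖ ≤ r → ‖Q z‖ ≤ B := by
  obtain ⟨s', h1, h2⟩ := exists_between (lt_min hs hσρ)
  have hs's : s' < s := h2.trans_le (min_le_left _ _)
  have hs'ρ : s' < ρ := h2.trans_le (min_le_right _ _)
  obtain ⟨B, hB⟩ := h.exists_norm_Q_le_of_lt (s := s') (r := r) (hσ.trans_lt h1)
  have hd0 : 0 < ρ - s' := by linarith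
  set B' := M + (∑ k, ∑ j ∈ Finset.range (μ + 1), ‖c k j‖) / (ρ - s') ^ (μ + 1)
  refine ⟨max 0 (max B B'), le_max_left _ _, fun z hz1 hz2 => ?_⟩
  rcases le_or_gt s' ‖z‖ with hz | hz
  · exact (hB z hz hz2).trans ((le_max_left _ _).trans (le_max_right _ _))
  · refine le_trans ?_ ((le_max_right B B').trans (le_max_right _ _))
    have h3 := h.De_eq z (hσ.trans_lt hz1) (h.notMem_range_of_norm_ne (by linarith))
    have h4 : Q z = De z - ∑ k, ∑ j ∈ Finset.range (μ + 1), c k j / (z - a k) ^ (j + 1) := by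
      rw [h3]; ring
    rw [h4]
    refine (norm_sub_le _ _).trans (add_le_add (hM z hz1 (hz.trans hs's)) ?_)
    have := h.pos
    have := h.lt_one
    have := h.nonneg'
    exact norm_principalParts_le hd0 (by linarith) fun k => by
      have := h.le_norm_sub_a (z := z) k
      linarith

/-- `Q` is regular on |t| = ρ, so for such z the circle can shrink to radius q < ρ. -/
theorem exists_norm_cInt_Q_le (h : PoleRepresentation P D De g τ ρ ρ' a μ c Q) {κ q : ℝ}
    (hκ : ρ' < q) (hκq : κ < q) (hq : q < ρ) : ∃ B, 0 ≤ B ∧ ∀ n z, ‖z‖ ≤ κ →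
      ‖cInt 1 (fun t => t ^ n * g n t * Q t / (t - z))‖ ≤ B * q ^ n := by
  obtain ⟨B, hB⟩ := h.exists_norm_Q_le_of_lt (s := q) (r := q) hκ
  obtain ⟨M, hM0, hM⟩ := h.exists_norm_g_le
  have hq0 : 0 < q := h.nonneg'.trans_lt hκ
  have hq1 : q < 1 := hq.trans h.lt_one
  have hB0 : 0 ≤ B := (norm_nonneg _).trans
    (hB (q : ℂ) (by simp [abs_of_pos hq0]) (by simp [abs_of_pos hq0]))
  have hd : 0 < q - κ := by linarith
  refine ⟨q * (M * B / (q - κ)), by positivity, fun n z hz => ?_⟩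
  rw [cInt_deform (f := fun t => t ^ n * g n t * Q t / (t - z)) hq0 hq1.le fun t h1 h2 =>
    analyticAt_div_sub ((h.analyticAt_pow_mul n h2).mul (h.analyticAt_Q t (hκ.trans_le h1)))
      (sub_ne_zero_of_norm_lt (by linarith)), mul_assoc]
  refine norm_cInt_le hq0.le fun t ht => ?_
  have h1 : q - κ ≤ ‖t - z‖ := by
    have := norm_sub_norm_le t z
    linarith
  rw [norm_div, norm_mul, norm_mul, norm_pow, ht]
  have h2 := hM n t (by linarith)
  have h3 := hB t ht.ge ht.le
  calc _ ≤ q ^ n * M * B / (q - κ) := by gcongr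
    _ = _ := by ring

theorem exists_norm_cInt_Q_sub_le (h : PoleRepresentation P D De g τ ρ ρ' a μ c Q) {σ B r : ℝ}
    (hσ : ρ' ≤ σ) (hσρ : σ < ρ) (hB0 : 0 ≤ B) (hr : r < 1)
    (hB : ∀ z, σ < ‖z‖ → ‖z‖ ≤ r → ‖Q z‖ ≤ B) : ∃ q C, 0 < q ∧ q < ρ ∧ 0 ≤ C ∧
      ∀ n z, σ < ‖z‖ → ‖z‖ ≤ r →
      ‖cInt 1 (fun t => t ^ n * g n t * Q t / (t - z)) - z ^ n * g n z * Q z‖ ≤ C * q ^ n := by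
  -- Radii σ < q₁ < q₂ < q < ρ. For |z| ≤ q₂ both terms are O(q^n) separately; for |z| > q₂ Cauchy's
  -- formula in an annulus turns the difference into an integral over |t| = q₁, which stays away
  -- from z.
  obtain ⟨q₂, h2, hq2⟩ := exists_between hσρ
  obtain ⟨q₁, h1, h12⟩ := exists_between h2
  obtain ⟨q, h2q, hq⟩ := exists_between hq2
  have hq10 : 0 < q₁ := (h.nonneg'.trans hσ).trans_lt h1
  have hq0 : 0 < q := by linarith
  have hρ1 := h.lt_one
  obtain ⟨M, hM0, hM⟩ := h.exists_norm_g_le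
  obtain ⟨B₁, hB₁0, hB₁⟩ := h.exists_norm_cInt_Q_le (κ := q₂) (q := q) (by linarith) h2q hq
  obtain ⟨B₂, hB₂⟩ := h.exists_norm_Q_le_of_lt (s := q₁) (r := q₁) (by linarith)
  have hB₂0 : 0 ≤ B₂ := (norm_nonneg _).trans
    (hB₂ (q₁ : ℂ) (by simp [abs_of_pos hq10]) (by simp [abs_of_pos hq10]))
  have hd : 0 < q₂ - q₁ := by linarith
  refine ⟨q, max (B₁ + M * B) (q₁ * (M * B₂ / (q₂ - q₁))), hq0, hq,
    le_trans (by positivity) (le_max_left _ _), fun n z hz1 hz2 => ?_⟩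
  have han : ∀ t : ℂ, σ < ‖t‖ → ‖t‖ ≤ 1 → AnalyticAt ℂ (fun t => t ^ n * g n t * Q t) t :=
    fun t ht1 ht2 => (h.analyticAt_pow_mul n ht2).mul (h.analyticAt_Q t (by linarith))
  rcases le_or_gt ‖z‖ q₂ with hz | hz
  · refine le_trans ?_ (mul_le_mul_of_nonneg_right (le_max_left _ _) (by positivity))
    rw [add_mul]
    refine (norm_sub_le _ _).trans (add_le_add (hB₁ n z hz) ?_)
    rw [norm_mul, norm_mul, norm_pow]
    have h3 := hM n z (by linarith)
    have h4 := hB z hz1 hz2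
    have h5 : ‖z‖ ^ n ≤ q ^ n := pow_le_pow_left₀ (norm_nonneg _) (by linarith) n
    calc _ ≤ q ^ n * M * B := by gcongr
      _ = _ := by ring
  · refine le_trans ?_ (mul_le_mul_of_nonneg_right (le_max_right _ _) (by positivity))
    have key := cInt_annulus hq10 (f := fun t => t ^ n * g n t * Q t) (R := 1) (z := z)
      (fun t ht1 ht2 => han t (by linarith) ht2) (by linarith) (by linarith)
    have e : cInt 1 (fun t => t ^ n * g n t * Q t / (t - z)) - z ^ n * g n z * Q z =
        cInt q₁ (fun t => t ^ n * g n t * Q t / (t - z)) := by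
      rw [key]; ring
    rw [e, mul_assoc]
    refine norm_cInt_le hq10.le fun t ht => ?_
    have h1 : q₂ - q₁ ≤ ‖t - z‖ := by
      have := norm_sub_norm_le z t
      rw [norm_sub_rev] at this
      linarith
    rw [norm_div, norm_mul, norm_mul, norm_pow, ht]
    have h2 := hM n t (by linarith)
    have h3 := hB₂ t ht.ge ht.le
    have h4 : q₁ ^ n ≤ q ^ n := pow_le_pow_left₀ hq10.le (by linarith) n
    calc _ ≤ q ^ n * M * B₂ / (q₂ - q₁) := by gcongr
      _ = _ := by ring

/-- Strictly inside |z| = ρ the z^n term is also exponentially smaller than ρ^n, so only the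
residues at the poles remain. -/
theorem exists_norm_mul_sub_residuePart_le (h : PoleRepresentation P D De g τ ρ ρ' a μ c Q)
    {κ : ℝ} (hκ : κ < ρ) : ∃ q C, 0 < q ∧ q < ρ ∧ 0 ≤ C ∧
      ∀ n z, ‖z‖ ≤ κ → ‖D z * P n z - residuePart g a μ c n z‖ ≤ C * q ^ n := by
  obtain ⟨q, h1, hq⟩ := exists_between (max_lt h.lt hκ)
  have hρ1 := h.lt_one
  have hq' : ρ' < q := (le_max_left _ _).trans_lt h1
  have hκq : κ < q := (le_max_right _ _).trans_lt h1
  have hq0 : 0 < q := h.nonneg'.trans_lt hq'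
  obtain ⟨M, hM0, hM⟩ := h.exists_norm_g_le
  obtain ⟨B, hB0, hB⟩ := h.exists_norm_cInt_Q_le hq' hκq hq
  have hd0 : 0 < ρ - q := by linarith
  refine ⟨q, M * ((∑ k, ∑ j ∈ Finset.range (μ + 1), ‖c k j‖) / (ρ - q) ^ (μ + 1)) + B, hq0, hq,
    by positivity, fun n z hz => ?_⟩
  rw [h.mul_eq n (by linarith) (h.notMem_range_of_norm_ne (by linarith)), add_right_comm,
    add_sub_cancel_right, add_mul]
  refine (norm_add_le _ _).trans (add_le_add ?_ (hB n z hz))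
  have h2 := norm_principalParts_le (c := c) (a := a) (z := z) (μ := μ) hd0 (by linarith)
    fun k => by
      have := h.le_norm_sub_a (z := z) k
      linarith
  have h3 := hM n z (by linarith)
  have h5 : ‖z‖ ^ n ≤ q ^ n := pow_le_pow_left₀ (norm_nonneg _) (by linarith) n
  rw [norm_mul, norm_mul, norm_pow]
  calc _ ≤ q ^ n * M * ((∑ k, ∑ j ∈ Finset.range (μ + 1), ‖c k j‖) / (ρ - q) ^ (μ + 1)) := by
        gcongr
    _ = _ := by ring

end PoleRepresentation

/-! ### Error estimates for the leading term -/

theorem exists_nat_mul_pow_le {q : ℝ} (h0 : 0 ≤ q) (h1 : q < 1) :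
    ∃ B, 0 ≤ B ∧ ∀ n : ℕ, (n : ℝ) * q ^ n ≤ B := by
  obtain ⟨B, hB⟩ := (tendsto_self_mul_const_pow_of_lt_one h0 h1).bddAbove_range
  exact ⟨B, le_trans (by simp) (hB ⟨0, rfl⟩), fun n => hB ⟨n, rfl⟩⟩

theorem norm_sum_div_pow_le {a z : ℂ} {d X : ℝ} (hd0 : 0 < d) (hd1 : d ≤ 1) (hd : d ≤ ‖z - a‖)
    (s : ℕ) (T : ℕ → ℂ) (e : ℕ → ℕ) {m : ℕ} (hX : 0 ≤ X)
    (hT : ∀ i < s, ‖T i‖ ≤ X) (he : ∀ i < s, e i ≤ m) :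
    ‖∑ i ∈ Finset.range s, T i / (z - a) ^ e i‖ ≤ s * (X / d ^ m) := by
  refine (norm_sum_le_of_le (f := fun i => T i / (z - a) ^ e i) _
    (n := fun _ => X / d ^ m) fun i hi => ?_).trans_eq (by simp)
  have hi := Finset.mem_range.1 hi
  have h1 : d ^ m ≤ ‖z - a‖ ^ e i :=
    (pow_le_pow_of_le_one hd0.le hd1 (he i hi)).trans (pow_le_pow_left₀ hd0.le hd _)
  have := hT i hi
  rw [norm_div, norm_pow]
  gcongr

namespace PoleRepresentation

variable {P : ℕ → ℂ → ℂ} {D De : ℂ → ℂ} {g : ℕ → ℂ → ℂ} {τ : ℂ} {ρ ρ' : ℝ} {u : ℕ}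
  {a : Fin u → ℂ} {μ : ℕ} {c : Fin u → ℕ → ℂ} {Q : ℂ → ℂ}

/-- At simple poles the residues involve no derivatives, so the only error is that of replacing g n
by D/τ. -/
theorem residuePart_sub_leadingPart_zero (h : PoleRepresentation P D De g τ ρ ρ' a 0 c Q)
    (n : ℕ) (z : ℂ) : residuePart g a 0 c n z - leadingPart D τ a 0 c n z =
      ∑ k, c k 0 * (a k ^ n * (g n (a k) - D (a k) / τ)) / (a k - z) := by
  rw [residuePart, leadingPart, ← Finset.sum_neg_distrib, ← Finset.sum_sub_distrib]
  refine Finset.sum_congr rfl fun k _ => ?_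
  have h1 := cInt_cauchy (f := fun t => t ^ n * g n t) (R := 1) (z := a k)
    (fun t ht => h.analyticAt_pow_mul n ht) (by rw [h.norm_a]; exact h.lt_one)
  simp only [zero_add, Finset.range_one, Finset.sum_singleton, pow_one, Nat.sub_zero, h1,
    Nat.choose_zero_right, Nat.cast_one, one_mul]
  rw [← neg_sub (a k) z, div_neg]
  ring

theorem exists_norm_coeff_le (h : PoleRepresentation P D De g τ ρ ρ' a μ c Q) (ν : ℕ) :
    ∃ K, 0 ≤ K ∧ ∀ i ≤ ν, ∀ k n, 1 ≤ n →
      ‖cInt 1 (fun t => t ^ n * g n t / (t - a k) ^ (i + 1))‖ ≤ K * n ^ ν * ρ ^ n := by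
  obtain ⟨M, hM0, hM⟩ := h.exists_norm_g_le
  choose K hK0 hK using exists_norm_cInt_pow_mul_le h.pos h.lt_one
  refine ⟨(∑ i ∈ Finset.range (ν + 1), K i) * M,
    mul_nonneg (Finset.sum_nonneg fun i _ => hK0 i) hM0, fun i hi k n hn => ?_⟩
  refine (hK i (a k) (g n) M n (h.norm_a k) (h.analyticAt_g n) (hM n) hn).trans ?_
  have h1 : K i ≤ ∑ i ∈ Finset.range (ν + 1), K i :=
    Finset.single_le_sum (fun i _ => hK0 i) (Finset.mem_range.2 (by omega))
  have h2 : (n : ℝ) ^ i ≤ n ^ ν := pow_le_pow_right₀ (by exact_mod_cast hn) hi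
  have := h.pos
  have hS : 0 ≤ ∑ i ∈ Finset.range (ν + 1), K i := Finset.sum_nonneg fun i _ => hK0 i
  gcongr

theorem exists_norm_coeff_sub_le (h : PoleRepresentation P D De g τ ρ ρ' a μ c Q) (ν : ℕ) :
    ∃ K, 0 ≤ K ∧ ∀ k n, 1 ≤ n →
      ‖cInt 1 (fun t => t ^ n * g n t / (t - a k) ^ (ν + 1 + 1)) -
        n.choose (ν + 1) * a k ^ (n - (ν + 1)) * (D (a k) / τ)‖ ≤ K * n ^ ν * ρ ^ n := by
  have hρ0 := h.pos
  obtain ⟨M, hM0, hM⟩ := h.exists_norm_g_le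
  obtain ⟨K, hK0, hK⟩ := exists_norm_cInt_pow_mul_sub_le h.pos h.lt_one ν
  obtain ⟨q, hq, hq1⟩ := exists_between h.lt_one
  obtain ⟨M', hM'0, hM'⟩ := h.g_close q hq
  -- Replacing g n (a k) by D (a k)/τ costs q^n, which absorbs the surplus factor n coming from the
  -- binomial.
  obtain ⟨B, hB0, hB⟩ := exists_nat_mul_pow_le (h.pos.trans hq).le hq1
  refine ⟨K * M + (ρ ^ (ν + 1))⁻¹ * M' * B, by positivity, fun k n hn => ?_⟩
  have hak : ‖a k‖ ≤ 1 := by rw [h.norm_a]; exact h.lt_one.le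
  have e1 := hK (a k) (g n) M n (h.norm_a k) (h.analyticAt_g n) (hM n) hn
  have e2 : ‖(n.choose (ν + 1) : ℂ) * a k ^ (n - (ν + 1)) * (g n (a k) - D (a k) / τ)‖ ≤
      (ρ ^ (ν + 1))⁻¹ * M' * B * n ^ ν * ρ ^ n := by
    rcases Nat.lt_or_ge n (ν + 1) with h1 | h1
    · simp only [Nat.choose_eq_zero_of_lt h1, Nat.cast_zero, zero_mul, norm_zero]
      positivity
    · have h3 : ρ ^ n = ρ ^ (ν + 1) * ρ ^ (n - (ν + 1)) := by rw [← pow_add]; congr 1; omega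
      have h4 : ((n.choose (ν + 1) : ℕ) : ℝ) ≤ (n : ℝ) ^ (ν + 1) := by
        exact_mod_cast Nat.choose_le_pow n (ν + 1)
      rw [norm_mul, norm_mul, norm_pow, h.norm_a, Complex.norm_natCast, h3]
      have h5 := hM' n (a k) hak
      calc _ ≤ (n : ℝ) ^ (ν + 1) * ρ ^ (n - (ν + 1)) * (M' * q ^ n) := by gcongr
        _ = M' * ((n : ℝ) * q ^ n) * n ^ ν * ρ ^ (n - (ν + 1)) := by ring
        _ ≤ M' * B * n ^ ν * ρ ^ (n - (ν + 1)) := by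
          have := hB n
          gcongr
        _ = _ := by field_simp
  calc _ = ‖(cInt 1 (fun t => t ^ n * g n t / (t - a k) ^ (ν + 1 + 1)) -
        n.choose (ν + 1) * a k ^ (n - (ν + 1)) * g n (a k)) +
        (n.choose (ν + 1) : ℂ) * a k ^ (n - (ν + 1)) * (g n (a k) - D (a k) / τ)‖ := by
        congr 1; ring
    _ ≤ _ := (norm_add_le _ _).trans ((add_le_add e1 e2).trans_eq (by ring))

/-- Only the coefficient with i = j = ν + 1 reaches the order n^(ν+1) ρ^n, and its limit form is the
leading part. The dependence on the distance d is explicit because it becomes ε^(-m) in the theorem.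
-/
theorem exists_norm_residuePart_sub_leadingPart_le {ν : ℕ}
    (h : PoleRepresentation P D De g τ ρ ρ' a (ν + 1) c Q) :
    ∃ C, 0 ≤ C ∧ ∀ n, 1 ≤ n → ∀ (z : ℂ) (d : ℝ), 0 < d → d ≤ 1 → (∀ k, d ≤ ‖z - a k‖) →
      ‖residuePart g a (ν + 1) c n z - leadingPart D τ a (ν + 1) c n z‖ ≤
        C / d ^ (ν + 2) * n ^ ν * ρ ^ n := by
  have hρ0 := h.pos
  obtain ⟨K, hK0, hK⟩ := h.exists_norm_coeff_le ν
  obtain ⟨K', hK'0, hK'⟩ := h.exists_norm_coeff_sub_le ν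
  refine ⟨∑ k, ((∑ j ∈ Finset.range (ν + 1), ‖c k j‖ * ((j + 1 : ℕ) * K)) +
    ‖c k (ν + 1)‖ * ((ν + 1 : ℕ) * K) + ‖c k (ν + 1)‖ * K'), by positivity,
    fun n hn z d hd0 hd1 hd => ?_⟩
  rw [residuePart, leadingPart, ← Finset.sum_neg_distrib, ← Finset.sum_sub_distrib,
    Finset.sum_div, Finset.sum_mul, Finset.sum_mul]
  refine norm_sum_le_of_le _ fun k _ => ?_
  set T : ℕ → ℂ := fun i => cInt 1 (fun t => t ^ n * g n t / (t - a k) ^ (i + 1)) with hT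
  have hzd := hd k
  have hza : z - a k ≠ 0 := norm_pos_iff.1 (hd0.trans_le hzd)
  have hsum : ∀ j s, s ≤ ν + 1 → j ≤ ν + 1 →
      ‖∑ i ∈ Finset.range s, T i / (z - a k) ^ (j + 1 - i)‖ ≤
        s * (K * n ^ ν * ρ ^ n / d ^ (ν + 2)) := fun j s hs hj =>
    norm_sum_div_pow_le hd0 hd1 hzd s T _ (by positivity)
      (fun i hi => hK i (by omega) k n hn) (fun i _ => by omega)
  have e : -(∑ j ∈ Finset.range (ν + 1 + 1), c k j * ∑ i ∈ Finset.range (j + 1),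
      T i / (z - a k) ^ (j + 1 - i)) - n.choose (ν + 1) * a k ^ (n - (ν + 1)) *
        (D (a k) / τ * c k (ν + 1) / (a k - z)) =
      -((∑ j ∈ Finset.range (ν + 1), c k j * ∑ i ∈ Finset.range (j + 1),
        T i / (z - a k) ^ (j + 1 - i)) +
      c k (ν + 1) * (∑ i ∈ Finset.range (ν + 1), T i / (z - a k) ^ (ν + 1 + 1 - i)) +
      c k (ν + 1) * ((T (ν + 1) - n.choose (ν + 1) * a k ^ (n - (ν + 1)) * (D (a k) / τ)) /
        (z - a k))) := by
    rw [Finset.sum_range_succ _ (ν + 1),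
      Finset.sum_range_succ (fun i => T i / (z - a k) ^ (ν + 1 + 1 - i)) (ν + 1),
      show ν + 1 + 1 - (ν + 1) = 1 by omega, pow_one, ← neg_sub z (a k), div_neg]
    ring
  rw [e, norm_neg]
  have e3 : ‖(T (ν + 1) - n.choose (ν + 1) * a k ^ (n - (ν + 1)) * (D (a k) / τ)) /
      (z - a k)‖ ≤ K' * n ^ ν * ρ ^ n / d ^ (ν + 2) := by
    rw [norm_div]
    have h1 := hK' k n hn
    have h2 : d ^ (ν + 2) ≤ ‖z - a k‖ :=
      ((pow_le_pow_of_le_one hd0.le hd1 (by omega : 1 ≤ ν + 2)).trans_eq (pow_one d)).trans hzd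
    gcongr
  have e1 : ‖∑ j ∈ Finset.range (ν + 1), c k j * ∑ i ∈ Finset.range (j + 1),
      T i / (z - a k) ^ (j + 1 - i)‖ ≤ ∑ j ∈ Finset.range (ν + 1),
        ‖c k j‖ * ((j + 1 : ℕ) * (K * n ^ ν * ρ ^ n / d ^ (ν + 2))) := by
    refine norm_sum_le_of_le _ fun j hj => ?_
    have hj := Finset.mem_range.1 hj
    rw [norm_mul]
    have := hsum j (j + 1) (by omega) (by omega)
    gcongr
  refine (norm_add₃_le.trans (add_le_add (add_le_add e1 (?_ : _ ≤ ‖c k (ν + 1)‖ *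
    ((ν + 1 : ℕ) * (K * n ^ ν * ρ ^ n / d ^ (ν + 2))))) (?_ : _ ≤ ‖c k (ν + 1)‖ *
    (K' * n ^ ν * ρ ^ n / d ^ (ν + 2))))).trans_eq ?_
  · rw [norm_mul]
    have := hsum (ν + 1) (ν + 1) le_rfl le_rfl
    gcongr
  · rw [norm_mul]
    gcongr
  · rw [add_div, add_div, add_mul, add_mul, add_mul, add_mul, Finset.sum_div, Finset.sum_mul,
      Finset.sum_mul]
    congr 1
    · congr 1
      · exact Finset.sum_congr rfl fun j _ => by ring
      · ring
    · ring

/-- The remainder in the asymptotic expansion of `P n`. -/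
theorem mul_remainder_eq (h : PoleRepresentation P D De g τ ρ ρ' a μ c Q) (n : ℕ) {z : ℂ}
    (hz' : ρ' < ‖z‖) (hz : ‖z‖ < 1) (hza : z ∉ Set.range a) :
    D z * (P n z - De z / τ * z ^ n - (D z)⁻¹ * leadingPart D τ a μ c n z) =
      z ^ n * De z * (g n z - D z / τ) +
      (residuePart g a μ c n z - leadingPart D τ a μ c n z) +
      (cInt 1 (fun t => t ^ n * g n t * Q t / (t - z)) - z ^ n * g n z * Q z) := by
  have h1 := h.mul_eq n hz hza
  have h2 := h.De_eq z hz' hza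
  have h3 := h.D_ne z hz.le
  set PP := ∑ k, ∑ j ∈ Finset.range (μ + 1), c k j / (z - a k) ^ (j + 1)
  have h4 : D z * (P n z - De z / τ * z ^ n - (D z)⁻¹ * leadingPart D τ a μ c n z) =
      D z * P n z - D z * (De z / τ * z ^ n) - leadingPart D τ a μ c n z := by
    field_simp
  rw [h4, h1, h2]
  ring

/-- With E(t) = t^n (g n t - D t/τ), the poles of `De` E and the residue errors combine into divided
differences of E. These are bounded by the maximum of E on |t| ≤ r, however close z is to a pole. -/
theorem exists_norm_remainder_le_of_simple (h : PoleRepresentation P D De g τ ρ ρ' a 0 c Q)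
    {σ B r : ℝ} (hσ : ρ' ≤ σ) (hσρ : σ < ρ) (hB0 : 0 ≤ B) (hρr : ρ < r) (hr : r < 1)
    (hB : ∀ z, σ < ‖z‖ → ‖z‖ ≤ r → ‖Q z‖ ≤ B) :
    ∃ C δ, 0 ≤ C ∧ 0 < δ ∧ δ < 1 ∧ ∀ n z, σ < ‖z‖ → ‖z‖ ≤ r → z ∉ Set.range a →
      ‖P n z - De z / τ * z ^ n - (D z)⁻¹ * leadingPart D τ a 0 c n z‖ ≤ C * (ρ ^ n * δ ^ n) := by
  have hρ0 := h.pos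
  have hr0 : 0 < r := hρ0.trans hρr
  -- Since r < 1, q > ρ can be chosen with r q < ρ; then r^n q^n is exponentially smaller than ρ^n
  -- even though |z| may exceed ρ.
  obtain ⟨q, hq1, hq2⟩ := exists_between (show ρ < ρ / r by rw [lt_div_iff₀ hr0]; nlinarith)
  rw [lt_div_iff₀ hr0] at hq2
  obtain ⟨M, hM0, hM⟩ := h.g_close q hq1
  obtain ⟨p, C, hp0, hpρ, hC0, hC⟩ := h.exists_norm_cInt_Q_sub_le hσ hσρ hB0 hr hB
  obtain ⟨B', hB'0, hB'⟩ := h.exists_norm_inv_D_le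
  have hq0 : 0 < q := hρ0.trans hq1
  set s := max (r * q) p with hs
  have hs0 : 0 < s := hp0.trans_le (le_max_right _ _)
  have hsρ : s < ρ := max_lt (by linarith) hpρ
  have hrρ : 0 < r - ρ := by linarith
  refine ⟨B' * ((M * B + ∑ k, ‖c k 0‖ * (2 * M / (r - ρ))) + C), s / ρ, by positivity,
    by positivity, (div_lt_one hρ0).2 hsρ, fun n z hz1 hz2 hza => ?_⟩
  have hz : ‖z‖ < 1 := hz2.trans_lt hr
  have e0 : ρ ^ n * (s / ρ) ^ n = s ^ n := by
    rw [← mul_pow]; congr 1; field_simp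
  have e := h.mul_remainder_eq n (hσ.trans_lt hz1) hz hza
  set H := P n z - De z / τ * z ^ n - (D z)⁻¹ * leadingPart D τ a 0 c n z
  have hH : H = (D z)⁻¹ * (D z * H) := by
    have := h.D_ne z hz.le
    field_simp
  set E : ℂ → ℂ := fun t => t ^ n * (g n t - D t / τ) with hE
  have hEan : ∀ t, ‖t‖ ≤ r → AnalyticAt ℂ E t := fun t ht => (analyticAt_id.pow n).mul
    ((h.analyticAt_g n t (by linarith)).sub ((h.analyticAt_D t (by linarith)).div_const))
  have hEb : ∀ t, ‖t‖ ≤ r → ‖E t‖ ≤ M * s ^ n := by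
    intro t ht
    rw [hE]
    simp only
    rw [norm_mul, norm_pow]
    have h1 := hM n t (by linarith)
    calc _ ≤ r ^ n * (M * q ^ n) := by gcongr
      _ = M * (r * q) ^ n := by rw [mul_pow]; ring
      _ ≤ _ := by gcongr; exact le_max_left _ _
  have e1 : z ^ n * De z * (g n z - D z / τ) +
      (residuePart g a 0 c n z - leadingPart D τ a 0 c n z) =
      E z * Q z + ∑ k, c k 0 * dslope E (a k) z := by
    rw [h.residuePart_sub_leadingPart_zero, h.De_eq z (hσ.trans_lt hz1) hza]
    have : z ^ n * (∑ k, ∑ j ∈ Finset.range (0 + 1), c k j / (z - a k) ^ (j + 1) + Q z) *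
        (g n z - D z / τ) = E z * Q z + ∑ k, c k 0 * (E z / (z - a k)) := by
      rw [hE]
      simp only [zero_add, Finset.range_one, Finset.sum_singleton, pow_one]
      rw [mul_add, add_mul, add_comm, Finset.mul_sum, Finset.sum_mul]
      congr 1
      · ring
      · exact Finset.sum_congr rfl fun k _ => by ring
    rw [this, add_assoc, ← Finset.sum_add_distrib]
    congr 1
    refine Finset.sum_congr rfl fun k _ => ?_
    have hk : z ≠ a k := fun h => hza ⟨k, h.symm⟩
    rw [dslope_of_ne _ hk, slope_def_field, ← neg_sub z (a k), div_neg]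
    ring
  have e2 : ‖E z * Q z + ∑ k, c k 0 * dslope E (a k) z‖ ≤
      (M * B + ∑ k, ‖c k 0‖ * (2 * M / (r - ρ))) * s ^ n := by
    rw [add_mul, Finset.sum_mul]
    refine (norm_add_le _ _).trans (add_le_add ?_ (norm_sum_le_of_le _ fun k _ => ?_))
    · rw [norm_mul]
      have h1 := hEb z hz2
      have h2 := hB z hz1 hz2
      calc _ ≤ M * s ^ n * B := by gcongr
        _ = _ := by ring
    · rw [norm_mul]
      have h1 := norm_dslope_le hEan hEb (a := a k) (by rw [h.norm_a]; exact hρr) hz2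
      rw [h.norm_a] at h1
      calc _ ≤ ‖c k 0‖ * (2 * (M * s ^ n) / (r - ρ)) := by gcongr
        _ = _ := by ring
  have e3 : C * p ^ n ≤ C * s ^ n := by
    gcongr
    exact le_max_right _ _
  rw [e0]
  calc ‖H‖ = ‖(D z)⁻¹‖ * ‖D z * H‖ := by rw [← norm_mul, ← hH]
    _ ≤ B' * ((M * B + ∑ k, ‖c k 0‖ * (2 * M / (r - ρ)) + C) * s ^ n) := by
      refine mul_le_mul (hB' z hz.le) ?_ (norm_nonneg _) hB'0
      rw [e, e1, add_mul]
      exact (norm_add_le _ _).trans (add_le_add e2 ((hC n z hz1 hz2).trans e3))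
    _ = _ := by ring

/-- `De` costs at most a multiple of d^(-m), and its error term carries (q r)^n with q r < ρ. The
residue error of order n^(m-2) ρ^n therefore governs, with m = ν + 2. -/
theorem exists_norm_remainder_le {ν : ℕ}
    (h : PoleRepresentation P D De g τ ρ ρ' a (ν + 1) c Q)
    {σ B r : ℝ} (hσ : ρ' ≤ σ) (hσρ : σ < ρ) (hB0 : 0 ≤ B) (hρr : ρ < r) (hr : r < 1)
    (hB : ∀ z, σ < ‖z‖ → ‖z‖ ≤ r → ‖Q z‖ ≤ B) :
    ∃ C, 0 ≤ C ∧ ∀ n, 1 ≤ n → ∀ (z : ℂ) (d : ℝ), σ < ‖z‖ → ‖z‖ ≤ r → 0 < d → d ≤ 1 →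
      (∀ k, d ≤ ‖z - a k‖) →
      ‖P n z - De z / τ * z ^ n - (D z)⁻¹ * leadingPart D τ a (ν + 1) c n z‖ ≤
        C / d ^ (ν + 2) * n ^ ν * ρ ^ n := by
  have hρ0 := h.pos
  have hr0 : 0 < r := hρ0.trans hρr
  obtain ⟨q, hq1, hq2⟩ := exists_between (show ρ < ρ / r by rw [lt_div_iff₀ hr0]; nlinarith)
  rw [lt_div_iff₀ hr0] at hq2
  have hq0 : 0 < q := hρ0.trans hq1
  obtain ⟨M, hM0, hM⟩ := h.g_close q hq1
  obtain ⟨p, C, hp0, hpρ, hC0, hC⟩ := h.exists_norm_cInt_Q_sub_le hσ hσρ hB0 hr hB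
  obtain ⟨B', hB'0, hB'⟩ := h.exists_norm_inv_D_le
  obtain ⟨C', hC'0, hC'⟩ := h.exists_norm_residuePart_sub_leadingPart_le
  set S := ∑ k, ∑ j ∈ Finset.range (ν + 1 + 1), ‖c k j‖ with hS
  have hS0 : 0 ≤ S := by positivity
  refine ⟨B' * (M * (S + B) + C' + C), by positivity, fun n hn z d hz1 hz2 hd0 hd1 hd => ?_⟩
  have hz : ‖z‖ < 1 := hz2.trans_lt hr
  have hza : z ∉ Set.range a := by
    rintro ⟨k, rfl⟩
    have := hd k
    simp only [sub_self, norm_zero] at this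
    linarith
  have e := h.mul_remainder_eq n (hσ.trans_lt hz1) hz hza
  set H := P n z - De z / τ * z ^ n - (D z)⁻¹ * leadingPart D τ a (ν + 1) c n z
  have hH : H = (D z)⁻¹ * (D z * H) := by
    have := h.D_ne z hz.le
    field_simp
  have hn1 : (1 : ℝ) ≤ (n : ℝ) ^ ν := one_le_pow₀ (by exact_mod_cast hn)
  have hdp : 1 ≤ 1 / d ^ (ν + 2) := by
    rw [le_div_iff₀ (by positivity), one_mul]
    exact pow_le_one₀ hd0.le hd1
  have hX : ρ ^ n ≤ 1 / d ^ (ν + 2) * n ^ ν * ρ ^ n :=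
    le_mul_of_one_le_left (by positivity) (one_le_mul_of_one_le_of_one_le hdp hn1)
  have hDe : ‖De z‖ ≤ (S + B) * (1 / d ^ (ν + 2)) := by
    rw [h.De_eq z (hσ.trans_lt hz1) hza, add_mul]
    refine (norm_add_le _ _).trans (add_le_add ?_ ?_)
    · exact (norm_principalParts_le hd0 hd1 hd).trans_eq (by rw [hS]; ring)
    · exact (hB z hz1 hz2).trans (le_mul_of_one_le_right hB0 hdp)
  have e1 : ‖z ^ n * De z * (g n z - D z / τ)‖ ≤
      M * (S + B) * (1 / d ^ (ν + 2) * n ^ ν * ρ ^ n) := by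
    rw [norm_mul, norm_mul, norm_pow]
    have h1 := hM n z hz.le
    calc _ ≤ r ^ n * ((S + B) * (1 / d ^ (ν + 2))) * (M * q ^ n) := by gcongr
      _ = M * (S + B) * (1 / d ^ (ν + 2) * 1 * (q * r) ^ n) := by rw [mul_pow]; ring
      _ ≤ _ := by gcongr
  have e2 : ‖residuePart g a (ν + 1) c n z - leadingPart D τ a (ν + 1) c n z‖ ≤
      C' * (1 / d ^ (ν + 2) * n ^ ν * ρ ^ n) :=
    (hC' n hn z d hd0 hd1 hd).trans_eq (by ring)
  have e3 : C * p ^ n ≤ C * (1 / d ^ (ν + 2) * n ^ ν * ρ ^ n) := by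
    have : p ^ n ≤ ρ ^ n := pow_le_pow_left₀ hp0.le hpρ.le n
    have := this.trans hX
    gcongr
  calc ‖H‖ = ‖(D z)⁻¹‖ * ‖D z * H‖ := by rw [← norm_mul, ← hH]
    _ ≤ B' * ((M * (S + B) + C' + C) * (1 / d ^ (ν + 2) * n ^ ν * ρ ^ n)) := by
      refine mul_le_mul (hB' z hz.le) ?_ (norm_nonneg _) hB'0
      rw [e, add_mul, add_mul]
      exact norm_add₃_le.trans (add_le_add (add_le_add e1 e2) ((hC n z hz1 hz2).trans e3))
    _ = _ := by ring

theorem exists_norm_mul_sub_leadingPart_le_of_simple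
    (h : PoleRepresentation P D De g τ ρ ρ' a 0 c Q) {κ : ℝ} (hκ : κ < ρ) :
    ∃ C δ, 0 ≤ C ∧ 0 < δ ∧ δ < 1 ∧ ∀ n z, ‖z‖ ≤ κ →
      ‖D z * P n z - leadingPart D τ a 0 c n z‖ ≤ C * (ρ ^ n * δ ^ n) := by
  have hρ0 := h.pos
  obtain ⟨p, C, hp0, hpρ, hC0, hC⟩ := h.exists_norm_mul_sub_residuePart_le hκ
  obtain ⟨q, hq, hq1⟩ := exists_between h.lt_one
  have hq0 : 0 < q := hρ0.trans hq
  obtain ⟨M, hM0, hM⟩ := h.g_close q hq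
  have hd0 : 0 < ρ - κ := by linarith
  set s := max (p / ρ) q with hs
  have hs0 : 0 < s := hq0.trans_le (le_max_right _ _)
  refine ⟨C + ∑ k, ‖c k 0‖ * (M / (ρ - κ)), s, by positivity, hs0,
    max_lt ((div_lt_one hρ0).2 hpρ) hq1, fun n z hz => ?_⟩
  have e1 : ‖D z * P n z - residuePart g a 0 c n z‖ ≤ C * (ρ ^ n * s ^ n) := by
    refine (hC n z hz).trans ?_
    have : p ≤ ρ * s := by
      rw [mul_comm, ← div_le_iff₀ hρ0]; exact le_max_left _ _
    rw [← mul_pow]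
    gcongr
  have e2 : ‖residuePart g a 0 c n z - leadingPart D τ a 0 c n z‖ ≤
      (∑ k, ‖c k 0‖ * (M / (ρ - κ))) * (ρ ^ n * s ^ n) := by
    rw [h.residuePart_sub_leadingPart_zero, Finset.sum_mul]
    refine norm_sum_le_of_le _ fun k _ => ?_
    rw [norm_div, norm_mul, norm_mul, norm_pow, h.norm_a, norm_sub_rev (a k) z]
    have h1 := hM n (a k) (by rw [h.norm_a]; exact h.lt_one.le)
    have h2 : ρ - κ ≤ ‖z - a k‖ := by
      have := h.le_norm_sub_a (z := z) k
      linarith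
    have h3 : q ^ n ≤ s ^ n := pow_le_pow_left₀ hq0.le (le_max_right _ _) n
    calc _ ≤ ‖c k 0‖ * (ρ ^ n * (M * s ^ n)) / (ρ - κ) := by
          gcongr
          exact h1.trans (by gcongr)
      _ = _ := by ring
  calc _ = ‖(D z * P n z - residuePart g a 0 c n z) +
        (residuePart g a 0 c n z - leadingPart D τ a 0 c n z)‖ := by congr 1; ring
    _ ≤ _ := (norm_add_le _ _).trans ((add_le_add e1 e2).trans_eq (by ring))

theorem exists_norm_mul_sub_leadingPart_le {ν : ℕ}
    (h : PoleRepresentation P D De g τ ρ ρ' a (ν + 1) c Q) {κ : ℝ} (hκ0 : 0 ≤ κ) (hκ : κ < ρ) :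
    ∃ C, 0 ≤ C ∧ ∀ n, 1 ≤ n → ∀ z, ‖z‖ ≤ κ →
      ‖D z * P n z - leadingPart D τ a (ν + 1) c n z‖ ≤ C * (n ^ ν * ρ ^ n) := by
  have hρ0 := h.pos
  obtain ⟨p, C, hp0, hpρ, hC0, hC⟩ := h.exists_norm_mul_sub_residuePart_le hκ
  obtain ⟨C', hC'0, hC'⟩ := h.exists_norm_residuePart_sub_leadingPart_le
  have hd0 : 0 < ρ - κ := by linarith
  refine ⟨C + C' / (ρ - κ) ^ (ν + 2), by positivity, fun n hn z hz => ?_⟩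
  have hn1 : (1 : ℝ) ≤ (n : ℝ) ^ ν := one_le_pow₀ (by exact_mod_cast hn)
  have e1 : ‖D z * P n z - residuePart g a (ν + 1) c n z‖ ≤ C * (n ^ ν * ρ ^ n) := by
    refine (hC n z hz).trans ?_
    have h1 : p ^ n ≤ ρ ^ n := pow_le_pow_left₀ hp0.le hpρ.le n
    have h2 : ρ ^ n ≤ n ^ ν * ρ ^ n := le_mul_of_one_le_left (by positivity) hn1
    have := h1.trans h2
    gcongr
  have e2 := hC' n hn z (ρ - κ) hd0 (by linarith [h.lt_one]) fun k => by
    have := h.le_norm_sub_a (z := z) k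
    linarith
  calc _ = ‖(D z * P n z - residuePart g a (ν + 1) c n z) +
        (residuePart g a (ν + 1) c n z - leadingPart D τ a (ν + 1) c n z)‖ := by congr 1; ring
    _ ≤ _ := (norm_add_le _ _).trans ((add_le_add e1 e2).trans_eq (by ring))

end PoleRepresentation

/-! ### Bounding the number of zeros -/

/-- Cauchy's formula for the exterior; the sign comes from the orientation of the circle. -/
theorem cInt_div_sub_of_tendsto_zero {f : ℂ → ℂ} {R : ℝ} {x : ℂ} (hR : 0 < R)
    (hf : ∀ t, R ≤ ‖t‖ → AnalyticAt ℂ f t) (hf0 : Tendsto f (Bornology.cobounded ℂ) (𝓝 0))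
    (hx : R < ‖x‖) : cInt R (fun t => f t / (t - x)) = -f x := by
  have htx : ∀ t : ℂ, ‖t‖ ≤ R → t - x ≠ 0 := fun t ht =>
    sub_ne_zero_of_norm_gt (ht.trans_lt hx)
  have hds : ∀ t, R ≤ ‖t‖ → AnalyticAt ℂ (dslope f x) t := fun t ht =>
    (hf x hx.le).dslope (hf t ht)
  have h1 : cInt R (dslope f x) = -f x := by
    refine cInt_eq_of_tendsto hR hds ?_
    have h2 := (tendsto_div_sub_cobounded x).mul (hf0.sub_const (f x))
    rw [one_mul, zero_sub] at h2
    refine h2.congr' ?_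
    filter_upwards [Bornology.eventually_ne_cobounded x] with t ht
    rw [dslope_of_ne _ ht, slope_def_field]
    ring
  have h3 : cInt R (fun t => f x * (1 / (t - x))) = 0 :=
    cInt_eq_zero (f := fun t => f x * (1 / (t - x))) hR.le fun t ht =>
      analyticAt_const.mul (analyticAt_div_sub analyticAt_const (htx t ht))
  rw [cInt_congr hR.le (g := fun t => dslope f x t + f x * (1 / (t - x))), cInt_add, h1, h3,
    add_zero]
  · exact circleIntegrable_of_analyticAt hR.le fun t ht => hds t ht.ge
  · exact circleIntegrable_of_analyticAt hR.le fun t ht =>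
      analyticAt_const.mul (analyticAt_div_sub analyticAt_const (htx t ht.le))
  · intro t ht
    have h4 := htx t ht.le
    rw [dslope_of_ne _ (sub_ne_zero.1 h4), slope_def_field]
    field_simp
    ring

theorem tendsto_eval_div_eval_cobounded {p q : ℂ[X]} (hp : p.Monic) (hq : q.Monic)
    (h : p.natDegree < q.natDegree) :
    Tendsto (fun t => p.eval t / q.eval t) (Bornology.cobounded ℂ) (𝓝 0) := by
  have h1 := (monic_eval_div_pow_tendsto hp).div (monic_eval_div_pow_tendsto hq) one_ne_zero
  have h2 := h1.mul ((tendsto_inv₀_cobounded (α := ℂ)).pow (q.natDegree - p.natDegree))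
  rw [zero_pow (by omega), mul_zero] at h2
  refine h2.congr' ?_
  filter_upwards [Bornology.eventually_ne_cobounded (0 : ℂ)] with t ht
  rw [Pi.div_apply, div_div_div_comm, inv_pow, pow_sub₀ t ht h.le]
  field_simp

theorem pow_card_le_norm_eval_multiset_prod {Z : Multiset ℂ} {t : ℂ} {d : ℝ} (hd : 0 ≤ d)
    (h : ∀ z ∈ Z, d ≤ ‖t - z‖) :
    d ^ Z.card ≤ ‖((Z.map fun z => X - C z).prod).eval t‖ := by
  induction Z using Multiset.induction_on with
  | empty => simp
  | cons z Z ih =>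
    rw [Multiset.map_cons, Multiset.prod_cons, eval_mul, norm_mul, Multiset.card_cons, pow_succ']
    simp only [eval_sub, eval_X, eval_C]
    have h1 := ih fun x hx => h x (Multiset.mem_cons_of_mem hx)
    have h2 := h z (Multiset.mem_cons_self z Z)
    gcongr

theorem norm_eval_multiset_prod_le {Z : Multiset ℂ} {t : ℂ} {d : ℝ} (hd : 0 ≤ d)
    (h : ∀ z ∈ Z, ‖t - z‖ ≤ d) :
    ‖((Z.map fun z => X - C z).prod).eval t‖ ≤ d ^ Z.card := by
  induction Z using Multiset.induction_on with
  | empty => simp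
  | cons z Z ih =>
    rw [Multiset.map_cons, Multiset.prod_cons, eval_mul, norm_mul, Multiset.card_cons, pow_succ']
    simp only [eval_sub, eval_X, eval_C]
    have h1 := ih fun x hx => h x (Multiset.mem_cons_of_mem hx)
    have h2 := h z (Multiset.mem_cons_self z Z)
    gcongr

/-- If a function with at least as many zeros in `|z| ≤ κ` as there are points `b k` is close on
`|z| = q` to `∑ k, β k / (b k - z)`, then each `β k` is small. -/
theorem norm_residue_mul_le {ι : Type*} [Fintype ι] [DecidableEq ι] {b β : ι → ℂ}
    {κ q ρ ε : ℝ} (hκ0 : 0 ≤ κ) (hκ : κ < q) (hq : q < ρ) (hb : ∀ k, ‖b k‖ = ρ)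
    {Z : Multiset ℂ} (hZ : Z.card = Fintype.card ι) (hZκ : ∀ z ∈ Z, ‖z‖ ≤ κ) {G : ℂ → ℂ}
    (hG : ∀ z, ‖z‖ ≤ q → AnalyticAt ℂ G z)
    (hF : ∀ z, ‖z‖ = q →
      ‖G z * ((Z.map fun z => X - C z).prod).eval z - ∑ k, β k / (b k - z)‖ ≤ ε) (k₀ : ι) :
    ‖β k₀‖ * ((∏ k ∈ Finset.univ.erase k₀, ‖b k₀ - b k‖) / (2 * ρ) ^ Fintype.card ι) ≤
      q * (ε * ((2 * ρ) ^ (Fintype.card ι - 1) / (q - κ) ^ Fintype.card ι)) := by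
  have hq0 : 0 < q := hκ0.trans_lt hκ
  have hρ0 : 0 < ρ := hq0.trans hq
  have hd0 : 0 < q - κ := sub_pos.2 hκ
  set Q : ℂ[X] := (Z.map fun z => X - C z).prod with hQ
  set A : ℂ[X] := ∏ k ∈ Finset.univ.erase k₀, (X - C (b k)) with hA
  have hAev : ∀ t, A.eval t = ∏ k ∈ Finset.univ.erase k₀, (t - b k) := fun t => by
    simp [hA, eval_prod]
  have hcard : (Finset.univ.erase k₀).card = Fintype.card ι - 1 := by
    rw [Finset.card_erase_of_mem (Finset.mem_univ _), Finset.card_univ]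
  have hAd : A.natDegree = Fintype.card ι - 1 := by
    rw [hA, natDegree_finsetProd_X_sub_C_eq_card, hcard]
  have hQd : Q.natDegree = Fintype.card ι := by
    rw [hQ, natDegree_multiset_prod_X_sub_C_eq_card, hZ]
  have hι : 0 < Fintype.card ι := Fintype.card_pos_iff.2 ⟨k₀⟩
  have hQlow : ∀ t : ℂ, q ≤ ‖t‖ → (q - κ) ^ Fintype.card ι ≤ ‖Q.eval t‖ := fun t ht => by
    rw [← hZ]
    refine pow_card_le_norm_eval_multiset_prod hd0.le fun z hz => ?_
    have := norm_sub_norm_le t z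
    have := hZκ z hz
    linarith
  have hQne : ∀ t : ℂ, q ≤ ‖t‖ → Q.eval t ≠ 0 := fun t ht =>
    norm_pos_iff.1 ((pow_pos hd0 _).trans_le (hQlow t ht))
  -- The test function: it vanishes at every b k except b k₀, tends to 0 at infinity since deg A =
  -- deg Q - 1, and turns G Q into the analytic G A. Integration over |t| = q thus leaves only β k₀
  -- f (b k₀) from the sum and nothing from G A.
  set f : ℂ → ℂ := fun t => A.eval t / Q.eval t with hf
  have hfan : ∀ t, q ≤ ‖t‖ → AnalyticAt ℂ f t := fun t ht =>
    (A.differentiable.analyticAt t).div (Q.differentiable.analyticAt t) (hQne t ht)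
  have hf0 : Tendsto f (Bornology.cobounded ℂ) (𝓝 0) :=
    tendsto_eval_div_eval_cobounded (monic_prod_X_sub_C _ _) (monic_multisetProd_X_sub_C _)
      (by rw [hAd, hQd]; omega)
  have hfb : ∀ k, k ≠ k₀ → f (b k) = 0 := fun k hk => by
    rw [hf]
    simp only
    rw [hAev, Finset.prod_eq_zero (Finset.mem_erase.2 ⟨hk, Finset.mem_univ _⟩) (sub_self _),
      zero_div]
  have hqb : ∀ k, q < ‖b k‖ := fun k => by rw [hb]; exact hq
  have hbt : ∀ k (t : ℂ), ‖t‖ = q → t - b k ≠ 0 := fun k t ht =>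
    sub_ne_zero_of_norm_gt (ht ▸ hqb k)
  have h1 : cInt q (fun t => ∑ k, -β k * (f t / (t - b k))) = β k₀ * f (b k₀) := by
    rw [cInt_sum]
    · simp only [cInt_const_mul, cInt_div_sub_of_tendsto_zero hq0 hfan hf0 (hqb _)]
      rw [Finset.sum_eq_single k₀ (fun k _ hk => by rw [hfb k hk]; ring) (by simp)]
      ring
    · exact fun k _ => circleIntegrable_of_analyticAt hq0.le fun t ht =>
        analyticAt_const.mul (analyticAt_div_sub (hfan t ht.ge) (hbt k t ht))
  have h2 : cInt q (fun t => G t * A.eval t) = 0 :=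
    cInt_eq_zero (f := fun t => G t * A.eval t) hq0.le fun t ht =>
      (hG t ht).mul (A.differentiable.analyticAt t)
  have h3 : cInt q (fun t => (∑ k, -β k * (f t / (t - b k))) - G t * A.eval t) =
      β k₀ * f (b k₀) := by
    rw [cInt_sub, h1, h2, sub_zero]
    · exact circleIntegrable_of_analyticAt hq0.le fun t ht => Finset.analyticAt_fun_sum _
        fun k _ => analyticAt_const.mul (analyticAt_div_sub (hfan t ht.ge) (hbt k t ht))
    · exact circleIntegrable_of_analyticAt hq0.le fun t ht =>
        (hG t ht.le).mul (A.differentiable.analyticAt t)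
  have h4 : ‖β k₀ * f (b k₀)‖ ≤
      q * (ε * ((2 * ρ) ^ (Fintype.card ι - 1) / (q - κ) ^ Fintype.card ι)) := by
    rw [← h3]
    refine norm_cInt_le hq0.le fun t ht => ?_
    have h5 : (∑ k, -β k * (f t / (t - b k))) - G t * A.eval t =
        -((G t * Q.eval t - ∑ k, β k / (b k - t)) * f t) := by
      have h6 : G t * A.eval t = G t * Q.eval t * f t := by
        have := hQne t ht.ge
        rw [hf]
        field_simp
      rw [h6, sub_mul, Finset.sum_mul, neg_sub]
      congr 1
      refine Finset.sum_congr rfl fun k _ => ?_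
      rw [← neg_sub t (b k), div_neg]
      ring
    rw [h5, norm_neg, norm_mul]
    have h7 : ‖A.eval t‖ ≤ (2 * ρ) ^ (Fintype.card ι - 1) := by
      rw [hAev, norm_prod, ← hcard, ← Finset.prod_const]
      refine Finset.prod_le_prod (fun _ _ => norm_nonneg _) fun k _ => ?_
      refine (norm_sub_le _ _).trans ?_
      rw [hb, ht]
      linarith
    have h8 := hF t ht
    have h9 := hQlow t ht.ge
    have h10 : ‖f t‖ ≤ (2 * ρ) ^ (Fintype.card ι - 1) / (q - κ) ^ Fintype.card ι := by
      rw [hf, norm_div]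
      gcongr
    exact mul_le_mul h8 h10 (norm_nonneg _) ((norm_nonneg _).trans h8)
  refine le_trans ?_ h4
  rw [norm_mul, hf, norm_div, hAev, norm_prod]
  have h11 : ‖Q.eval (b k₀)‖ ≤ (2 * ρ) ^ Fintype.card ι := by
    rw [← hZ]
    refine norm_eval_multiset_prod_le (by positivity) fun z hz => ?_
    refine (norm_sub_le _ _).trans ?_
    have := hZκ z hz
    rw [hb]
    linarith
  have h12 : 0 < ‖Q.eval (b k₀)‖ := norm_pos_iff.2 (hQne _ (hqb k₀).le)
  have h13 : 0 ≤ ∏ k ∈ Finset.univ.erase k₀, ‖b k₀ - b k‖ :=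
    Finset.prod_nonneg fun _ _ => norm_nonneg _
  gcongr

theorem exists_le_lt_of_isCompact_subset_ball {K : Set ℂ} (hK : IsCompact K) {ρ : ℝ}
    (hρ : 0 < ρ) (h : K ⊆ Metric.ball 0 ρ) : ∃ κ, 0 ≤ κ ∧ κ < ρ ∧ ∀ z ∈ K, ‖z‖ ≤ κ := by
  rcases K.eq_empty_or_nonempty with rfl | hne
  · exact ⟨0, le_rfl, hρ, by simp⟩
  · obtain ⟨x, hx, hmax⟩ := hK.exists_isMaxOn hne continuous_norm.continuousOn
    exact ⟨‖x‖, norm_nonneg _, by simpa using h hx, hmax⟩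

/-- If `F n * p n` is asymptotic to `∑ k, β n k / (b k - z)` locally uniformly in `|z| < ρ`, with
`l` distinct points `b k` on `|z| = ρ` and some `β n k` bounded below, then `p n` has eventually
fewer than `l` zeros in each compact subset of `|z| < ρ`. -/
theorem exists_forall_numZerosIn_lt {l : ℕ} {b : Fin l → ℂ} (hinj : Function.Injective b) {ρ : ℝ}
    (hρ : 0 < ρ) (hb : ∀ k, ‖b k‖ = ρ) {p : ℕ → ℂ[X]} (hp : ∀ n, p n ≠ 0) {F : ℕ → ℂ → ℂ}
    (hF : ∀ n z, ‖z‖ < ρ → AnalyticAt ℂ (F n) z) {β : ℕ → Fin l → ℂ} (k₀ : Fin l) {B : ℝ}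
    (hB0 : 0 < B) (hB : ∀ n, B ≤ ‖β n k₀‖)
    (hlim : ∀ q, 0 < q → q < ρ → ∃ ε : ℕ → ℝ, Tendsto ε atTop (𝓝 0) ∧ ∀ᶠ n in atTop,
      ∀ z, ‖z‖ ≤ q → ‖F n z * (p n).eval z - ∑ k, β n k / (b k - z)‖ ≤ ε n)
    {K : Set ℂ} (hK : IsCompact K) (hKρ : K ⊆ Metric.ball 0 ρ) :
    ∃ N, ∀ n, N ≤ n → numZerosIn (p n) K < l := by
  obtain ⟨κ, hκ0, hκρ, hκ⟩ := exists_le_lt_of_isCompact_subset_ball hK hρ hKρ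
  obtain ⟨q, hκq, hq⟩ := exists_between hκρ
  obtain ⟨ε, hε, hlim⟩ := hlim q (hκ0.trans_lt hκq) hq
  set c : ℝ := (∏ k ∈ Finset.univ.erase k₀, ‖b k₀ - b k‖) / (2 * ρ) ^ Fintype.card (Fin l) with hc
  have hc0 : 0 < c := by
    refine div_pos (Finset.prod_pos fun k hk => norm_pos_iff.2 (sub_ne_zero.2 fun h => ?_))
      (by positivity)
    exact (Finset.mem_erase.1 hk).1 (hinj h).symm
  set c' : ℝ := (2 * ρ) ^ (Fintype.card (Fin l) - 1) / (q - κ) ^ Fintype.card (Fin l)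
  have h1 : Tendsto (fun n => q * (ε n * c')) atTop (𝓝 0) := by
    simpa using (hε.mul_const c').const_mul q
  obtain ⟨N, hN⟩ := eventually_atTop.1
    (hlim.and (h1.eventually (gt_mem_nhds (mul_pos hB0 hc0))))
  refine ⟨N, fun n hn => ?_⟩
  obtain ⟨h2, h3⟩ := hN n hn
  classical
  by_contra! hlt
  rw [numZerosIn] at hlt
  -- Exactly l of the zeros are kept, counted with multiplicity; the cofactor of their polynomial
  -- goes into G.
  obtain ⟨Z, hZ⟩ := Multiset.card_pos_iff_exists_mem.1
    ((Multiset.card_powersetCard l ((p n).roots.filter (fun z => z ∈ K))).symm ▸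
      Nat.choose_pos (by convert hlt))
  obtain ⟨hZle, hZcard⟩ := Multiset.mem_powersetCard.1 hZ
  obtain ⟨s, hs⟩ := (Multiset.prod_X_sub_C_dvd_iff_le_roots (hp n) Z).2
    (hZle.trans (Multiset.filter_le _ _))
  have h4 := norm_residue_mul_le (β := β n) (G := fun z => F n z * s.eval z) (ε := ε n) hκ0 hκq hq
    hb (by rw [hZcard, Fintype.card_fin])
    (fun z hz => hκ z (Multiset.mem_filter.1 (Multiset.mem_of_le hZle hz)).2)
    (fun z hz => (hF n z (by linarith)).mul (s.differentiable.analyticAt z)) (fun z hz => by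
      have h5 := h2 z hz.le
      rw [hs, eval_mul] at h5
      rwa [mul_assoc, mul_comm (s.eval z)]) k₀
  -- The coefficient at b k₀ would be smaller than its lower bound B.
  exact absurd ((mul_le_mul_of_nonneg_right (hB n) hc0.le).trans h4) (not_le.2 h3)

/-! ### Dominant poles, normalization and the main theorem -/

theorem IsPoleAt.not_analyticAt {f : ℂ → ℂ} {a : ℂ} (h : IsPoleAt f a) : ¬ AnalyticAt ℂ f a :=
  fun hf => not_le.2 h.2 hf.meromorphicOrderAt_nonneg

/-- All poles have modulus ρ, so dominance reduces to comparing multiplicities; conversely, a pole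
of maximal multiplicity is dominant, hence among the first l. -/
theorem poleMult_le_of_isDominantPole_iff {f : ℂ → ℂ} {ρ ρ' : ℝ} {u l m : ℕ} {a : Fin u → ℂ}
    (hρ' : ρ' < ρ) (ha_inj : Function.Injective a) (ha_norm : ∀ k, ‖a k‖ = ρ)
    (ha_pole : ∀ k, IsPoleAt f (a k))
    (han : ∀ z : ℂ, ρ' < ‖z‖ → z ∉ Set.range a → AnalyticAt ℂ f z) (hl : 0 < l) (hlu : l ≤ u)
    (hdom : ∀ k : Fin u, IsDominantPole f {z | ρ' < ‖z‖} (a k) ↔ (k : ℕ) < l)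
    (hm : ∀ k : Fin l, poleMult f (a (Fin.castLE hlu k)) = m) (k : Fin u) :
    poleMult f (a k) ≤ m ∧ (poleMult f (a k) = m ↔ (k : ℕ) < l) := by
  have hle : ∀ k, poleMult f (a k) ≤ m := fun k => by
    rw [← hm ⟨0, hl⟩]
    by_cases hk : k = Fin.castLE hlu ⟨0, hl⟩
    · rw [← hk]
    rcases ((hdom (Fin.castLE hlu ⟨0, hl⟩)).2 hl).2.2 (a k)
      (by simpa [ha_norm k] using hρ') (ha_inj.ne hk) (ha_pole k).not_analyticAt with h | h
    · rw [ha_norm, ha_norm] at h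
      exact absurd h (lt_irrefl _)
    · exact h.2.2
  refine ⟨hle k, fun hk => (hdom k).1 ⟨by simpa [ha_norm k] using hρ', ha_pole k,
    fun b hb _ hbn => ?_⟩, fun hk => hm ⟨k, hk⟩⟩
  obtain ⟨j, rfl⟩ : b ∈ Set.range a := by
    by_contra h
    exact hbn (han b hb h)
  exact Or.inr ⟨by rw [ha_norm, ha_norm], ha_pole j, by rw [hk]; exact hle j⟩

theorem exists_poleRepresentation {w : Circle → ℝ} (hpos : ∀ ζ, 0 < w ζ) (hw : Continuous w)
    {φ : ℕ → ℂ[X]} (hφ : IsOrthonormalSystem w φ) {ρ ρ' : ℝ} (hρ1 : ρ < 1) (hρ'0 : 0 ≤ ρ')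
    (hρ' : ρ' < ρ) {De : ℂ → ℂ} (hDe : ∀ z : ℂ, 1 < ‖z‖ → De z = szegoD w z) {u : ℕ}
    {a : Fin u → ℂ} (ha_inj : Function.Injective a) (ha_norm : ∀ k, ‖a k‖ = ρ)
    (ha_pole : ∀ k, IsPoleAt De (a k))
    (han : ∀ z : ℂ, ρ' < ‖z‖ → z ∉ Set.range a → AnalyticAt ℂ De z) {μ : ℕ}
    (hmult : ∀ k, poleMult De (a k) ≤ μ + 1) :
    ∃ D g c Q, PoleRepresentation (fun n z => (monicOP φ n).eval z) D De g (szegoTau w : ℂ)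
      ρ ρ' a μ c Q ∧ (∀ z, ‖z‖ < 1 → D z = szegoD w z) ∧
      ∀ k, poleCoeff De (μ + 1) (a k) = c k μ ∧ (poleMult De (a k) = μ + 1 ↔ c k μ ≠ 0) := by
  have hρ0 := hρ'0.trans_lt hρ'
  obtain ⟨D, J, R₀, h⟩ := exists_szegoExtension hpos hw hDe hρ0 hρ1 fun z hz =>
    han z (hρ'.trans hz) fun ⟨k, hk⟩ => by rw [← hk, ha_norm] at hz; exact lt_irrefl _ hz
  obtain ⟨R, hR1, hR⟩ := exists_between h.one_lt
  obtain ⟨c, Q, hQ, hDeq, hc, hcm⟩ := exists_principalPart_decomposition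
    (U := {z : ℂ | ρ' < ‖z‖}) ha_inj ha_pole hmult han
  exact ⟨D, fun n => interiorPart De D R φ n, c, Q,
    ⟨hρ0, hρ1, hρ'0, hρ', ha_norm, fun z hz => h.analyticAt_D z (hz.trans_lt h.one_lt),
      fun z hz => h.D_ne z (hz.trans_lt h.one_lt),
      fun n z hz => h.analyticAt_interiorPart hR1.le hR φ n (hz.trans_lt hR1),
      fun q hq => h.exists_norm_interiorPart_sub_le hpos hw hφ hR1 hR hq,
      fun n z hz => h.mul_monicOP_eq hpos hw hφ n hR1 hR hz, hQ, hDeq⟩,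
    h.eq_szegoD, fun k => ⟨hc k, hcm k⟩⟩

/-- The integer exponent and the truncated one differ only for n < μ, where the binomial is 0. -/
theorem choose_mul_zpow (n μ : ℕ) (a : ℂ) :
    (n.choose μ : ℂ) * a ^ ((n : ℤ) - ((μ + 1 : ℕ) : ℤ) + 1) = n.choose μ * a ^ (n - μ) := by
  rcases lt_or_ge n μ with h | h
  · simp [Nat.choose_eq_zero_of_lt h]
  · rw [← zpow_natCast a (n - μ), Nat.cast_sub h]
    congr 2
    push_cast
    ring

theorem sum_eq_sum_castLE {u l : ℕ} (hlu : l ≤ u) {f : Fin u → ℂ}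
    (hf : ∀ k : Fin u, ¬ (k : ℕ) < l → f k = 0) :
    ∑ k, f k = ∑ k : Fin l, f (Fin.castLE hlu k) :=
  (Fintype.sum_of_injective (Fin.castLE hlu) (Fin.castLE_injective hlu) _ _
    (fun k hk => hf k fun h => hk ⟨⟨k, h⟩, rfl⟩) fun _ => rfl).symm

/-- All b k have modulus ρ, so quotients are determined by arguments. The convention θ₁ = 1 is as
good as 0, because the exponent is an integer multiple of 2πi. -/
theorem exp_relAngle_eq {l : ℕ} (hl : 0 < l) {b : Fin l → ℂ} {ρ : ℝ} (hρ : 0 < ρ)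
    (hb : ∀ k, ‖b k‖ = ρ) {n μ : ℕ} (hn : μ ≤ n) (k : Fin l) :
    Complex.exp (2 * Real.pi * Complex.I * ((n : ℂ) - ((μ + 1 : ℕ) : ℂ) + 1) *
      (relAngle hl b k : ℂ)) = b k ^ (n - μ) / b ⟨0, hl⟩ ^ (n - μ) := by
  have hb0 : ∀ k, b k ≠ 0 := fun k => norm_pos_iff.1 (by rw [hb]; exact hρ)
  have h1 : Complex.exp (2 * Real.pi * Complex.I * (relAngle hl b k : ℂ)) =
      b k / b ⟨0, hl⟩ := by
    unfold relAngle
    split_ifs with hk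
    · have : k = ⟨0, hl⟩ := Fin.ext hk
      rw [this, div_self (hb0 _)]
      simp [Complex.exp_two_pi_mul_I]
    · have h2 : (2 * Real.pi * Complex.I * (((Complex.arg (b k) - Complex.arg (b ⟨0, hl⟩)) /
          (2 * Real.pi) : ℝ) : ℂ)) =
          Complex.arg (b k) * Complex.I - Complex.arg (b ⟨0, hl⟩) * Complex.I := by
        have := Real.pi_ne_zero
        push_cast
        field_simp
      rw [h2, Complex.exp_sub]
      conv_rhs => rw [← Complex.norm_mul_exp_arg_mul_I (b k),
        ← Complex.norm_mul_exp_arg_mul_I (b ⟨0, hl⟩), hb, hb]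
      rw [mul_div_mul_left]
      exact_mod_cast hρ.ne'
  rw [← div_pow, ← h1, ← Complex.exp_nat_mul, Nat.cast_sub hn]
  congr 1
  push_cast
  ring

/-- Combines (n + 1 - μ)^μ ≤ μ! binom(n, μ) with n ≤ μ (n + 1 - μ), valid for 1 ≤ μ ≤ n. -/
theorem exists_pow_le_mul_choose (μ : ℕ) :
    ∃ A : ℝ, 0 < A ∧ ∀ n : ℕ, μ ≤ n → (n : ℝ) ^ μ ≤ A * n.choose μ := by
  rcases Nat.eq_zero_or_pos μ with rfl | hμ
  · exact ⟨1, one_pos, by simp⟩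
  refine ⟨μ ^ μ * μ.factorial, by positivity, fun n hn => ?_⟩
  have h1 := Nat.pow_le_choose (α := ℝ) μ n
  rw [div_le_iff₀ (by positivity)] at h1
  have h2 : (n : ℝ) ≤ μ * (n + 1 - μ : ℕ) := by
    rw [Nat.cast_sub (by omega)]
    push_cast
    have : (1 : ℝ) ≤ μ := by exact_mod_cast hμ
    have : (μ : ℝ) ≤ n := by exact_mod_cast hn
    nlinarith
  calc (n : ℝ) ^ μ ≤ (μ * (n + 1 - μ : ℕ)) ^ μ := by gcongr
    _ = μ ^ μ * (n + 1 - μ : ℕ) ^ μ := mul_pow _ _ _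
    _ ≤ μ ^ μ * (n.choose μ * μ.factorial) := by gcongr
    _ = _ := by ring

namespace PoleRepresentation

variable {P : ℕ → ℂ → ℂ} {D De : ℂ → ℂ} {g : ℕ → ℂ → ℂ} {τ : ℂ} {ρ ρ' : ℝ} {u : ℕ}
  {a : Fin u → ℂ} {μ : ℕ} {c : Fin u → ℕ → ℂ} {Q : ℂ → ℂ}

theorem normalized_sub_eq (h : PoleRepresentation P D De g τ ρ ρ' a μ c Q) (hτ : τ ≠ 0)
    (k₀ : Fin u) {n : ℕ} (hn : μ ≤ n) (z : ℂ) :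
    τ * D z / a k₀ ^ (n - μ) * (n.choose μ : ℂ)⁻¹ * P n z -
      ∑ k, D (a k) * c k μ / (a k - z) * (a k ^ (n - μ) / a k₀ ^ (n - μ)) =
    τ / a k₀ ^ (n - μ) * (n.choose μ : ℂ)⁻¹ * (D z * P n z - leadingPart D τ a μ c n z) := by
  have h1 : (n.choose μ : ℂ) ≠ 0 := by exact_mod_cast (Nat.choose_pos hn).ne'
  have h2 : a k₀ ^ (n - μ) ≠ 0 :=
    pow_ne_zero _ (norm_pos_iff.1 (by rw [h.norm_a]; exact h.pos))
  rw [mul_sub, leadingPart, Finset.mul_sum]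
  congr 1
  · ring
  · refine Finset.sum_congr rfl fun k _ => ?_
    field_simp

theorem exists_norm_normalized_sub_le_of_simple
    (h : PoleRepresentation P D De g τ ρ ρ' a 0 c Q) (hτ : τ ≠ 0) (k₀ : Fin u) {κ : ℝ}
    (hκ : κ < ρ) : ∃ C δ, 0 ≤ C ∧ 0 < δ ∧ δ < 1 ∧ ∀ n z, ‖z‖ ≤ κ →
      ‖τ * D z / a k₀ ^ (n - 0) * (n.choose 0 : ℂ)⁻¹ * P n z -
        ∑ k, D (a k) * c k 0 / (a k - z) * (a k ^ (n - 0) / a k₀ ^ (n - 0))‖ ≤ C * δ ^ n := by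
  obtain ⟨C, δ, hC, hδ, hδ1, hle⟩ := h.exists_norm_mul_sub_leadingPart_le_of_simple hκ
  refine ⟨‖τ‖ * C, δ, by positivity, hδ, hδ1, fun n z hz => ?_⟩
  have hρ := h.pos
  rw [h.normalized_sub_eq hτ k₀ n.zero_le, norm_mul, norm_mul, norm_div, norm_pow, h.norm_a,
    Nat.sub_zero, Nat.choose_zero_right, Nat.cast_one, inv_one, norm_one, mul_one]
  calc ‖τ‖ / ρ ^ n * ‖D z * P n z - leadingPart D τ a 0 c n z‖
      ≤ ‖τ‖ / ρ ^ n * (C * (ρ ^ n * δ ^ n)) := by gcongr; exact hle n z hz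
    _ = _ := by field_simp

theorem exists_norm_normalized_sub_le {ν : ℕ}
    (h : PoleRepresentation P D De g τ ρ ρ' a (ν + 1) c Q) (hτ : τ ≠ 0) (k₀ : Fin u) {κ : ℝ}
    (hκ0 : 0 ≤ κ) (hκ : κ < ρ) : ∃ C, 0 ≤ C ∧ ∀ n, ν + 1 ≤ n → ∀ z, ‖z‖ ≤ κ →
      ‖τ * D z / a k₀ ^ (n - (ν + 1)) * (n.choose (ν + 1) : ℂ)⁻¹ * P n z -
        ∑ k, D (a k) * c k (ν + 1) / (a k - z) *
          (a k ^ (n - (ν + 1)) / a k₀ ^ (n - (ν + 1)))‖ ≤ C / n := by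
  obtain ⟨C, hC, hle⟩ := h.exists_norm_mul_sub_leadingPart_le hκ0 hκ
  obtain ⟨A, hA, hAle⟩ := exists_pow_le_mul_choose (ν + 1)
  have hρ := h.pos
  refine ⟨‖τ‖ * A * C * ρ ^ (ν + 1), by positivity, fun n hn z hz => ?_⟩
  have hn0 : (0 : ℝ) < n := by exact_mod_cast (by omega : 0 < n)
  have hch : (0 : ℝ) < n.choose (ν + 1) := by exact_mod_cast Nat.choose_pos hn
  rw [h.normalized_sub_eq hτ k₀ hn, norm_mul, norm_mul, norm_div, norm_pow, h.norm_a, norm_inv,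
    Complex.norm_natCast]
  have h1 : ((n.choose (ν + 1) : ℕ) : ℝ)⁻¹ ≤ A / n ^ (ν + 1) := by
    rw [inv_le_comm₀ hch (by positivity), inv_div, div_le_iff₀ hA, mul_comm]
    exact hAle n hn
  calc ‖τ‖ / ρ ^ (n - (ν + 1)) * ((n.choose (ν + 1) : ℕ) : ℝ)⁻¹ *
        ‖D z * P n z - leadingPart D τ a (ν + 1) c n z‖
      ≤ ‖τ‖ / ρ ^ (n - (ν + 1)) * (A / n ^ (ν + 1)) * (C * (n ^ ν * ρ ^ n)) := by
        gcongr
        exact hle n (by omega) z hz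
    _ = ‖τ‖ / ρ ^ (n - (ν + 1)) * (A / n ^ (ν + 1)) *
        (C * (n ^ ν * (ρ ^ (n - (ν + 1)) * ρ ^ (ν + 1)))) := by
        rw [← pow_add, Nat.sub_add_cancel hn]
    _ = _ := by
        rw [pow_succ (n : ℝ) ν]
        field_simp

end PoleRepresentation

theorem mainTheorem3
    (w : Circle → ℝ) (hpos : ∀ ζ, 0 < w ζ)
    (han : ∀ θ : ℝ, AnalyticAt ℝ (fun t : ℝ => w (Circle.exp t)) θ)
    (φ : ℕ → ℂ[X]) (hφ : IsOrthonormalSystem w φ)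
    (ρ ρ' : ℝ) (hρ : ρ = szegoRadius w) (hρ'0 : 0 ≤ ρ') (hρ' : ρ' < ρ)
    -- `De` is the meromorphic continuation of `D_e` to `|z| > ρ'`
    (De : ℂ → ℂ) (hDe : ∀ z : ℂ, 1 < ‖z‖ → De z = szegoD w z)
    -- its singularities are the poles `a_1, …, a_u`, all on the circle `|z| = ρ`
    (u : ℕ) (a : Fin u → ℂ) (ha_inj : Function.Injective a) (ha_norm : ∀ k, ‖a k‖ = ρ)
    (ha_pole : ∀ k, IsPoleAt De (a k))
    (hDe_an : ∀ z : ℂ, ρ' < ‖z‖ → z ∉ Set.range a → AnalyticAt ℂ De z)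
    -- the dominant poles are `a_1, …, a_l`, of multiplicity `m`
    (l m : ℕ) (hl : 0 < l) (hlu : l ≤ u)
    (hdom : ∀ k : Fin u, IsDominantPole De {z | ρ' < ‖z‖} (a k) ↔ (k : ℕ) < l)
    (hm : ∀ k : Fin l, poleMult De (a (Fin.castLE hlu k)) = m) :
    (∀ σ : ℝ, ρ' ≤ σ → σ < ρ →
      -- automatic for `ρ' < σ`
      (∃ s M : ℝ, σ < s ∧ ∀ z : ℂ, σ < ‖z‖ → ‖z‖ < s → ‖De z‖ ≤ M) →
      ∀ r : ℝ, ρ < r → r < 1 →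
        ∃ C : ℝ, 0 < C ∧ ∀ ε : ℝ, 0 < ε → ∃ δ : ℝ, 0 < δ ∧ δ < 1 ∧
          ∀ n : ℕ, 1 ≤ n → ∃ h : ℂ → ℂ,
            ∀ z : ℂ, σ < ‖z‖ → ‖z‖ ≤ r - ε → (∀ k, z ∉ Metric.ball (a k) ε) →
              (monicOP φ n).eval z =
                De z / (szegoTau w : ℂ) * z ^ n
                + szegoD w 0 / szegoD w z *
                  ∑ k : Fin l, (n.choose (m - 1) : ℂ) *
                    a (Fin.castLE hlu k) ^ ((n : ℤ) - (m : ℤ) + 1) *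
                    (szegoD w (a (Fin.castLE hlu k)) * poleCoeff De m (a (Fin.castLE hlu k)) /
                      (a (Fin.castLE hlu k) - z))
                + h z ∧
              (m = 1 → ‖h z‖ ≤ C * (ρ ^ n * δ ^ n + r ^ (3 * n))) ∧
              (2 ≤ m → ‖h z‖ ≤ C / ε ^ m * (n : ℝ) ^ (m - 2) * ρ ^ n))
    ∧ (∀ K : Set ℂ, IsCompact K → K ⊆ Metric.ball 0 ρ →
        ∃ C δ : ℝ, 0 < C ∧ 0 < δ ∧ δ < 1 ∧ ∀ n : ℕ, 1 ≤ n → m - 1 ≤ n → ∀ z ∈ K,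
          ∀ E : ℂ, E =
            (szegoTau w : ℂ) * szegoD w z /
                a (Fin.castLE hlu ⟨0, hl⟩) ^ ((n : ℤ) - (m : ℤ) + 1) *
                (n.choose (m - 1) : ℂ)⁻¹ * (monicOP φ n).eval z
              - ∑ k : Fin l,
                  szegoD w (a (Fin.castLE hlu k)) * poleCoeff De m (a (Fin.castLE hlu k)) /
                    (a (Fin.castLE hlu k) - z) *
                  Complex.exp (2 * Real.pi * Complex.I * ((n : ℂ) - (m : ℂ) + 1) *
                    (relAngle hl (fun j => a (Fin.castLE hlu j)) k : ℂ)) →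
          (m = 1 → ‖E‖ ≤ C * δ ^ n) ∧ (2 ≤ m → ‖E‖ ≤ C / n))
    ∧ (∀ K : Set ℂ, IsCompact K → K ⊆ Metric.ball 0 ρ →
        ∃ N : ℕ, ∀ n : ℕ, N ≤ n → numZerosIn (monicOP φ n) K ≤ l - 1) := by
  have hw : Continuous w := continuous_of_analyticAt_circleExp han
  have hρ0 : 0 < ρ := hρ'0.trans_lt hρ'
  have hρ1 : ρ < 1 := by
    rw [hρ] at hρ0 ⊢
    exact szegoRadius_lt_one hρ0
  obtain ⟨μ, rfl⟩ : ∃ μ, m = μ + 1 := ⟨m - 1, by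
    have := (ha_pole (Fin.castLE hlu ⟨0, hl⟩)).poleMult_pos
    rw [hm] at this
    omega⟩
  have hmult := poleMult_le_of_isDominantPole_iff hρ' ha_inj ha_norm ha_pole hDe_an hl hlu hdom hm
  obtain ⟨D, g, c, Q, h, hD, hc⟩ := exists_poleRepresentation hpos hw hφ hρ1 hρ'0 hρ' hDe ha_inj
    ha_norm ha_pole hDe_an fun k => (hmult k).1
  have hc0 : ∀ k, c k μ ≠ 0 ↔ (k : ℕ) < l := fun k => (hc k).2.symm.trans (hmult k).2
  have hDa : ∀ k, D (a k) = szegoD w (a k) := fun k => hD _ (by rw [ha_norm]; exact hρ1)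
  have hτ : (szegoTau w : ℂ) ≠ 0 := by exact_mod_cast (Real.exp_pos _).ne'
  simp only [Nat.add_sub_cancel]
  refine ⟨fun σ hσ hσρ ⟨s, M, hs, hM⟩ r hρr hr => ?_, ?_⟩
  · obtain ⟨B, hB0, hB⟩ := h.exists_norm_Q_le (r := r) hσ hσρ hs hM
    have key : ∀ n (z : ℂ), ‖z‖ < 1 → (monicOP φ n).eval z =
        De z / (szegoTau w : ℂ) * z ^ n
        + szegoD w 0 / szegoD w z *
          ∑ k : Fin l, (n.choose μ : ℂ) *
            a (Fin.castLE hlu k) ^ ((n : ℤ) - ((μ + 1 : ℕ) : ℤ) + 1) *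
            (szegoD w (a (Fin.castLE hlu k)) * poleCoeff De (μ + 1) (a (Fin.castLE hlu k)) /
              (a (Fin.castLE hlu k) - z))
        + ((monicOP φ n).eval z - De z / (szegoTau w : ℂ) * z ^ n -
          (D z)⁻¹ * leadingPart D (szegoTau w : ℂ) a μ c n z) := fun n z hz => by
      have h1 : (D z)⁻¹ * leadingPart D (szegoTau w : ℂ) a μ c n z = szegoD w 0 / szegoD w z *
          ∑ k : Fin l, (n.choose μ : ℂ) *
            a (Fin.castLE hlu k) ^ ((n : ℤ) - ((μ + 1 : ℕ) : ℤ) + 1) *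
            (szegoD w (a (Fin.castLE hlu k)) * poleCoeff De (μ + 1) (a (Fin.castLE hlu k)) /
              (a (Fin.castLE hlu k) - z)) := by
        -- Non-dominant poles drop out because their coefficient of order m is 0, and 1/τ is D_i(0).
        rw [leadingPart, sum_eq_sum_castLE hlu, hD z hz, szegoD_zero, Finset.mul_sum,
          Finset.mul_sum]
        · refine Finset.sum_congr rfl fun k _ => ?_
          rw [choose_mul_zpow, (hc _).1, hDa]
          ring
        · intro k hk
          rw [not_not.1 (mt (hc0 k).1 hk)]
          ring
      rw [h1]
      ring
    rcases Nat.eq_zero_or_pos μ with rfl | hμ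
    · obtain ⟨C, δ, hC, hδ, hδ1, hle⟩ :=
        h.exists_norm_remainder_le_of_simple hσ hσρ hB0 hρr hr hB
      -- C + 1 only ensures strict positivity. The bound obtained is C ρ^n δ^n with δ independent of
      -- ε, so the r^(3n) term is mere slack.
      refine ⟨C + 1, by positivity, fun ε hε => ⟨δ, hδ, hδ1, fun n _ =>
        ⟨fun z => (monicOP φ n).eval z - De z / (szegoTau w : ℂ) * z ^ n -
          (D z)⁻¹ * leadingPart D (szegoTau w : ℂ) a 0 c n z, fun z hz1 hz2 hz3 =>
          ⟨key n z (by linarith), fun _ => ?_, fun h2 => by omega⟩⟩⟩⟩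
      refine (hle n z hz1 (by linarith) ?_).trans ?_
      · rintro ⟨k, rfl⟩
        exact hz3 k (Metric.mem_ball_self hε)
      · have : 0 < r := hρ0.trans hρr
        gcongr
        · linarith
        · exact le_add_of_nonneg_right (by positivity)
    · obtain ⟨ν, rfl⟩ : ∃ ν, μ = ν + 1 := ⟨μ - 1, by omega⟩
      obtain ⟨C, hC, hle⟩ := h.exists_norm_remainder_le hσ hσρ hB0 hρr hr hB
      refine ⟨C + 1, by positivity, fun ε hε => ⟨1 / 2, by norm_num, by norm_num, fun n hn =>
        ⟨fun z => (monicOP φ n).eval z - De z / (szegoTau w : ℂ) * z ^ n -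
          (D z)⁻¹ * leadingPart D (szegoTau w : ℂ) a (ν + 1) c n z, fun z hz1 hz2 hz3 =>
          ⟨key n z (by linarith), fun h1 => by omega, fun _ => ?_⟩⟩⟩⟩
      -- From 0 ≤ |z| ≤ r - ε and r < 1 follows ε ≤ 1, so ε may serve as the distance d.
      have := norm_nonneg z
      refine (hle n hn z ε hz1 (by linarith) hε (by linarith) (fun k => by
        simpa [Complex.dist_eq] using hz3 k)).trans ?_
      rw [show ν + 1 + 1 - 2 = ν by omega]
      gcongr
      linarith
  · set b : Fin l → ℂ := fun j => a (Fin.castLE hlu j) with hb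
    have hbinj : Function.Injective b := ha_inj.comp (Fin.castLE_injective hlu)
    set β : ℕ → Fin l → ℂ := fun n k => szegoD w (b k) * poleCoeff De (μ + 1) (b k) *
      Complex.exp (2 * Real.pi * Complex.I * ((n : ℂ) - ((μ + 1 : ℕ) : ℂ) + 1) *
        (relAngle hl b k : ℂ)) with hβ
    set F : ℕ → ℂ → ℂ := fun n z => (szegoTau w : ℂ) * szegoD w z /
      b ⟨0, hl⟩ ^ ((n : ℤ) - ((μ + 1 : ℕ) : ℤ) + 1) * (n.choose μ : ℂ)⁻¹ with hF
    have key : ∀ n (z : ℂ), μ ≤ n → ‖z‖ < ρ → F n z * (monicOP φ n).eval z -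
        ∑ k, β n k / (b k - z) =
        (szegoTau w : ℂ) * D z / a (Fin.castLE hlu ⟨0, hl⟩) ^ (n - μ) * (n.choose μ : ℂ)⁻¹ *
          (monicOP φ n).eval z -
        ∑ k, D (a k) * c k μ / (a k - z) *
          (a k ^ (n - μ) / a (Fin.castLE hlu ⟨0, hl⟩) ^ (n - μ)) := fun n z hn hz => by
      rw [sum_eq_sum_castLE hlu, hD z (hz.trans hρ1)]
      · congr 1
        · rw [hF, ← zpow_natCast _ (n - μ), Nat.cast_sub hn]
          simp only [hb]
          congr 4
          push_cast
          ring
        · refine Finset.sum_congr rfl fun k _ => ?_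
          rw [hβ]
          simp only
          rw [exp_relAngle_eq hl hρ0 (fun k => ha_norm _) hn, (hc _).1, hDa]
          simp only [hb]
          ring
      · intro k hk
        rw [not_not.1 (mt (hc0 k).1 hk)]
        ring
    have main : ∀ κ, 0 ≤ κ → κ < ρ → ∃ C δ : ℝ, 0 < C ∧ 0 < δ ∧ δ < 1 ∧ ∀ n : ℕ, μ ≤ n →
        ∀ z, ‖z‖ ≤ κ →
        (μ = 0 → ‖F n z * (monicOP φ n).eval z - ∑ k, β n k / (b k - z)‖ ≤ C * δ ^ n) ∧
        (1 ≤ μ → ‖F n z * (monicOP φ n).eval z - ∑ k, β n k / (b k - z)‖ ≤ C / n) := by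
      intro κ hκ0 hκ
      rcases Nat.eq_zero_or_pos μ with rfl | hμ
      · obtain ⟨C, δ, hC, hδ, hδ1, hle⟩ := h.exists_norm_normalized_sub_le_of_simple hτ
          (Fin.castLE hlu ⟨0, hl⟩) hκ
        refine ⟨C + 1, δ, by positivity, hδ, hδ1, fun n hn z hz => ⟨fun _ => ?_, by omega⟩⟩
        rw [key n z hn (hz.trans_lt hκ)]
        refine (hle n z hz).trans ?_
        gcongr
        linarith
      · obtain ⟨ν, rfl⟩ : ∃ ν, μ = ν + 1 := ⟨μ - 1, by omega⟩
        obtain ⟨C, hC, hle⟩ := h.exists_norm_normalized_sub_le hτ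
          (Fin.castLE hlu ⟨0, hl⟩) hκ0 hκ
        refine ⟨C + 1, 1 / 2, by positivity, by norm_num, by norm_num,
          fun n hn z hz => ⟨by omega, fun _ => ?_⟩⟩
        rw [key n z hn (hz.trans_lt hκ)]
        refine (hle n hn z hz).trans ?_
        gcongr
        linarith
    refine ⟨fun K hK hKρ => ?_, fun K hK hKρ => ?_⟩
    · obtain ⟨κ, hκ0, hκρ, hκ⟩ := exists_le_lt_of_isCompact_subset_ball hK hρ0 hKρ
      obtain ⟨C, δ, hC, hδ, hδ1, hle⟩ := main κ hκ0 hκρ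
      refine ⟨C, δ, hC, hδ, hδ1, fun n _ hn z hz E hE => ?_⟩
      obtain ⟨h1, h2⟩ := hle n hn z (hκ z hz)
      have h3 : E = F n z * (monicOP φ n).eval z - ∑ k, β n k / (b k - z) := by
        rw [hE]
        congr 1
        exact Finset.sum_congr rfl fun k _ => by rw [hβ]; ring
      rw [h3]
      exact ⟨fun hμ => h1 (by omega), fun hμ => h2 (by omega)⟩
    -- The exponential has modulus 1, so |β n| at the first pole is a constant; it is nonzero
    -- because that pole is dominant.
    · have hβ0 : ∀ n, ‖szegoD w (b ⟨0, hl⟩) * poleCoeff De (μ + 1) (b ⟨0, hl⟩)‖ ≤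
          ‖β n ⟨0, hl⟩‖ := fun n => by
        have h1 : (2 * Real.pi * Complex.I * ((n : ℂ) - ((μ + 1 : ℕ) : ℂ) + 1) *
            (relAngle hl b ⟨0, hl⟩ : ℂ)) = ((2 * Real.pi * ((n : ℝ) - ((μ + 1 : ℕ) : ℝ) + 1) *
            relAngle hl b ⟨0, hl⟩ : ℝ) : ℂ) * Complex.I := by
          push_cast
          ring
        rw [hβ]
        simp only
        rw [h1, norm_mul _ (Complex.exp _), Complex.norm_exp_ofReal_mul_I, mul_one]
      have hlim : ∀ q, 0 < q → q < ρ → ∃ ε : ℕ → ℝ, Tendsto ε atTop (𝓝 0) ∧ ∀ᶠ n in atTop,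
          ∀ z, ‖z‖ ≤ q → ‖F n z * (monicOP φ n).eval z - ∑ k, β n k / (b k - z)‖ ≤ ε n := by
        intro q hq0 hq
        obtain ⟨C, δ, hC, hδ, hδ1, hle⟩ := main q hq0.le hq
        rcases Nat.eq_zero_or_pos μ with hμ | hμ
        · refine ⟨fun n => C * δ ^ n, ?_, ?_⟩
          · simpa using (tendsto_pow_atTop_nhds_zero_of_lt_one hδ.le hδ1).const_mul C
          · filter_upwards [eventually_ge_atTop μ] with n hn z hz
            exact (hle n hn z hz).1 hμ
        · refine ⟨fun n => C / n, tendsto_const_div_atTop_nhds_zero_nat C, ?_⟩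
          filter_upwards [eventually_ge_atTop μ] with n hn z hz
          exact (hle n hn z hz).2 hμ
      obtain ⟨N, hN⟩ := exists_forall_numZerosIn_lt hbinj hρ0
        (fun k => ha_norm _) (fun n => (monic_monicOP hφ n).ne_zero)
        (fun n z hz => ((analyticAt_const.mul (analyticAt_szegoD hpos hw
          (hz.trans hρ1))).div analyticAt_const (zpow_ne_zero _ (norm_pos_iff.1
            (by rw [ha_norm]; exact hρ0)))).mul analyticAt_const) ⟨0, hl⟩
        (norm_pos_iff.2 (mul_ne_zero (szegoD_ne_zero _ _)
          (by rw [(hc _).1]; exact (hc0 _).2 hl))) hβ0 hlim hK hKρ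
      exact ⟨N, fun n hn => Nat.le_sub_one_of_lt (hN n hn)⟩
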